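/- Let $(X,\mathcal B,\mu)$ be a standard probability space with non-atomic $\mu$, and let $\mathrm{Aut}$ be the group of invertible $\mu$-preserving transformations of $X$, where transformations that agree almost everywhere are identified. Let $\{A_i\}_{i\ge 0}$ be any sequence of measurable sets that is dense in $\mathcal B$ with respect to $\mu(A\,\Delta\,B)$, and equip $\mathrm{Aut}$ with the Halmos metric $$\rho(S,T)=\sum_{i\ge 0} 2^{-i}\bigl(\mu(SA_i\,\Delta\, TA_i)+\mu(S^{-1}A_i\,\Delta\, T^{-1}A_i)\bigr).$$ An interval exchange transformation is a map $S$ of $[0,1)$ onto itself for which $[0,1)$ can be divided into finitely many consecutive half-open intervals $I_1,\dots,I_p$ of positive length ($p\ge 1$ arbitrary) such that $S$ acts on each $I_j$ by a translation and rearranges the intervals according to a permutation of $\{1,\dots,p\}$. A joining of $(X,\mu,T)$ with $([0,1),\lambda,S)$, where $\lambda$ is Lebesgue measure, is a $T\times S$-invariant measure on $X\times[0,1)$ whose marginals are $\mu$ and $\lambda$; $T$ and $S$ are disjoint if $\mu\times\lambda$ is their only joining. **Theorem.** The set of all $T\in\mathrm{Aut}$ that are disjoint from every ergodic interval exchange transformation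 is generic: it contains a $G_\delta$ set that is dense in $(\mathrm{Aut},\rho)$. -/

import Mathlib

open MeasureTheory
open scoped symmDiff

noncomputable section

/-! ### Transformations of a probability space -/

/-- Invertible bimeasurable measure-preserving maps of `(X, μ)`, before identification mod `0`. -/
def PreAut {X : Type*} [MeasurableSpace X] (μ : Measure X) : Type _ :=
  {e : X ≃ᵐ X // MeasurePreserving e μ μ}

/-- Coincidence almost everywhere. -/
def PreAut.setoid {X : Type*} [MeasurableSpace X] (μ : Measure X) : Setoid (PreAut μ) where
  r e f := ∀ᵐ x ∂μ, e.1 x = f.1 x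
  iseqv :=
    { refl := fun _ => Filter.Eventually.of_forall fun _ => rfl
      symm := fun h => h.mono fun _ hx => hx.symm
      trans := fun h₁ h₂ => by filter_upwards [h₁, h₂] with x h h' using h.trans h' }

/-- The set `Aut(X, μ)` of automorphisms of `(X, μ)`; two of them are identified if they agree
almost everywhere. -/
def Aut {X : Type*} [MeasurableSpace X] (μ : Measure X) : Type _ :=
  Quotient (PreAut.setoid μ)

/-! ### The Halmos metric -/

/-- The sequence `A` of measurable sets is dense in the measure algebra of `μ`, with respect to
the distance `μ (A ∆ B)`. -/
def IsDenseFamily {X : Type*} [MeasurableSpace X] (μ : Measure X) (A : ℕ → Set X) : Prop :=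
  (∀ i, MeasurableSet (A i)) ∧
    ∀ B, MeasurableSet B → ∀ ε : ℝ, 0 < ε → ∃ i, μ.real (A i ∆ B) < ε

/-- The `i`-th term `μ (S Aᵢ ∆ T Aᵢ) + μ (S⁻¹ Aᵢ ∆ T⁻¹ Aᵢ)` of the Halmos metric. -/
def PreAut.term {X : Type*} [MeasurableSpace X] {μ : Measure X} (B : Set X)
    (S T : PreAut μ) : ℝ :=
  μ.real ((S.1 '' B) ∆ (T.1 '' B)) + μ.real ((S.1 ⁻¹' B) ∆ (T.1 ⁻¹' B))

/-- `ρ(S, T) = ∑ᵢ 2⁻ⁱ (μ (S Aᵢ ∆ T Aᵢ) + μ (S⁻¹ Aᵢ ∆ T⁻¹ Aᵢ))`. -/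
def PreAut.rho {X : Type*} [MeasurableSpace X] {μ : Measure X} (A : ℕ → Set X)
    (S T : PreAut μ) : ℝ :=
  ∑' i, (1 / 2 : ℝ) ^ i * PreAut.term (A i) S T

section helpers

variable {X : Type*} [MeasurableSpace X] {μ : Measure X}

theorem PreAut.symm_ae_eq {S T : PreAut μ} (h : ∀ᵐ x ∂μ, S.1 x = T.1 x) :
    ∀ᵐ x ∂μ, S.1.symm x = T.1.symm x := by
  have hS : MeasurePreserving S.1.symm μ μ := S.2.symm S.1
  have h' : ∀ᵐ x ∂μ, S.1 (S.1.symm x) = T.1 (S.1.symm x) :=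
    hS.quasiMeasurePreserving.ae h
  filter_upwards [h'] with x hx
  rw [MeasurableEquiv.apply_symm_apply] at hx
  rw [eq_comm, hx, MeasurableEquiv.symm_apply_apply, ← hx]

theorem PreAut.term_nonneg (B : Set X) (S T : PreAut μ) : 0 ≤ PreAut.term B S T :=
  add_nonneg measureReal_nonneg measureReal_nonneg

theorem PreAut.term_self (B : Set X) (S : PreAut μ) : PreAut.term B S S = 0 := by
  simp [PreAut.term]

theorem PreAut.term_comm (B : Set X) (S T : PreAut μ) :
    PreAut.term B S T = PreAut.term B T S := by
  simp [PreAut.term, symmDiff_comm]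

theorem PreAut.term_le_two [IsProbabilityMeasure μ] (B : Set X) (S T : PreAut μ) :
    PreAut.term B S T ≤ 2 := by
  have h₁ : μ.real ((S.1 '' B) ∆ (T.1 '' B)) ≤ 1 := measureReal_le_one
  have h₂ : μ.real ((S.1 ⁻¹' B) ∆ (T.1 ⁻¹' B)) ≤ 1 := measureReal_le_one
  unfold PreAut.term
  linarith

theorem PreAut.term_triangle [IsProbabilityMeasure μ] (B : Set X) (S T U : PreAut μ) :
    PreAut.term B S U ≤ PreAut.term B S T + PreAut.term B T U := by
  have key : ∀ C D E : Set X, μ.real (C ∆ E) ≤ μ.real (C ∆ D) + μ.real (D ∆ E) := fun C D E =>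
    (measureReal_mono (symmDiff_triangle C D E)).trans (measureReal_union_le _ _)
  have h₁ := key (S.1 '' B) (T.1 '' B) (U.1 '' B)
  have h₂ := key (S.1 ⁻¹' B) (T.1 ⁻¹' B) (U.1 ⁻¹' B)
  unfold PreAut.term
  linarith

theorem PreAut.term_eq_zero_of_ae (B : Set X) {S T : PreAut μ}
    (h : ∀ᵐ x ∂μ, S.1 x = T.1 x) : PreAut.term B S T = 0 := by
  have key : ∀ e f : X ≃ᵐ X, (∀ᵐ x ∂μ, e x = f x) → μ.real ((e ⁻¹' B) ∆ (f ⁻¹' B)) = 0 := by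
    intro e f hef
    have : μ ((e ⁻¹' B) ∆ (f ⁻¹' B)) = 0 := by
      rw [measure_symmDiff_eq_zero_iff]
      filter_upwards [hef] with x hx
      exact congrArg (fun y => (y ∈ B : Prop)) hx
    simp [Measure.real, this]
  have h₁ := key _ _ h
  have h₂ := key _ _ (PreAut.symm_ae_eq h)
  unfold PreAut.term
  rw [MeasurableEquiv.image_eq_preimage_symm, MeasurableEquiv.image_eq_preimage_symm, h₁, h₂,
    add_zero]

theorem PreAut.summable_rho [IsProbabilityMeasure μ] (A : ℕ → Set X) (S T : PreAut μ) :
    Summable fun i => (1 / 2 : ℝ) ^ i * PreAut.term (A i) S T := by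
  refine Summable.of_nonneg_of_le
    (fun i => mul_nonneg (by positivity) (PreAut.term_nonneg _ _ _))
    (fun i => mul_le_mul_of_nonneg_left (PreAut.term_le_two (A i) S T) (by positivity))
    (summable_geometric_two.mul_right 2)

theorem PreAut.rho_self (A : ℕ → Set X) (S : PreAut μ) : PreAut.rho A S S = 0 := by
  simp [PreAut.rho, PreAut.term_self]

theorem PreAut.rho_comm (A : ℕ → Set X) (S T : PreAut μ) :
    PreAut.rho A S T = PreAut.rho A T S := by
  simp only [PreAut.rho, PreAut.term_comm _ S T]

theorem PreAut.rho_triangle [IsProbabilityMeasure μ] (A : ℕ → Set X) (S T U : PreAut μ) :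
    PreAut.rho A S U ≤ PreAut.rho A S T + PreAut.rho A T U := by
  unfold PreAut.rho
  rw [← (PreAut.summable_rho A S T).tsum_add (PreAut.summable_rho A T U)]
  refine (PreAut.summable_rho A S U).tsum_le_tsum (fun i => ?_)
    ((PreAut.summable_rho A S T).add (PreAut.summable_rho A T U))
  rw [← mul_add]
  exact mul_le_mul_of_nonneg_left (PreAut.term_triangle _ _ _ _) (by positivity)

theorem PreAut.rho_eq_zero_of_ae (A : ℕ → Set X) {S T : PreAut μ}
    (h : ∀ᵐ x ∂μ, S.1 x = T.1 x) : PreAut.rho A S T = 0 := by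
  simp [PreAut.rho, PreAut.term_eq_zero_of_ae _ h]

theorem PreAut.rho_congr [IsProbabilityMeasure μ] (A : ℕ → Set X) {S S' T T' : PreAut μ}
    (hS : ∀ᵐ x ∂μ, S.1 x = S'.1 x) (hT : ∀ᵐ x ∂μ, T.1 x = T'.1 x) :
    PreAut.rho A S T = PreAut.rho A S' T' := by
  have a₁ := PreAut.rho_eq_zero_of_ae A hS
  have a₂ := PreAut.rho_eq_zero_of_ae A hT
  have b₁ := PreAut.rho_comm A S S'
  have b₂ := PreAut.rho_comm A T T'
  have c₁ := PreAut.rho_triangle A S S' T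
  have c₂ := PreAut.rho_triangle A S' T' T
  have c₃ := PreAut.rho_triangle A S' S T'
  have c₄ := PreAut.rho_triangle A S T T'
  linarith

end helpers

/-- The Halmos (pseudo)metric `ρ` on `Aut(X, μ)` built from the sequence `A`; it separates points
when `A` is dense and `X` is standard. -/
abbrev halmosMetric {X : Type*} [MeasurableSpace X] (μ : Measure X) [IsProbabilityMeasure μ]
    (A : ℕ → Set X) : PseudoMetricSpace (Aut μ) where
  dist := Quotient.lift₂ (PreAut.rho A) fun _ _ _ _ h₁ h₂ => PreAut.rho_congr A h₁ h₂
  dist_self := by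
    rintro ⟨S⟩
    exact PreAut.rho_self A S
  dist_comm := by
    rintro ⟨S⟩ ⟨T⟩
    exact PreAut.rho_comm A S T
  dist_triangle := by
    rintro ⟨S⟩ ⟨T⟩ ⟨U⟩
    exact PreAut.rho_triangle A S T U

/-- A set of automorphisms is generic if it contains a `G_δ` set that is dense in
`(Aut(X, μ), ρ)`. -/
def IsGeneric {X : Type*} [MeasurableSpace X] (μ : Measure X) [IsProbabilityMeasure μ]
    (A : ℕ → Set X) (E : Set (Aut μ)) : Prop :=
  letI := halmosMetric μ A
  ∃ G : Set (Aut μ), G ⊆ E ∧ IsGδ G ∧ Dense G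

/-! ### Joinings and disjointness -/

/-- `γ` is a joining of `(X, μ, T)` and `(Y, ν, S)`: a measure on `X × Y` with marginals
`μ` and `ν` that is invariant under `T × S`. -/
structure IsJoining {X Y : Type*} [MeasurableSpace X] [MeasurableSpace Y]
    (μ : Measure X) (ν : Measure Y) (T : X → X) (S : Y → Y) (γ : Measure (X × Y)) : Prop where
  map_fst : γ.map Prod.fst = μ
  map_snd : γ.map Prod.snd = ν
  invariant : γ.map (Prod.map T S) = γ

/-- `(X, μ, T)` and `(Y, ν, S)` are disjoint: the product measure is their only joining. -/
def AreDisjoint {X Y : Type*} [MeasurableSpace X] [MeasurableSpace Y]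
    (μ : Measure X) (ν : Measure Y) (T : X → X) (S : Y → Y) : Prop :=
  ∀ γ : Measure (X × Y), IsJoining μ ν T S γ → γ = μ.prod ν

theorem IsJoining.congr_left {X Y : Type*} [MeasurableSpace X] [MeasurableSpace Y]
    {μ : Measure X} {ν : Measure Y} {T T' : X → X} {S : Y → Y} {γ : Measure (X × Y)}
    (h : ∀ᵐ x ∂μ, T x = T' x) (hγ : IsJoining μ ν T S γ) : IsJoining μ ν T' S γ where
  map_fst := hγ.map_fst
  map_snd := hγ.map_snd
  invariant := by
    have h' : ∀ᵐ z ∂γ, T z.1 = T' z.1 := by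
      rw [← hγ.map_fst] at h
      exact ae_of_ae_map measurable_fst.aemeasurable h
    rw [← Measure.map_congr (f := Prod.map T S), hγ.invariant]
    filter_upwards [h'] with z hz
    simp [Prod.map, hz]

/-- Disjointness of (the class of) an automorphism of `(X, μ)` from the system `(Y, ν, S)`. -/
def Aut.IsDisjointFrom {X Y : Type*} [MeasurableSpace X] [MeasurableSpace Y] {μ : Measure X}
    (T : Aut μ) (ν : Measure Y) (S : Y → Y) : Prop :=
  Quotient.lift (fun e : PreAut μ => AreDisjoint μ ν e.1 S)
    (fun e f (h : ∀ᵐ x ∂μ, e.1 x = f.1 x) => propext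
      ⟨fun H γ hγ => H γ (hγ.congr_left (h.mono fun _ hx => hx.symm)),
        fun H γ hγ => H γ (hγ.congr_left h)⟩) T

/-! ### Interval exchange transformations -/

/-- Lebesgue measure on `[0, 1)`. -/
def lebesgueIco : Measure (Set.Ico (0 : ℝ) 1) :=
  Measure.comap Subtype.val volume

/-- `S` is an interval exchange transformation of `[0, 1)`: `[0, 1)` is cut into consecutive
half-open intervals `I₀, …, I_{p-1}` of positive lengths `l i`, and `S` rearranges them by
translations so that `I_j` becomes the interval at position `π j`. -/
def IsIET (S : Set.Ico (0 : ℝ) 1 → Set.Ico (0 : ℝ) 1) : Prop :=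
  ∃ (p : ℕ) (l : Fin p → ℝ) (π : Equiv.Perm (Fin p)),
    (∀ i, 0 < l i) ∧ ∑ i, l i = 1 ∧
    ∀ (j : Fin p) (x : Set.Ico (0 : ℝ) 1),
      ∑ i with i < j, l i ≤ (x : ℝ) → (x : ℝ) < ∑ i with i ≤ j, l i →
      (S x : ℝ) = (x : ℝ) - (∑ i with i < j, l i) + (∑ i with π i < π j, l i)

end

open Filter Topology

/-! ### Isomorphisms of standard probability spaces -/

/-! An exchange S of p intervals is partially rigid many times over. Unless S is mostly periodic,
when this is immediate, a tall tower over a short interval G fills at least 1/(16p) of [0,1), and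
the first return to G takes at most 2(p+2) different times. Hence the first N returns follow one of
boundedly many patterns, and the columns over a frequent pattern form an almost invariant set E, of
measure bounded below in terms of p and N alone, on which S is close to the identity at N+1 widely
spaced times m_0 < ... < m_N (`IsExchange.exists_rigid`). The lengths range over a compact simplex,
so for given p, N, least gap and error one bound on these times serves all exchanges
(`exists_uniform_isRigidFor`).

These bounds define windows of times [n, M r n] before any T is chosen. A generic T mixes throughout
windows [n_r, M r n_r] with n_r → ∞: this defines a G_δ set, dense because it contains every mixing
map (`isGeneric_of_isWindowMixing`). Mixing maps are dense because some copy of a Bernoulli shift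
imitates any given map outside an event of small probability (`exists_isMixing_close`).

Now let γ be a joining of such a T with an ergodic S, let f have mean zero, I = ∫ f(x) g(y) dγ, and
let u be a continuous substitute for the indicator of E, with U = ∫ u. Rigidity allows g to be
replaced by g ∘ S^{m_i} under the weight u; invariance of γ, and the fact that almost invariant
functions decorrelate from everything when S is ergodic, then give ∫ f(T^{m_i} x) g(y) u(y) dγ ≈ I U
for every i. Averaging over i bounds |I| U by the integral of |N⁻¹ ∑ f(T^{m_i} x)| u(y), which is
small compared with U if the functions f ∘ T^{m_i} are almost orthogonal for the weight u.

The differences d = m_j - m_i lie in a window, but mixing yields orthogonality for μ, not for the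
weight. To insert the weight, choose finitely many times l_a, independent of d, such that the
average over a of (f ∘ T^{l_a}) (f ∘ T^{l_a + d}) is small in L¹(μ); shifting by l_a hardly changes
u (`IsJoining.exists_abs_integral_corr_le`). Hence I = 0. The quantifiers fit because the lower
bound for U depends only on p and N: N is fixed from I, then the errors, then r. -/

theorem not_countable_of_nullSingletonClass {X : Type*} [MeasurableSpace X] (μ : Measure X)
    [IsProbabilityMeasure μ] [NullSingletonClass μ] : ¬ Countable X := by
  intro h
  have : μ Set.univ = 0 := Set.countable_univ.measure_zero μ
  simp at this

/-- X is Borel isomorphic to the plane, and only countably many of its uncountably many disjoint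
vertical lines can have positive measure. -/
theorem exists_uncountable_null {X : Type*} [MeasurableSpace X] [StandardBorelSpace X]
    (μ : Measure X) [IsProbabilityMeasure μ] [NullSingletonClass μ] :
    ∃ C : Set X, MeasurableSet C ∧ μ C = 0 ∧ ¬ C.Countable := by
  have hX := not_countable_of_nullSingletonClass μ
  have hR : ¬ Countable (ℝ × ℝ) := by
    intro h
    have : Countable ℝ := (Prod.mk_left_injective (0 : ℝ) :
      Function.Injective fun a : ℝ => (a, (0 : ℝ))).countable
    exact Cardinal.not_countable_real (Set.countable_univ_iff.2 this)
  let e : X ≃ᵐ ℝ × ℝ := PolishSpace.measurableEquivOfNotCountable hX hR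
  let As : ℝ → Set X := fun t => {x | (e x).1 = t}
  have hm : ∀ t, MeasurableSet (As t) := fun t =>
    (measurable_fst.comp e.measurable) (measurableSet_singleton t)
  have hd : Pairwise (Function.onFun Disjoint As) := by
    intro s t hst
    refine Set.disjoint_left.2 fun x hx hx' => hst ?_
    exact (show (e x).1 = s from hx).symm.trans hx'
  have hc := Measure.countable_meas_pos_of_disjoint_iUnion (μ := μ) hm hd
  obtain ⟨t, ht⟩ : ∃ t, μ (As t) = 0 := by
    by_contra! h
    apply Cardinal.not_countable_real
    refine hc.mono fun t _ => ?_
    exact pos_iff_ne_zero.2 (h t)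
  refine ⟨As t, hm t, ht, fun hcount => ?_⟩
  have : Function.Injective fun s : ℝ => (⟨e.symm (t, s), by simp [As]⟩ : As t) := by
    intro a b hab
    have := congrArg Subtype.val hab
    simpa using this
  have hA : Countable (As t) := hcount
  have : Countable ℝ := this.countable
  exact Cardinal.not_countable_real (Set.countable_univ_iff.2 this)

/-- Points with equal codes are matched. What is left over on each side is null and contains an
uncountable null set put aside beforehand, so any Borel isomorphism between the leftovers completes
the map. -/
theorem exists_measurableEquiv_comp_ae_eq {X Y V : Type*} [MeasurableSpace X]
    [StandardBorelSpace X] [MeasurableSpace Y] [StandardBorelSpace Y] [MeasurableSpace V]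
    [StandardBorelSpace V] (μ : Measure X) [IsProbabilityMeasure μ] [NullSingletonClass μ]
    (ν : Measure Y) [IsProbabilityMeasure ν] [NullSingletonClass ν]
    {f : X → V} {g : Y → V} (hf : Measurable f) (hg : Measurable g)
    (hlaw : μ.map f = ν.map g) {X₀ : Set X} (hX₀ : MeasurableSet X₀) (hX₀' : μ X₀ᶜ = 0)
    (hfi : Set.InjOn f X₀) {Y₀ : Set Y} (hY₀ : MeasurableSet Y₀) (hY₀' : ν Y₀ᶜ = 0)
    (hgi : Set.InjOn g Y₀) :
    ∃ e : X ≃ᵐ Y, MeasurePreserving e μ ν ∧ ∀ᵐ x ∂μ, g (e x) = f x := by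
  classical
  obtain ⟨C, hC, hC0, hCu⟩ := exists_uncountable_null μ
  obtain ⟨D, hD, hD0, hDu⟩ := exists_uncountable_null ν
  set X₁ := X₀ \ C
  set Y₁ := Y₀ \ D
  have mX₁ : MeasurableSet X₁ := hX₀.diff hC
  have mY₁ : MeasurableSet Y₁ := hY₀.diff hD
  have iX₁ : Set.InjOn f X₁ := hfi.mono Set.sdiff_subset
  have iY₁ : Set.InjOn g Y₁ := hgi.mono Set.sdiff_subset
  have cX₁ : μ X₁ᶜ = 0 := by
    have : X₁ᶜ ⊆ X₀ᶜ ∪ C := by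
      intro x hx
      by_contra h
      simp only [Set.mem_union, Set.mem_compl_iff, not_or, not_not] at h
      exact hx ⟨h.1, h.2⟩
    exact measure_mono_null this (measure_union_null hX₀' hC0)
  have cY₁ : ν Y₁ᶜ = 0 := by
    have : Y₁ᶜ ⊆ Y₀ᶜ ∪ D := by
      intro x hx
      by_contra h
      simp only [Set.mem_union, Set.mem_compl_iff, not_or, not_not] at h
      exact hx ⟨h.1, h.2⟩
    exact measure_mono_null this (measure_union_null hY₀' hD0)
  set W := f '' X₁ ∩ g '' Y₁
  have mfX : MeasurableSet (f '' X₁) := mX₁.image_of_measurable_injOn hf iX₁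
  have mgY : MeasurableSet (g '' Y₁) := mY₁.image_of_measurable_injOn hg iY₁
  have mW : MeasurableSet W := mfX.inter mgY
  have nW : μ.map f Wᶜ = 0 := by
    rw [Set.compl_inter]
    refine measure_union_null ?_ ?_
    · rw [Measure.map_apply hf mfX.compl]
      refine measure_mono_null (fun x hx hx' => hx ⟨x, hx', rfl⟩) cX₁
    · rw [hlaw, Measure.map_apply hg mgY.compl]
      refine measure_mono_null (fun x hx hx' => hx ⟨x, hx', rfl⟩) cY₁
  set XW := X₁ ∩ f ⁻¹' W
  set YW := Y₁ ∩ g ⁻¹' W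
  have mXW : MeasurableSet XW := mX₁.inter (hf mW)
  have mYW : MeasurableSet YW := mY₁.inter (hg mW)
  have cXW : μ XWᶜ = 0 := by
    rw [Set.compl_inter]
    refine measure_union_null cX₁ ?_
    rw [Measure.map_apply hf mW.compl] at nW
    exact nW
  have cYW : ν YWᶜ = 0 := by
    rw [Set.compl_inter]
    refine measure_union_null cY₁ ?_
    rw [hlaw, Measure.map_apply hg mW.compl] at nW
    exact nW
  have : StandardBorelSpace XW := mXW.standardBorel
  have : StandardBorelSpace YW := mYW.standardBorel
  have : StandardBorelSpace ↑(XWᶜ) := mXW.compl.standardBorel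
  have : StandardBorelSpace ↑(YWᶜ) := mYW.compl.standardBorel
  have uX : ¬ Countable ↑(XWᶜ) := fun h => hCu <| (Set.Countable.mono
    (fun x hx => fun hx' => hx'.1.2 hx) (show XWᶜ.Countable from h))
  have uY : ¬ Countable ↑(YWᶜ) := fun h => hDu <| (Set.Countable.mono
    (fun x hx => fun hx' => hx'.1.2 hx) (show YWᶜ.Countable from h))
  have eX : MeasurableEmbedding (fun x : XW => f x) :=
    (hf.comp measurable_subtype_coe).measurableEmbedding
      (fun a b hab => Subtype.ext (iX₁ a.2.1 b.2.1 hab))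
  have eY : MeasurableEmbedding (fun x : YW => g x) :=
    (hg.comp measurable_subtype_coe).measurableEmbedding
      (fun a b hab => Subtype.ext (iY₁ a.2.1 b.2.1 hab))
  have rX : Set.range (fun x : XW => f x) = W := by
    ext v
    constructor
    · rintro ⟨x, rfl⟩
      exact x.2.2
    · intro hv
      obtain ⟨x, hx, rfl⟩ := hv.1
      exact ⟨⟨x, hx, hv⟩, rfl⟩
  have rY : Set.range (fun x : YW => g x) = W := by
    ext v
    constructor
    · rintro ⟨x, rfl⟩
      exact x.2.2
    · intro hv
      obtain ⟨x, hx, rfl⟩ := hv.2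
      exact ⟨⟨x, hx, hv⟩, rfl⟩
  have rXY : Set.range (fun x : XW => f x) = Set.range (fun x : YW => g x) := rX.trans rY.symm
  let c : Set.range (fun x : XW => f x) ≃ᵐ Set.range (fun x : YW => g x) :=
    { toEquiv := Equiv.setCongr rXY
      measurable_toFun := measurable_subtype_coe.subtype_mk
      measurable_invFun := measurable_subtype_coe.subtype_mk }
  let e₁ : XW ≃ᵐ YW := eX.equivRange.trans (c.trans eY.equivRange.symm)
  have he₁ : ∀ x, g (e₁ x) = f x := by
    intro x
    have h : eY.equivRange (e₁ x) = c (eX.equivRange x) := by simp [e₁]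
    rw [MeasurableEmbedding.equivRange_apply, MeasurableEmbedding.equivRange_apply] at h
    exact congrArg Subtype.val h
  let e₂ : ↑(XWᶜ) ≃ᵐ ↑(YWᶜ) := PolishSpace.measurableEquivOfNotCountable uX uY
  let e : X ≃ᵐ Y := (MeasurableEquiv.sumCompl mXW).symm.trans
    ((MeasurableEquiv.sumCongr e₁ e₂).trans (MeasurableEquiv.sumCompl mYW))
  have heX : ∀ x (hx : x ∈ XW), e x = e₁ ⟨x, hx⟩ := by
    intro x hx
    have : (MeasurableEquiv.sumCompl mXW).symm x = Sum.inl ⟨x, hx⟩ := by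
      rw [MeasurableEquiv.symm_apply_eq]; rfl
    simp only [e, MeasurableEquiv.trans_apply, this]
    rfl
  have hcomp : ∀ x ∈ XW, g (e x) = f x := fun x hx => by rw [heX x hx, he₁]
  have hmem : ∀ x ∈ XW, e x ∈ YW := fun x hx => by rw [heX x hx]; exact (e₁ _).2
  refine ⟨e, ⟨e.measurable, ?_⟩, ?_⟩
  · ext B hB
    rw [Measure.map_apply e.measurable hB]
    have iYW : Set.InjOn g (B ∩ YW) := iY₁.mono fun y hy => hy.2.1
    have mI : MeasurableSet (g '' (B ∩ YW)) := (hB.inter mYW).image_of_measurable_injOn hg iYW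
    have h₁ : μ (e ⁻¹' B) = μ (f ⁻¹' (g '' (B ∩ YW))) := by
      refine measure_congr ?_
      have : ∀ᵐ x ∂μ, x ∈ XW := mem_ae_iff.2 cXW
      filter_upwards [this] with x hx
      refine propext ⟨fun h => ⟨e x, ⟨h, hmem x hx⟩, hcomp x hx⟩, ?_⟩
      rintro ⟨y, hy, hyx⟩
      rw [← hcomp x hx] at hyx
      have : y = e x := iY₁ hy.2.1 (hmem x hx).1 hyx
      rw [this] at hy
      exact hy.1
    have h₂ : ν B = ν (g ⁻¹' (g '' (B ∩ YW))) := by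
      refine measure_congr ?_
      have : ∀ᵐ x ∂ν, x ∈ YW := mem_ae_iff.2 cYW
      filter_upwards [this] with y hy
      refine propext ⟨fun h => ⟨y, ⟨h, hy⟩, rfl⟩, ?_⟩
      rintro ⟨y', hy', hyx⟩
      have : y' = y := iY₁ hy'.2.1 hy.1 hyx
      rw [this] at hy'
      exact hy'.1
    rw [h₁, h₂, ← Measure.map_apply hf mI, ← Measure.map_apply hg mI, hlaw]
  · have : ∀ᵐ x ∂μ, x ∈ XW := mem_ae_iff.2 cXW
    filter_upwards [this] with x hx using hcomp x hx

/-! ### The distribution function of a measure without atoms -/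

/-- The distribution function repeats a value at a < b only if the mass between them vanishes; then
[a, r) is null for some rational r. For fixed r such a form an interval ending at r, a countable
union of null ones. -/
theorem measureReal_Iic_injOn_compl_null (m : Measure ℝ) [IsProbabilityMeasure m]
    [NullSingletonClass m] :
    ∃ N : Set ℝ, MeasurableSet N ∧ m N = 0 ∧ Set.InjOn (fun t => m.real (Set.Iic t)) Nᶜ := by
  let N : Set ℝ := ⋃ b : ℚ, {x | x < b ∧ m (Set.Ico x b) = 0}
  have key : ∀ b : ℝ, MeasurableSet {x | x < b ∧ m (Set.Ico x b) = 0} ∧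
      m {x | x < b ∧ m (Set.Ico x b) = 0} = 0 := by
    intro b
    set S := {x | x < b ∧ m (Set.Ico x b) = 0}
    have hS : ∀ x ∈ S, ∀ y, x ≤ y → y < b → y ∈ S := fun x hx y hxy hy =>
      ⟨hy, measure_mono_null (Set.Ico_subset_Ico_left hxy) hx.2⟩
    have hoc : S.OrdConnected := ⟨fun x hx y hy z hz => hS x hx z hz.1 (hz.2.trans_lt hy.1)⟩
    refine ⟨hoc.measurableSet, ?_⟩
    rcases S.eq_empty_or_nonempty with h | h
    · simp [h]
    by_cases hb : BddBelow S
    · obtain ⟨u, hu, hut, hus⟩ := exists_seq_tendsto_sInf h hb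
      by_cases hmem : sInf S ∈ S
      · exact measure_mono_null (t := Set.Ico (sInf S) b)
          (fun x hx => ⟨csInf_le hb hx, hx.1⟩) hmem.2
      · refine measure_mono_null (t := ⋃ n, Set.Ico (u n) b) (fun x hx => ?_)
          (measure_iUnion_null fun n => (hus n).2)
        have hlt : sInf S < x := lt_of_le_of_ne (csInf_le hb hx) fun h => hmem (h ▸ hx)
        obtain ⟨n, hn⟩ := (hut.eventually_lt_const hlt).exists
        exact Set.mem_iUnion.2 ⟨n, hn.le, hx.1⟩
    · refine measure_mono_null (t := ⋃ n : ℕ, Set.Ico (b - (n + 1)) b) (fun x hx => ?_)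
        (measure_iUnion_null fun n => ?_)
      · obtain ⟨n, hn⟩ := exists_nat_gt (b - x)
        exact Set.mem_iUnion.2 ⟨n, by linarith, hx.1⟩
      · rw [not_bddBelow_iff] at hb
        obtain ⟨y, hy, hyn⟩ := hb (b - (n + 1))
        exact measure_mono_null (Set.Ico_subset_Ico_left hyn.le) hy.2
  refine ⟨N, MeasurableSet.iUnion fun b => (key b).1, measure_iUnion_null fun b => (key b).2, ?_⟩
  have main : ∀ a b : ℝ, a ∉ N → a < b → m.real (Set.Iic a) ≠ m.real (Set.Iic b) := by
    intro a b ha hab heq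
    obtain ⟨r, har, hrb⟩ := exists_rat_btwn hab
    suffices h : m (Set.Ico a (r : ℝ)) = 0 from ha (Set.mem_iUnion.2 ⟨r, har, h⟩)
    have h₁ : m (Set.Iic b \ Set.Iic a) = 0 := by
      rw [measure_sdiff (Set.Iic_subset_Iic.2 hab.le) measurableSet_Iic.nullMeasurableSet
        (measure_ne_top _ _), ← ofReal_measureReal, ← ofReal_measureReal (s := Set.Iic a), heq,
        tsub_self]
    have h₂ : Set.Ico a (r : ℝ) ⊆ {a} ∪ (Set.Iic b \ Set.Iic a) := by
      intro x hx
      rcases hx.1.eq_or_lt with h | h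
      · exact Or.inl h.symm
      · exact Or.inr ⟨(hx.2.trans hrb).le, not_le.2 h⟩
    exact measure_mono_null h₂ (measure_union_null (measure_singleton a) h₁)
  intro a ha b hb hab
  rcases lt_trichotomy a b with h | h | h
  · exact absurd hab (main a b ha h)
  · exact h
  · exact absurd hab.symm (main b a hb h)

theorem measureReal_Iic_continuous (m : Measure ℝ) [IsProbabilityMeasure m]
    [NullSingletonClass m] : Continuous fun t => m.real (Set.Iic t) := by
  have h : (fun t => m.real (Set.Iic t)) = ProbabilityTheory.cdf m := by
    ext t; exact (ProbabilityTheory.cdf_eq_real m t).symm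
  rw [h, continuous_iff_continuousAt]
  intro x
  rw [(ProbabilityTheory.monotone_cdf m).continuousAt_iff_leftLim_eq_rightLim,
    (ProbabilityTheory.cdf m).rightLim_eq]
  have h₂ := (ProbabilityTheory.cdf m).measure_singleton x
  rw [ProbabilityTheory.measure_cdf, measure_singleton] at h₂
  have h₃ := (ProbabilityTheory.monotone_cdf m).leftLim_le (le_refl x)
  have h₄ := ENNReal.ofReal_eq_zero.1 h₂.symm
  linarith

/-- The probability integral transform: for 0 ≤ t < 1 a nonempty sublevel set of the continuous
distribution function F is a half-line whose endpoint has F-value exactly t. -/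
theorem map_measureReal_Iic (m : Measure ℝ) [IsProbabilityMeasure m] [NullSingletonClass m] :
    m.map (fun t => m.real (Set.Iic t)) = volume.restrict (Set.Icc 0 1) := by
  have hc := measureReal_Iic_continuous m
  have hF : (fun t => m.real (Set.Iic t)) = ProbabilityTheory.cdf m := by
    ext t; exact (ProbabilityTheory.cdf_eq_real m t).symm
  have : IsProbabilityMeasure (m.map (fun t => m.real (Set.Iic t))) :=
    Measure.isProbabilityMeasure_map hc.measurable.aemeasurable
  refine Measure.ext_of_Iic _ _ fun t => ?_
  rw [Measure.map_apply hc.measurable measurableSet_Iic, Measure.restrict_apply measurableSet_Iic]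
  have hmono : Monotone fun t => m.real (Set.Iic t) := fun a b h =>
    measureReal_mono (Set.Iic_subset_Iic.2 h)
  rcases lt_or_ge t 0 with ht | ht
  · have h₁ : (fun t => m.real (Set.Iic t)) ⁻¹' Set.Iic t = ∅ := by
      ext x
      simp only [Set.mem_preimage, Set.mem_Iic, Set.mem_empty_iff_false, iff_false, not_le]
      exact ht.trans_le measureReal_nonneg
    have h₂ : Set.Iic t ∩ Set.Icc 0 1 = ∅ := by
      ext x
      simp only [Set.mem_inter_iff, Set.mem_Iic, Set.mem_Icc, Set.mem_empty_iff_false, iff_false]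
      intro h; linarith [h.1, h.2.1]
    rw [h₁, h₂]; simp
  rcases le_or_gt 1 t with ht1 | ht1
  · have h₁ : (fun t => m.real (Set.Iic t)) ⁻¹' Set.Iic t = Set.univ := by
      ext x
      simp only [Set.mem_preimage, Set.mem_Iic, Set.mem_univ, iff_true]
      exact measureReal_le_one.trans ht1
    have h₂ : Set.Iic t ∩ Set.Icc 0 1 = Set.Icc (0 : ℝ) 1 := by
      ext x
      simp only [Set.mem_inter_iff, Set.mem_Iic, Set.mem_Icc, and_iff_right_iff_imp]
      intro h; linarith [h.2]
    rw [h₁, h₂]; simp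
  have h₂ : Set.Iic t ∩ Set.Icc 0 1 = Set.Icc (0 : ℝ) t := by
    ext x
    simp only [Set.mem_inter_iff, Set.mem_Iic, Set.mem_Icc]
    constructor
    · rintro ⟨a, b, c⟩; exact ⟨b, a⟩
    · rintro ⟨a, b⟩; exact ⟨b, a, by linarith⟩
  rw [h₂, Real.volume_Icc, sub_zero]
  set S := (fun t => m.real (Set.Iic t)) ⁻¹' Set.Iic t
  have hbd : BddAbove S := by
    have := (ProbabilityTheory.tendsto_cdf_atTop m).eventually_const_lt ht1
    obtain ⟨b, hb⟩ := this.exists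
    refine ⟨b, fun x hx => ?_⟩
    by_contra h
    push Not at h
    have h₁ := hmono h.le
    rw [← hF] at hb
    exact absurd (h₁.trans hx) (not_le.2 hb)
  rcases S.eq_empty_or_nonempty with hS | hS
  · rw [hS, measure_empty]
    rcases ht.eq_or_lt with h | h
    · simp [← h]
    · exfalso
      obtain ⟨b, hb⟩ := ((ProbabilityTheory.tendsto_cdf_atBot m).eventually_lt_const h).exists
      rw [← hF] at hb
      have : b ∈ S := hb.le
      rw [hS] at this
      exact this
  · have hmem : sSup S ∈ S := (isClosed_Iic.preimage hc).csSup_mem hS hbd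
    have hSI : S = Set.Iic (sSup S) :=
      Set.Subset.antisymm (fun x hx => le_csSup hbd hx) (fun x hx => (hmono hx).trans hmem)
    have hval : m.real (Set.Iic (sSup S)) = t := by
      refine le_antisymm hmem ?_
      by_contra h
      push Not at h
      have h₁ : ∀ᶠ x in nhdsWithin (sSup S) (Set.Ioi (sSup S)), m.real (Set.Iic x) < t :=
        (hc.continuousWithinAt (x := sSup S)).tendsto.eventually_lt_const h
      obtain ⟨x, hx, hx'⟩ := (h₁.and self_mem_nhdsWithin).exists
      exact absurd (le_csSup hbd (show x ∈ S from hx.le)) (not_le.2 hx')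
    rw [hSI, ← ofReal_measureReal, hval]

/-- An almost injective uniform code from which the label can be read off by comparison with
thresholds. The thresholds depend only on the law of the label, so codes on different spaces are
compatible. -/
theorem exists_uniform_coding {Z : Type*} [MeasurableSpace Z] [StandardBorelSpace Z]
    (κ : Measure Z) [IsProbabilityMeasure κ] [NullSingletonClass κ] {l : Z → ℕ}
    (hl : Measurable l) :
    ∃ f : Z → ℝ, Measurable f ∧ κ.map f = volume.restrict (Set.Icc 0 1) ∧
      (∃ Z₀, MeasurableSet Z₀ ∧ κ Z₀ᶜ = 0 ∧ Set.InjOn f Z₀) ∧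
      ∀ᵐ z ∂κ, ∀ i, i ≤ l z ↔ κ.real {z | l z < i} < f z := by
  have hemb := measurableEmbedding_sigmoid_comp_embeddingReal Z
  -- The integer part is the label and the fractional part an injective code; sorting by `a` sorts
  -- by label first. The code is the distribution function of `a`.
  let a : Z → ℝ := fun z => l z + ((unitInterval.sigmoid ∘ embeddingReal Z) z : ℝ)
  have ha : Measurable a := by
    have h₁ : Measurable fun z => ((l z : ℕ) : ℝ) := (measurable_from_top).comp hl
    exact h₁.add (measurable_subtype_coe.comp hemb.measurable)
  have hs0 : ∀ z, 0 < ((unitInterval.sigmoid ∘ embeddingReal Z) z : ℝ) := fun z =>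
    Real.sigmoid_pos _
  have hs1 : ∀ z, ((unitInterval.sigmoid ∘ embeddingReal Z) z : ℝ) < 1 := fun z =>
    Real.sigmoid_lt_one _
  have hai : ∀ z i, (i : ℕ) ≤ l z ↔ (i : ℝ) < a z := by
    intro z i
    constructor
    · intro h
      have : (i : ℝ) ≤ l z := by exact_mod_cast h
      have := hs0 z
      simp only [a]; linarith
    · intro h
      by_contra hc
      have : (l z : ℝ) + 1 ≤ i := by exact_mod_cast not_le.1 hc
      have := hs1 z
      simp only [a] at h; linarith
  have hainj : Function.Injective a := by
    intro x y hxy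
    have hl' : l x = l y := by
      refine le_antisymm ?_ ?_
      · rw [hai, ← hxy, ← hai]
      · rw [hai, hxy, ← hai]
    refine hemb.injective (Subtype.ext ?_)
    simpa [a, hl'] using hxy
  have : IsProbabilityMeasure (κ.map a) := Measure.isProbabilityMeasure_map ha.aemeasurable
  have : NullSingletonClass (κ.map a) := by
    refine ⟨fun t => ?_⟩
    rw [Measure.map_apply ha (measurableSet_singleton t)]
    exact (Set.subsingleton_singleton.preimage hainj).measure_zero κ
  have hFm := (measureReal_Iic_continuous (κ.map a)).measurable
  obtain ⟨N, hN, hN0, hNi⟩ := measureReal_Iic_injOn_compl_null (κ.map a)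
  refine ⟨fun z => (κ.map a).real (Set.Iic (a z)), hFm.comp ha, ?_, ⟨a ⁻¹' Nᶜ, ha hN.compl, ?_, ?_⟩,
    ?_⟩
  · rw [← map_measureReal_Iic (κ.map a), Measure.map_map hFm ha]
    rfl
  · rw [Measure.map_apply ha hN] at hN0
    rw [← Set.preimage_compl, compl_compl]
    exact hN0
  · intro x hx y hy hxy
    exact hainj (hNi hx hy hxy)
  · have hlt : ∀ i : ℕ, κ.real {z | l z < i} = (κ.map a).real (Set.Iic (i : ℝ)) := by
      intro i
      rw [measureReal_def, measureReal_def, Measure.map_apply ha measurableSet_Iic]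
      congr 2
      ext z
      have := hai z i
      simp only [Set.mem_ofPred_eq, Set.mem_preimage, Set.mem_Iic]
      rw [← not_le, this, not_lt]
    have h₀ : ∀ᵐ z ∂κ, a z ∈ Nᶜ := by
      rw [Measure.map_apply ha hN] at hN0
      exact measure_eq_zero_iff_ae_notMem.1 hN0
    -- The code is uniform, so it almost never equals one of the countably many thresholds; this
    -- makes the comparison strict.
    have h₁ : ∀ᵐ z ∂κ, ∀ i : ℕ,
        (κ.map a).real (Set.Iic (a z)) ≠ (κ.map a).real (Set.Iic (i : ℝ)) := by
      rw [ae_all_iff]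
      intro i
      have h := map_measureReal_Iic (κ.map a)
      have h' : (κ.map a).map (fun t => (κ.map a).real (Set.Iic t))
          {(κ.map a).real (Set.Iic (i : ℝ))} = 0 := by
        rw [h]; exact measure_singleton _
      rw [Measure.map_apply hFm (measurableSet_singleton _),
        Measure.map_apply ha (hFm (measurableSet_singleton _))] at h'
      exact measure_eq_zero_iff_ae_notMem.1 h'
    filter_upwards [h₁] with z hz i
    rw [hlt, hai]
    constructor
    · intro h
      exact lt_of_le_of_ne (measureReal_mono (Set.Iic_subset_Iic.2 h.le)) (hz i).symm
    · intro h
      by_contra hc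
      exact absurd h (not_lt.2 (measureReal_mono (Set.Iic_subset_Iic.2 (not_lt.1 hc))))

/-- Equal laws of the labels give equal thresholds, so matching the uniform codes also matches the
labels. -/
theorem exists_measurableEquiv_label_ae_eq {X Y : Type*} [MeasurableSpace X]
    [StandardBorelSpace X] [MeasurableSpace Y] [StandardBorelSpace Y]
    (μ : Measure X) [IsProbabilityMeasure μ] [NullSingletonClass μ]
    (ν : Measure Y) [IsProbabilityMeasure ν] [NullSingletonClass ν]
    {q : X → ℕ} {r : Y → ℕ} (hq : Measurable q) (hr : Measurable r)
    (hlaw : μ.map q = ν.map r) :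
    ∃ e : X ≃ᵐ Y, MeasurePreserving e μ ν ∧ ∀ᵐ x ∂μ, r (e x) = q x := by
  obtain ⟨f, hf, hfl, ⟨X₀, hX₀, hX₀', hfi⟩, hfq⟩ := exists_uniform_coding μ hq
  obtain ⟨g, hg, hgl, ⟨Y₀, hY₀, hY₀', hgi⟩, hgr⟩ := exists_uniform_coding ν hr
  obtain ⟨e, he, hge⟩ := exists_measurableEquiv_comp_ae_eq μ ν hf hg (hfl.trans hgl.symm)
    hX₀ hX₀' hfi hY₀ hY₀' hgi
  refine ⟨e, he, ?_⟩
  have hS : ∀ i : ℕ, μ.real {z | q z < i} = ν.real {z | r z < i} := by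
    intro i
    have h₁ := Measure.map_apply (μ := μ) hq (measurableSet_Iio (a := i))
    have h₂ := Measure.map_apply (μ := ν) hr (measurableSet_Iio (a := i))
    rw [hlaw, h₂] at h₁
    simp only [measureReal_def]
    exact congrArg ENNReal.toReal h₁.symm
  filter_upwards [hge, hfq, he.quasiMeasurePreserving.ae hgr] with x h₁ h₂ h₃
  refine le_antisymm ?_ ?_
  · rw [h₂, hS, ← h₁, ← h₃]
  · rw [h₃, ← hS, h₁, ← h₂]

/-! ### The two-sided shift -/

/-- The two-sided shift on `W ^ ℤ`. -/
def zshift (W : Type*) [MeasurableSpace W] : (ℤ → W) ≃ᵐ (ℤ → W) where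
  toFun ω k := ω (k + 1)
  invFun ω k := ω (k - 1)
  left_inv ω := by ext k; simp
  right_inv ω := by ext k; simp
  measurable_toFun := measurable_pi_lambda _ fun k => measurable_pi_apply _
  measurable_invFun := measurable_pi_lambda _ fun k => measurable_pi_apply _

theorem zshift_apply {W : Type*} [MeasurableSpace W] (ω : ℤ → W) (k : ℤ) :
    zshift W ω k = ω (k + 1) := rfl

theorem zshift_iterate_apply {W : Type*} [MeasurableSpace W] (n : ℕ) (ω : ℤ → W) (k : ℤ) :
    (zshift W)^[n] ω k = ω (k + n) := by
  induction n generalizing ω with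
  | zero => simp
  | succ n ih =>
    rw [Function.iterate_succ_apply, ih, zshift_apply]
    congr 1
    push_cast
    ring

section Shift

variable {W : Type*} [MeasurableSpace W] (ν : Measure W) [IsProbabilityMeasure ν]

theorem measurePreserving_zshift : MeasurePreserving (zshift W)
    (Measure.infinitePi fun _ : ℤ => ν) (Measure.infinitePi fun _ : ℤ => ν) :=
  ⟨(zshift W).measurable,
    Measure.map_infinitePi_infinitePi_of_inj (P := fun _ : ℤ => ν) (add_left_injective (1 : ℤ))⟩

/-- Once n exceeds max s - min t, the coordinates t + n lie to the right of s, and the two events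
are independent. -/
theorem zshift_inter_cylinder {s t : Finset ℤ} {S : Set (s → W)} {R : Set (t → W)}
    (hS : MeasurableSet S) (hR : MeasurableSet R) :
    ∀ᶠ n : ℕ in atTop, (Measure.infinitePi fun _ : ℤ => ν)
      (cylinder (α := fun _ : ℤ => W) s S ∩
        (zshift W)^[n] ⁻¹' cylinder (α := fun _ : ℤ => W) t R) =
      (Measure.infinitePi fun _ : ℤ => ν) (cylinder (α := fun _ : ℤ => W) s S) *
      (Measure.infinitePi fun _ : ℤ => ν) (cylinder (α := fun _ : ℤ => W) t R) := by
  obtain ⟨b, hb⟩ := s.bddAbove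
  obtain ⟨a, ha⟩ := t.bddBelow
  filter_upwards [eventually_gt_atTop (b - a).toNat] with n hn
  have hmp := (measurePreserving_zshift ν).iterate n
  rw [← hmp.measure_preimage (MeasurableSet.cylinder t hR).nullMeasurableSet]
  let t' : Finset ℤ := t.map (addRightEmbedding (n : ℤ))
  have hdis : Disjoint s t' := by
    rw [Finset.disjoint_left]
    intro i hi hi'
    obtain ⟨j, hj, rfl⟩ := Finset.mem_map.1 hi'
    have h₁ := hb hi
    have h₂ := ha hj
    simp only [addRightEmbedding_apply] at h₁
    have := Int.self_le_toNat (b - a)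
    have : ((b - a).toNat : ℤ) < n := by exact_mod_cast hn
    linarith
  have hind := (ProbabilityTheory.iIndepFun_infinitePi (P := fun _ : ℤ => ν)
    (X := fun _ w => w) (fun _ => measurable_id)).indepFun_finset s t' hdis
    (fun i => measurable_pi_apply i)
  let ψ : (t' → W) → (t → W) := fun v i =>
    v ⟨i + n, Finset.mem_map.2 ⟨i, i.2, rfl⟩⟩
  have hψ : Measurable ψ := measurable_pi_lambda _ fun i => measurable_pi_apply _
  have := hind.measure_inter_preimage_eq_mul S (ψ ⁻¹' R) hS (hψ hR)
  have e : (zshift W)^[n] ⁻¹' cylinder (α := fun _ : ℤ => W) t R =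
      (fun ω (i : t') => ω (i : ℤ)) ⁻¹' (ψ ⁻¹' R) := by
    ext ω
    simp only [Set.mem_preimage, mem_cylinder]
    refine iff_of_eq (congrArg (· ∈ R) ?_)
    ext i
    simp [ψ, Finset.restrict, zshift_iterate_apply]
  rw [e]
  exact this

end Shift

/-- A measure preserving map is mixing if `μ (A ∩ T⁻ⁿ B) → μ A * μ B` for all measurable
`A`, `B`. -/
def IsMixing {X : Type*} [MeasurableSpace X] (μ : Measure X) (T : X → X) : Prop :=
  ∀ A B, MeasurableSet A → MeasurableSet B →
    Tendsto (fun n => μ.real (A ∩ T^[n] ⁻¹' B)) atTop (𝓝 (μ.real A * μ.real B))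

theorem abs_measureReal_sub_le_symmDiff {X : Type*} [MeasurableSpace X] (μ : Measure X)
    [IsFiniteMeasure μ] (A B : Set X) : |μ.real A - μ.real B| ≤ μ.real (A ∆ B) := by
  have key : ∀ C D : Set X, μ.real C ≤ μ.real D + μ.real (C ∆ D) := fun C D => by
    refine (measureReal_mono (s₂ := D ∪ C ∆ D) ?_).trans (measureReal_union_le _ _)
    intro x hx
    by_cases h : x ∈ D
    · exact Or.inl h
    · exact Or.inr (Or.inl ⟨hx, h⟩)
  have h₁ := key A B
  have h₂ := key B A
  rw [symmDiff_comm] at h₂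
  rw [abs_le]
  constructor <;> linarith

/-! ### Mixing of the Bernoulli shift, and finite labels -/

/-- Correlations are Lipschitz in both sets, uniformly over measure preserving maps, so mixing need
only be tested on a dense family of sets. -/
theorem abs_corr_sub_le {X : Type*} [MeasurableSpace X] {μ : Measure X}
    [IsProbabilityMeasure μ] {R : X → X} (hR : MeasurePreserving R μ μ) {A A' B B' : Set X}
    (hB : MeasurableSet B) (hB' : MeasurableSet B') :
    |(μ.real (A ∩ R ⁻¹' B) - μ.real A * μ.real B) -
      (μ.real (A' ∩ R ⁻¹' B') - μ.real A' * μ.real B')| ≤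
      2 * (μ.real (A ∆ A') + μ.real (B ∆ B')) := by
  have h₁ : |μ.real (A ∩ R ⁻¹' B) - μ.real (A' ∩ R ⁻¹' B')| ≤ μ.real (A ∆ A') + μ.real (B ∆ B') := by
    refine (abs_measureReal_sub_le_symmDiff μ _ _).trans ?_
    have : μ.real (B ∆ B') = μ.real (R ⁻¹' (B ∆ B')) :=
      congrArg ENNReal.toReal (hR.measure_preimage (hB.symmDiff hB').nullMeasurableSet).symm
    rw [this]
    refine (measureReal_mono ?_).trans (measureReal_union_le _ _)
    rintro x (⟨⟨h, h'⟩, h''⟩ | ⟨⟨h, h'⟩, h''⟩)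
    · by_cases hx : x ∈ A'
      · exact Or.inr (Or.inl ⟨h', fun hb => h'' ⟨hx, hb⟩⟩)
      · exact Or.inl (Or.inl ⟨h, hx⟩)
    · by_cases hx : x ∈ A
      · exact Or.inr (Or.inr ⟨h', fun hb => h'' ⟨hx, hb⟩⟩)
      · exact Or.inl (Or.inr ⟨h, hx⟩)
  have h₂ : |μ.real A * μ.real B - μ.real A' * μ.real B'| ≤ μ.real (A ∆ A') + μ.real (B ∆ B') := by
    have e : μ.real A * μ.real B - μ.real A' * μ.real B' =
      (μ.real A - μ.real A') * μ.real B + μ.real A' * (μ.real B - μ.real B') := by ring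
    have a₁ := abs_measureReal_sub_le_symmDiff μ A A'
    have a₂ := abs_measureReal_sub_le_symmDiff μ B B'
    rw [e]
    refine (abs_add_le _ _).trans (add_le_add ?_ ?_)
    · rw [abs_mul, abs_of_nonneg (measureReal_nonneg (μ := μ) (s := B))]
      exact (mul_le_of_le_one_right (abs_nonneg _) measureReal_le_one).trans a₁
    · rw [abs_mul, abs_of_nonneg (measureReal_nonneg (μ := μ) (s := A'))]
      exact (mul_le_of_le_one_left (abs_nonneg _) measureReal_le_one).trans a₂
  have e : (μ.real (A ∩ R ⁻¹' B) - μ.real A * μ.real B) -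
      (μ.real (A' ∩ R ⁻¹' B') - μ.real A' * μ.real B') =
      (μ.real (A ∩ R ⁻¹' B) - μ.real (A' ∩ R ⁻¹' B')) -
      (μ.real A * μ.real B - μ.real A' * μ.real B') := by ring
  rw [e]
  refine (abs_sub _ _).trans ?_
  linarith

theorem isMixing_zshift {W : Type*} [MeasurableSpace W] (ν : Measure W) [IsProbabilityMeasure ν] :
    IsMixing (Measure.infinitePi fun _ : ℤ => ν) (zshift W) := by
  intro A B hA hB
  set P := Measure.infinitePi fun _ : ℤ => ν
  have hdense : P.MeasureDense (measurableCylinders fun _ : ℤ => W) :=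
    Measure.MeasureDense.of_generateFrom_isSetAlgebra_finite P
      ⟨empty_mem_measurableCylinders _, fun _ => compl_mem_measurableCylinders,
        fun _ _ => union_mem_measurableCylinders⟩ generateFrom_measurableCylinders.symm
  rw [Metric.tendsto_atTop]
  intro ε hε
  obtain ⟨A', hA', hAA'⟩ := hdense.approx A hA (measure_ne_top _ _) (ε / 4) (by positivity)
  obtain ⟨B', hB', hBB'⟩ := hdense.approx B hB (measure_ne_top _ _) (ε / 4) (by positivity)
  have mB' := hdense.measurable B' hB'
  obtain ⟨s, S, hS, rfl⟩ := (mem_measurableCylinders A').1 hA'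
  obtain ⟨t, R, hR, rfl⟩ := (mem_measurableCylinders B').1 hB'
  obtain ⟨N, hN⟩ := eventually_atTop.1 (zshift_inter_cylinder ν hS hR)
  refine ⟨N, fun n hn => ?_⟩
  have h₁ := abs_corr_sub_le ((measurePreserving_zshift ν).iterate n) (A := A)
    (A' := cylinder s S) hB mB'
  have h₂ := hN n hn
  have h₃ : P.real (cylinder s S ∩ (zshift W)^[n] ⁻¹' cylinder t R) -
      P.real (cylinder s S) * P.real (cylinder t R) = 0 := by
    rw [measureReal_def, h₂, ENNReal.toReal_mul, measureReal_def, measureReal_def, sub_self]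
  have h₄ : P.real (A ∆ cylinder s S) < ε / 4 := by
    rw [measureReal_def]
    exact (ENNReal.lt_ofReal_iff_toReal_lt (measure_ne_top _ _)).1 hAA'
  have h₅ : P.real (B ∆ cylinder t R) < ε / 4 := by
    rw [measureReal_def]
    exact (ENNReal.lt_ofReal_iff_toReal_lt (measure_ne_top _ _)).1 hBB'
  rw [h₃, sub_zero] at h₁
  rw [Real.dist_eq]
  linarith

/-- The label records which of the sets contain the point, that is, the atom of the finite algebra
they generate. -/
theorem exists_nat_label {X : Type*} [MeasurableSpace X] {m : ℕ} (C : Fin m → Set X)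
    (hC : ∀ i, MeasurableSet (C i)) :
    ∃ q : X → ℕ, Measurable q ∧ ∀ i, ∃ S : Set ℕ, C i = q ⁻¹' S := by
  classical
  let v : X → (Fin m → Bool) := fun x i => decide (x ∈ C i)
  have hv : Measurable v := measurable_pi_lambda _ fun i => measurable_to_bool <| by
    convert hC i using 1
    ext x; simp [v]
  refine ⟨fun x => Encodable.encode (v x), (Measurable.of_discrete (f := Encodable.encode)).comp hv, fun i =>
    ⟨Encodable.encode '' {w : Fin m → Bool | w i = true}, ?_⟩⟩
  ext x
  simp only [Set.mem_preimage, Set.mem_image, Encodable.encode_inj]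
  constructor
  · intro h
    exact ⟨v x, by simpa [v] using h, rfl⟩
  · rintro ⟨w, hw, rfl⟩
    simpa [v] using hw

/-! ### A Bernoulli extension shadowing a given transformation -/

section Refresh

variable {X : Type*}

open Classical in
/-- The state at time `0`: the last refreshed letter, transported by `T` to time `0`. -/
noncomputable def refreshState (T : X → X) (ω : ℤ → X × Bool) : X :=
  if h : ∃ k : ℕ, (ω (-k)).2 = true then T^[Nat.find h] (ω (-(Nat.find h : ℕ))).1 else (ω 0).1

theorem refreshState_eq (T : X → X) {ω : ℤ → X × Bool} {k : ℕ}
    (h : (ω (-k)).2 = true) (h' : ∀ i < k, (ω (-(i : ℕ))).2 = false) :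
    refreshState T ω = T^[k] (ω (-k)).1 := by
  classical
  have hex : ∃ k : ℕ, (ω (-k)).2 = true := ⟨k, h⟩
  have : Nat.find hex = k := by
    rw [Nat.find_eq_iff]
    exact ⟨h, fun i hi => by rw [h' i hi]; simp⟩
  rw [refreshState, dif_pos hex, this]

/-- The last refreshment before time `0` took place `k` steps ago. -/
def refreshSet (X : Type*) (k : ℕ) : Set (ℤ → X × Bool) :=
  {ω | (ω (-k)).2 = true ∧ ∀ i < k, (ω (-(i : ℕ))).2 = false}

theorem pairwise_disjoint_refreshSet :
    Pairwise (Function.onFun Disjoint (refreshSet X)) := by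
  intro k l hkl
  refine Set.disjoint_left.2 fun ω hk hl => ?_
  rcases lt_or_gt_of_ne hkl with h | h
  · have := hl.2 k h; rw [hk.1] at this; simp at this
  · have := hk.2 l h; rw [hl.1] at this; simp at this

theorem mem_iUnion_refreshSet {ω : ℤ → X × Bool} (h : ∃ k : ℕ, (ω (-k)).2 = true) :
    ω ∈ ⋃ k, refreshSet X k := by
  classical
  refine Set.mem_iUnion.2 ⟨Nat.find h, Nat.find_spec h, fun i hi => ?_⟩
  simpa using Nat.find_min h hi

variable [MeasurableSpace X]

theorem measurableSet_coord_snd (j : ℤ) (b : Bool) :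
    MeasurableSet {ω : ℤ → X × Bool | (ω j).2 = b} :=
  (measurable_snd.comp (measurable_pi_apply j)) (measurableSet_singleton b)

theorem measurableSet_refreshSet (k : ℕ) : MeasurableSet (refreshSet X k) := by
  have : refreshSet X k = {ω : ℤ → X × Bool | (ω (-k)).2 = true} ∩
      ⋂ i : ℕ, ⋂ _ : i < k, {ω : ℤ → X × Bool | (ω (-(i : ℤ))).2 = false} := by
    ext ω; simp [refreshSet]
  rw [this]
  exact (measurableSet_coord_snd _ _).inter (MeasurableSet.iInter fun i =>
    MeasurableSet.iInter fun _ => measurableSet_coord_snd _ _)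

theorem measurable_refreshState {T : X → X} (hT : Measurable T) :
    Measurable (refreshState T) := by
  intro A hA
  have : refreshState T ⁻¹' A =
      (⋃ k : ℕ, refreshSet X k ∩ {ω | T^[k] (ω (-k)).1 ∈ A}) ∪
      ((⋃ k : ℕ, {ω : ℤ → X × Bool | (ω (-k)).2 = true})ᶜ ∩ {ω | (ω 0).1 ∈ A}) := by
    ext ω
    simp only [Set.mem_preimage, Set.mem_union, Set.mem_iUnion, Set.mem_inter_iff,
      Set.mem_compl_iff, Set.mem_ofPred_eq]
    by_cases h : ∃ k : ℕ, (ω (-k)).2 = true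
    · obtain ⟨k, hk⟩ := Set.mem_iUnion.1 (mem_iUnion_refreshSet h)
      rw [refreshState_eq T hk.1 hk.2]
      constructor
      · exact fun hA => Or.inl ⟨k, hk, hA⟩
      · rintro (⟨l, hl, hlA⟩ | ⟨hn, -⟩)
        · by_cases hkl : k = l
          · rwa [hkl]
          · exact absurd hl (Set.disjoint_left.1 (pairwise_disjoint_refreshSet hkl) hk)
        · exact absurd h hn
    · rw [refreshState, dif_neg h]
      constructor
      · exact fun hA => Or.inr ⟨h, hA⟩
      · rintro (⟨l, hl, -⟩ | ⟨-, hA⟩)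
        · exact absurd ⟨l, hl.1⟩ h
        · exact hA
  rw [this]
  refine MeasurableSet.union (MeasurableSet.iUnion fun k => (measurableSet_refreshSet k).inter ?_)
    ((MeasurableSet.iUnion fun k => measurableSet_coord_snd _ _).compl.inter ?_)
  · exact ((hT.iterate k).comp (measurable_fst.comp (measurable_pi_apply _))) hA
  · exact (measurable_fst.comp (measurable_pi_apply _)) hA

variable (μ : Measure X) [IsProbabilityMeasure μ] (β : Measure Bool) [IsProbabilityMeasure β]

theorem refreshSet_inter_measure {A : Set X} (hA : MeasurableSet A) (k : ℕ) :
    (Measure.infinitePi fun _ : ℤ => μ.prod β) (refreshSet X k ∩ {ω | (ω (-k)).1 ∈ A}) =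
      β {false} ^ k * β {true} * μ A := by
  let t : ℤ → Set (X × Bool) := fun j => if j = -k then A ×ˢ {true} else Set.univ ×ˢ {false}
  have ht : ∀ j, MeasurableSet (t j) := by
    intro j
    simp only [t]
    split_ifs
    · exact hA.prod (measurableSet_singleton _)
    · exact MeasurableSet.univ.prod (measurableSet_singleton _)
  let s : Finset ℤ := (Finset.range (k + 1)).image fun i : ℕ => -(i : ℤ)
  have hset : refreshSet X k ∩ {ω | (ω (-k)).1 ∈ A} = Set.pi s t := by
    ext ω
    simp only [refreshSet, Set.mem_inter_iff, Set.mem_ofPred_eq, Set.mem_pi, s, Finset.coe_image,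
      Set.mem_image, Finset.coe_range, Set.mem_Iio, forall_exists_index, and_imp]
    constructor
    · rintro ⟨⟨h₁, h₂⟩, h₃⟩ j i hi rfl
      rcases (Nat.lt_succ_iff.1 hi).eq_or_lt with h | h
      · subst h
        simp only [t, if_true]
        exact ⟨h₃, h₁⟩
      · simp only [t]
        rw [if_neg (by simpa using h.ne)]
        exact ⟨trivial, h₂ i h⟩
    · intro h
      have hk := h (-k) k (Nat.lt_succ_self k) rfl
      simp only [t, if_true] at hk
      refine ⟨⟨hk.2, fun i hi => ?_⟩, hk.1⟩
      have := h (-i) i (hi.trans (Nat.lt_succ_self k)) rfl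
      simp only [t] at this
      rw [if_neg (by simpa using hi.ne)] at this
      exact this.2
  rw [hset, Measure.infinitePi_pi _ fun i _ => ht i, Finset.prod_image (by
    intro a _ b _ h; simpa using h), Finset.prod_range_succ]
  have h₁ : ∀ i ∈ Finset.range k, (μ.prod β) (t (-(i : ℤ))) = β {false} := by
    intro i hi
    simp only [t]
    rw [if_neg (by simpa using (Finset.mem_range.1 hi).ne), Measure.prod_prod]
    simp
  rw [Finset.prod_congr rfl h₁, Finset.prod_const, Finset.card_range]
  simp only [t, if_true, Measure.prod_prod]
  rw [mul_comm (μ A), mul_assoc]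

theorem ae_exists_refresh (hβ : β {true} ≠ 0) :
    ∀ᵐ ω ∂(Measure.infinitePi fun _ : ℤ => μ.prod β), ∃ k : ℕ, (ω (-k)).2 = true := by
  set P := Measure.infinitePi fun _ : ℤ => μ.prod β
  have hlt : β {false} < 1 := by
    have h : β {false} + β {true} = 1 := by
      rw [← measure_union (by simp) (measurableSet_singleton _), ← measure_univ (μ := β)]
      congr 1
      ext b; cases b <;> simp
    rw [← h]
    exact ENNReal.lt_add_right (measure_ne_top _ _) hβ
  have hsum : P (⋃ k, refreshSet X k) = 1 := by
    rw [measure_iUnion pairwise_disjoint_refreshSet measurableSet_refreshSet]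
    have h₁ : ∀ k, P (refreshSet X k) = β {false} ^ k * β {true} := by
      intro k
      have := refreshSet_inter_measure μ β MeasurableSet.univ k
      simpa using this
    simp_rw [h₁]
    rw [ENNReal.tsum_mul_right, ENNReal.tsum_geometric]
    have h : β {true} = 1 - β {false} := by
      rw [← prob_compl_eq_one_sub (measurableSet_singleton _)]
      congr 1
      ext b; cases b <;> simp
    rw [h]
    refine ENNReal.inv_mul_cancel (tsub_pos_of_lt hlt).ne' (by finiteness)
  have hae : ∀ᵐ ω ∂P, ω ∈ ⋃ k, refreshSet X k :=
    (mem_ae_iff_prob_eq_one (MeasurableSet.iUnion measurableSet_refreshSet)).2 hsum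
  filter_upwards [hae] with ω hω
  obtain ⟨k, hk⟩ := Set.mem_iUnion.1 hω
  exact ⟨k, hk.1⟩

/-- If the last refreshment took place k steps ago, the state is T^k of a letter distributed by μ
and independent of the coins, hence again has law μ. -/
theorem map_refreshState (hβ : β {true} ≠ 0) {T : X → X} (hT : MeasurePreserving T μ μ) :
    (Measure.infinitePi fun _ : ℤ => μ.prod β).map (refreshState T) = μ := by
  set P := Measure.infinitePi fun _ : ℤ => μ.prod β
  have hm := measurable_refreshState hT.measurable
  have hae := ae_exists_refresh μ β hβ
  have key : ∀ A, MeasurableSet A → P (refreshState T ⁻¹' A) =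
      ∑' k, β {false} ^ k * β {true} * μ A := by
    intro A hA
    have h₁ : P (refreshState T ⁻¹' A) =
        P (⋃ k, refreshSet X k ∩ {ω | (ω (-k)).1 ∈ T^[k] ⁻¹' A}) := by
      refine measure_congr ?_
      filter_upwards [hae] with ω hω
      obtain ⟨k, hk⟩ := Set.mem_iUnion.1 (mem_iUnion_refreshSet hω)
      refine propext ?_
      change refreshState T ω ∈ A ↔ ω ∈ ⋃ k, refreshSet X k ∩ {ω | (ω (-k)).1 ∈ T^[k] ⁻¹' A}
      rw [refreshState_eq T hk.1 hk.2, Set.mem_iUnion]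
      constructor
      · exact fun h => ⟨k, hk, h⟩
      · rintro ⟨l, hl, hlA⟩
        by_cases hkl : k = l
        · rw [hkl]; exact hlA
        · exact absurd hl (Set.disjoint_left.1 (pairwise_disjoint_refreshSet hkl) hk)
    rw [h₁, measure_iUnion]
    · refine tsum_congr fun k => ?_
      rw [refreshSet_inter_measure μ β ((hT.measurable.iterate k) hA),
        (hT.iterate k).measure_preimage hA.nullMeasurableSet]
    · intro k l hkl
      exact (pairwise_disjoint_refreshSet hkl).mono Set.inter_subset_left Set.inter_subset_left
    · intro k
      exact (measurableSet_refreshSet k).inter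
        ((measurable_fst.comp (measurable_pi_apply _)) ((hT.measurable.iterate k) hA))
  ext A hA
  rw [Measure.map_apply hm hA, key A hA, ENNReal.tsum_mul_right]
  -- Taking the whole space shows that the geometric weights sum to one.
  have := key Set.univ MeasurableSet.univ
  rw [ENNReal.tsum_mul_right, measure_univ, mul_one, Set.preimage_univ, measure_univ] at this
  rw [← this, one_mul]

/-- Without a refreshment at time 1 the last refreshment stays the same and only becomes one step
older. -/
theorem refreshState_zshift (hβ : β {true} ≠ 0) (T : X → X) :
    ∀ᵐ ω ∂(Measure.infinitePi fun _ : ℤ => μ.prod β), (ω 1).2 = false →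
      refreshState T (zshift _ ω) = T (refreshState T ω) := by
  filter_upwards [ae_exists_refresh μ β hβ] with ω hω h1
  obtain ⟨k, hk⟩ := Set.mem_iUnion.1 (mem_iUnion_refreshSet hω)
  have e : ∀ i : ℕ, -((i + 1 : ℕ) : ℤ) + 1 = -i := fun i => by push_cast; ring
  rw [refreshState_eq T hk.1 hk.2, refreshState_eq T (k := k + 1) (ω := zshift _ ω),
    zshift_apply, e, Function.iterate_succ_apply']
  · rw [zshift_apply, e]; exact hk.1
  · intro i hi
    cases i with
    | zero => simpa [zshift_apply] using h1
    | succ i =>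
      rw [zshift_apply, e]
      exact hk.2 i (by omega)

end Refresh

/-! ### Density of the mixing transformations -/

/-- The Bernoulli shift moves the refreshed state by T₀ except when a refreshment occurs, with
probability p. The shift is carried to X by an isomorphism under which a point and its state have
the same label, hence lie in the same test sets. -/
theorem exists_isMixing_close {X : Type*} [MeasurableSpace X] [StandardBorelSpace X]
    (μ : Measure X) [IsProbabilityMeasure μ] [NullSingletonClass μ] (T₀ : PreAut μ) {m : ℕ}
    (C : Fin m → Set X) (hC : ∀ i, MeasurableSet (C i)) {ε : ℝ} (hε : 0 < ε) :
    ∃ T : PreAut μ, IsMixing μ T.1 ∧ ∀ i, PreAut.term (C i) T T₀ ≤ ε := by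
  -- Each of the two summands of `PreAut.term` costs at most p, the probability of a refreshment at
  -- time 1.
  obtain ⟨p, hp0, hp1, hpε⟩ : ∃ p : ℝ, 0 < p ∧ p ≤ 1 ∧ p ≤ ε / 2 :=
    ⟨min 1 (ε / 2), by positivity, min_le_left _ _, min_le_right _ _⟩
  let β : Measure Bool := ENNReal.ofReal p • Measure.dirac true +
    ENNReal.ofReal (1 - p) • Measure.dirac false
  have hβt : β {true} = ENNReal.ofReal p := by simp [β]
  have : IsProbabilityMeasure β := ⟨by
    simp only [β, Measure.coe_add, Measure.coe_smul, Pi.add_apply, Pi.smul_apply, measure_univ,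
      smul_eq_mul, mul_one]
    rw [← ENNReal.ofReal_add hp0.le (by linarith)]
    simp⟩
  have hβ : β {true} ≠ 0 := by
    rw [hβt]; simpa using hp0
  let P : Measure (ℤ → X × Bool) := Measure.infinitePi fun _ : ℤ => μ.prod β
  have hT₀ := T₀.2
  have : NullSingletonClass P := by
    refine ⟨fun ω => ?_⟩
    have h : P ((fun ω' : ℤ → X × Bool => ω' 0) ⁻¹' {ω 0}) = 0 := by
      rw [(measurePreserving_eval_infinitePi (fun _ : ℤ => μ.prod β) 0).measure_preimage
        (measurableSet_singleton _).nullMeasurableSet]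
      exact measure_singleton _
    exact measure_mono_null (fun ω' h' => by rw [h']; rfl) h
  -- The labels must resolve the images and preimages under T₀ as well, since `hclose` compares R⁻¹
  -- of one test set with its T₀-preimage, which must be a test set too.
  let D : Fin m ⊕ (Fin m ⊕ Fin m) → Set X :=
    Sum.elim C (Sum.elim (fun i => T₀.1 '' C i) (fun i => T₀.1 ⁻¹' C i))
  have hD : ∀ i, MeasurableSet (D i) := by
    rintro (i | i | i)
    · exact hC i
    · exact (T₀.1.measurableSet_image).2 (hC i)
    · exact T₀.1.measurable (hC i)
  let k := Fintype.card (Fin m ⊕ (Fin m ⊕ Fin m))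
  let en : Fin m ⊕ (Fin m ⊕ Fin m) ≃ Fin k := Fintype.equivFin _
  obtain ⟨q, hq, hqD⟩ := exists_nat_label (fun i => D (en.symm i)) fun i => hD _
  replace hqD : ∀ i, ∃ S : Set ℕ, D i = q ⁻¹' S := fun i => by simpa using hqD (en i)
  let x₀ := refreshState (X := X) T₀.1
  have hx₀ : Measurable x₀ := measurable_refreshState hT₀.measurable
  have hlaw : P.map x₀ = μ := map_refreshState μ β hβ hT₀
  -- The labels of x and of the state are equidistributed because the state has law μ.
  obtain ⟨e, he, hqe⟩ := exists_measurableEquiv_label_ae_eq μ P hq (hq.comp hx₀)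
    (by rw [← Measure.map_map hq hx₀, hlaw])
  have hDe : ∀ i, ∀ᵐ x ∂μ, x₀ (e x) ∈ D i ↔ x ∈ D i := by
    intro i
    obtain ⟨S, hS⟩ := hqD i
    filter_upwards [hqe] with x hx
    rw [hS]
    simp only [Set.mem_preimage]
    rw [show q (x₀ (e x)) = q x from hx]
  have hσ := measurePreserving_zshift (μ.prod β)
  have hes : MeasurePreserving e.symm P μ := he.symm e
  let R : X ≃ᵐ X := (e.trans (zshift _)).trans e.symm
  have hR : MeasurePreserving R μ μ := (hes.comp hσ).comp he
  have hRe : ∀ x, e (R x) = zshift _ (e x) := fun x => by simp [R]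
  have hRn : ∀ n x, R^[n] x = e.symm ((zshift _)^[n] (e x)) := by
    intro n x
    rw [← e.symm_apply_apply (R^[n] x)]
    congr 1
    exact (Function.Semiconj.iterate_right (f := e) (ga := R) (gb := zshift _) hRe n).eq x
  have hb : P.real {ω | (ω 1).2 = true} = p := by
    have h₁ : P {ω | (ω 1).2 = true} = ENNReal.ofReal p := by
      have h := (measurePreserving_eval_infinitePi (fun _ : ℤ => μ.prod β) 1).measure_preimage
        (MeasurableSet.univ.prod (measurableSet_singleton true)).nullMeasurableSet
        (s := (Set.univ : Set X) ×ˢ {true})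
      rw [Measure.prod_prod, measure_univ, one_mul, hβt] at h
      rw [← h]
      congr 1
      ext ω; simp
    rw [measureReal_def, h₁, ENNReal.toReal_ofReal hp0.le]
  have hshadow := refreshState_zshift μ β hβ T₀.1
  have hclose : ∀ i j, (∀ x, x ∈ D j ↔ T₀.1 x ∈ D i) →
      μ.real ((R ⁻¹' D i) ∆ D j) ≤ ε / 2 := by
    intro i j hij
    refine le_trans ?_ hpε
    rw [← hb]
    have : P.real {ω | (ω 1).2 = true} = μ.real (e ⁻¹' {ω | (ω 1).2 = true}) :=
      congrArg ENNReal.toReal (he.measure_preimage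
        (measurableSet_coord_snd 1 true).nullMeasurableSet).symm
    rw [this, measureReal_def, measureReal_def]
    refine ENNReal.toReal_mono (measure_ne_top _ _) (measure_mono_ae ?_)
    filter_upwards [hDe j, he.quasiMeasurePreserving.ae hshadow,
      hR.quasiMeasurePreserving.ae (hDe i)] with x h₁ h₂ h₃
    intro hx
    change (e x 1).2 = true
    by_contra hf
    have h₄ := h₂ (by simpa using hf)
    rw [← hRe] at h₄
    have h₅ : R x ∈ D i ↔ x ∈ D j := by
      rw [← h₃, ← h₁, hij]
      exact iff_of_eq (congrArg (· ∈ D i) h₄)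
    rcases hx with ⟨h, h'⟩ | ⟨h, h'⟩
    · exact h' (h₅.1 h)
    · exact h' (h₅.2 h)
  refine ⟨⟨R, hR⟩, ?_, ?_⟩
  · intro A B hA hB
    have h := isMixing_zshift (μ.prod β) (e.symm ⁻¹' A) (e.symm ⁻¹' B)
      (e.symm.measurable hA) (e.symm.measurable hB)
    have hm : ∀ S, MeasurableSet S → P.real (e.symm ⁻¹' S) = μ.real S := fun S hS =>
      congrArg ENNReal.toReal (hes.measure_preimage hS.nullMeasurableSet)
    change Tendsto _ _ (𝓝 (P.real _ * P.real _)) at h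
    rw [hm A hA, hm B hB] at h
    refine h.congr fun n => ?_
    change P.real _ = _
    rw [← hm _ (hA.inter ((hR.measurable.iterate n) hB))]
    congr 1
    ext ω
    simp only [Set.mem_inter_iff, Set.mem_preimage, hRn, MeasurableEquiv.apply_symm_apply]
  · intro i
    have h₁ : μ.real ((R '' C i) ∆ (T₀.1 '' C i)) ≤ ε / 2 := by
      have h := hclose (.inr (.inl i)) (.inl i) fun x =>
        ⟨fun h => ⟨x, h, rfl⟩, fun ⟨y, hy, hyx⟩ => T₀.1.injective hyx ▸ hy⟩
      refine le_trans (le_of_eq ?_) h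
      have hmm : MeasurableSet ((R '' C i) ∆ (T₀.1 '' C i)) :=
        (R.measurableSet_image.2 (hC i)).symmDiff (T₀.1.measurableSet_image.2 (hC i))
      refine congrArg ENNReal.toReal ?_
      rw [← hR.measure_preimage hmm.nullMeasurableSet, symmDiff_comm]
      congr 1
      rw [Set.preimage_symmDiff, Set.preimage_image_eq _ R.injective]
      rfl
    have h₂ : μ.real ((R ⁻¹' C i) ∆ (T₀.1 ⁻¹' C i)) ≤ ε / 2 :=
      hclose (.inl i) (.inr (.inr i)) fun x => Iff.rfl
    change μ.real _ + μ.real _ ≤ ε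
    linarith

/-! ### Genericity of mixing along long windows of times -/

/-- `T` mixes at all times of the windows `[n r, M r (n r)]`, asymptotically as `r → ∞`. -/
def IsWindowMixing {X : Type*} [MeasurableSpace X] (μ : Measure X) (T : X → X) (M : ℕ → ℕ → ℕ)
    (n : ℕ → ℕ) : Prop :=
  ∀ A B, MeasurableSet A → MeasurableSet B → ∀ η : ℝ, 0 < η → ∀ᶠ r in atTop,
    ∀ j, n r ≤ j → j ≤ M r (n r) → |μ.real (A ∩ T^[j] ⁻¹' B) - μ.real A * μ.real B| ≤ η

/-- The class of an invertible measure preserving map. -/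
def PreAut.toAut {X : Type*} [MeasurableSpace X] {μ : Measure X} (T : PreAut μ) : Aut μ :=
  Quotient.mk (PreAut.setoid μ) T

theorem measureReal_preimage_symmDiff {X : Type*} [MeasurableSpace X] {μ : Measure X} {R : X → X} (hR : MeasurePreserving R μ μ)
    {B C : Set X} (hB : MeasurableSet B) (hC : MeasurableSet C) :
    μ.real ((R ⁻¹' B) ∆ (R ⁻¹' C)) = μ.real (B ∆ C) :=
  congrArg ENNReal.toReal (hR.measure_preimage (hB.symmDiff hC).nullMeasurableSet)

section

variable {X : Type*} [MeasurableSpace X] {μ : Measure X} [IsProbabilityMeasure μ] {A : ℕ → Set X}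

theorem measureReal_symmDiff_triangle (B C D : Set X) :
    μ.real (B ∆ D) ≤ μ.real (B ∆ C) + μ.real (C ∆ D) :=
  (measureReal_mono (symmDiff_triangle B C D)).trans (measureReal_union_le _ _)

theorem PreAut.half_pow_mul_term_le_rho (i : ℕ) (S T : PreAut μ) :
    (1 / 2 : ℝ) ^ i * PreAut.term (A i) S T ≤ PreAut.rho A S T :=
  (PreAut.summable_rho A S T).le_tsum i fun j _ =>
    mul_nonneg (by positivity) (PreAut.term_nonneg _ _ _)

/-- Continuity of T ↦ T^{-j} B, by induction on j. As ρ controls only the sets A i, the set S^{-j} B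
is replaced by a nearby A i before the last preimage is compared. -/
theorem eventually_measureReal_iterate_symmDiff_lt (hA : IsDenseFamily μ A) (S : PreAut μ) (j : ℕ)
    {B : Set X} (hB : MeasurableSet B) {η : ℝ} (hη : 0 < η) :
    letI := halmosMetric μ A
    ∀ᶠ t in 𝓝 S.toAut, ∀ T : PreAut μ,
      T.toAut = t →
        μ.real ((S.1^[j] ⁻¹' B) ∆ (T.1^[j] ⁻¹' B)) < η := by
  let := halmosMetric μ A
  induction j generalizing η with
  | zero => simp [hη]
  | succ j ih =>
    set C := S.1^[j] ⁻¹' B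
    have hC : MeasurableSet C := (S.1.measurable.iterate j) hB
    obtain ⟨i, hi⟩ := hA.2 C hC (η / 4) (by positivity)
    have hAi := hA.1 i
    have h₁ : ∀ᶠ t in 𝓝 S.toAut,
        dist t S.toAut < (1 / 2) ^ i * (η / 4) :=
      Metric.ball_mem_nhds _ (by positivity)
    filter_upwards [h₁, ih (η := η / 4) (by positivity)] with t ht ht' T hT
    subst hT
    have h₂ := ht' T rfl
    have h₃ : PreAut.rho A T S < (1 / 2) ^ i * (η / 4) := ht
    have h₄ : PreAut.term (A i) T S < η / 4 := by
      have := (PreAut.half_pow_mul_term_le_rho (A := A) i T S).trans_lt h₃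
      exact lt_of_mul_lt_mul_left this (by positivity)
    have h₅ : μ.real ((S.1 ⁻¹' A i) ∆ (T.1 ⁻¹' A i)) < η / 4 := by
      refine lt_of_le_of_lt ?_ h₄
      rw [symmDiff_comm]
      exact le_add_of_nonneg_left measureReal_nonneg
    rw [Function.iterate_succ, Function.iterate_succ, Set.preimage_comp, Set.preimage_comp]
    have hD : MeasurableSet (T.1^[j] ⁻¹' B) := (T.1.measurable.iterate j) hB
    have t₁ := measureReal_symmDiff_triangle (μ := μ) (S.1 ⁻¹' C) (S.1 ⁻¹' A i)
      (T.1 ⁻¹' (T.1^[j] ⁻¹' B))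
    have t₂ := measureReal_symmDiff_triangle (μ := μ) (S.1 ⁻¹' A i) (T.1 ⁻¹' A i)
      (T.1 ⁻¹' (T.1^[j] ⁻¹' B))
    have t₃ := measureReal_symmDiff_triangle (μ := μ) (A i) C (T.1^[j] ⁻¹' B)
    rw [measureReal_preimage_symmDiff S.2 hC hAi, symmDiff_comm C] at t₁
    rw [measureReal_preimage_symmDiff T.2 hAi hD] at t₂
    linarith

theorem exists_isMixing_rho_lt [StandardBorelSpace X] [NullSingletonClass μ]
    (hA : ∀ i, MeasurableSet (A i)) (S : PreAut μ) {ε : ℝ} (hε : 0 < ε) :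
    ∃ T : PreAut μ, IsMixing μ T.1 ∧ PreAut.rho A T S < ε := by
  -- The tail of ρ beyond m is at most 4 · 2^{-m}, hence below ε/4.
  obtain ⟨m, hm⟩ := exists_pow_lt_of_lt_one (show 0 < ε / 16 by positivity)
    (show (1 / 2 : ℝ) < 1 by norm_num)
  obtain ⟨T, hT, hTm⟩ := exists_isMixing_close μ S (fun i : Fin m => A i) (fun i => hA i)
    (show 0 < ε / 4 by positivity)
  refine ⟨T, hT, ?_⟩
  have hs := PreAut.summable_rho A T S
  unfold PreAut.rho
  rw [← hs.sum_add_tsum_nat_add m]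
  have h₁ : ∑ i ∈ Finset.range m, (1 / 2 : ℝ) ^ i * PreAut.term (A i) T S ≤ ε / 2 := by
    calc _ ≤ ∑ i ∈ Finset.range m, (1 / 2 : ℝ) ^ i * (ε / 4) :=
          Finset.sum_le_sum fun i hi => mul_le_mul_of_nonneg_left
            (hTm ⟨i, Finset.mem_range.1 hi⟩) (by positivity)
      _ = (∑ i ∈ Finset.range m, (1 / 2 : ℝ) ^ i) * (ε / 4) := by rw [Finset.sum_mul]
      _ ≤ 2 * (ε / 4) := by
          refine mul_le_mul_of_nonneg_right ?_ (by positivity)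
          refine le_of_le_of_eq ?_ tsum_geometric_two
          exact summable_geometric_two.sum_le_tsum _ fun i _ => by positivity
      _ = ε / 2 := by ring
  have h₂ : ∑' i, (1 / 2 : ℝ) ^ (i + m) * PreAut.term (A (i + m)) T S ≤ ε / 4 := by
    calc _ ≤ ∑' i, (1 / 2 : ℝ) ^ i * ((1 / 2 : ℝ) ^ m * 2) := by
          refine ((summable_nat_add_iff m).2 hs).tsum_le_tsum (fun i => ?_)
            (summable_geometric_two.mul_right _)
          rw [pow_add, mul_assoc]
          have := PreAut.term_le_two (A (i + m)) T S
          gcongr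
      _ = 2 * ((1 / 2 : ℝ) ^ m * 2) := by rw [tsum_mul_right, tsum_geometric_two]
      _ ≤ ε / 4 := by linarith
  linarith

/-- At stage r, mixing on one window starting at some n ≥ r is asked of finitely many pairs of sets,
at finitely many times, with strict error bounds: an open condition. Every mixing map meets it by
starting late enough, so the intersection over r is dense. -/
theorem isGeneric_of_isWindowMixing [StandardBorelSpace X] [NullSingletonClass μ]
    (hA : IsDenseFamily μ A) (M : ℕ → ℕ → ℕ) {E : Set (Aut μ)}
    (hE : ∀ (T : PreAut μ) (n : ℕ → ℕ), (∀ r, r ≤ n r) → IsWindowMixing μ T.1 M n →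
      T.toAut ∈ E) : IsGeneric μ A E := by
  let := halmosMetric μ A
  let Q : ℕ → ℕ → PreAut μ → Prop := fun r n T => ∀ j ∈ Finset.Icc n (M r n),
    ∀ a ∈ Finset.range (r + 1), ∀ b ∈ Finset.range (r + 1),
      |μ.real (A a ∩ T.1^[j] ⁻¹' A b) - μ.real (A a) * μ.real (A b)| < 1 / ((r : ℝ) + 1)
  let O : ℕ → Set (Aut μ) := fun r =>
    {t | ∃ n, r ≤ n ∧ ∀ T : PreAut μ, T.toAut = t → Q r n T}
  have hO : ∀ r, IsOpen (O r) := by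
    intro r
    rw [isOpen_iff_mem_nhds]
    rintro ⟨S⟩ ⟨n, hn, hS⟩
    have hS' := hS S rfl
    have : ∀ᶠ t in 𝓝 S.toAut,
        ∀ j ∈ Finset.Icc n (M r n), ∀ a ∈ Finset.range (r + 1), ∀ b ∈ Finset.range (r + 1),
          ∀ T : PreAut μ, T.toAut = t →
          |μ.real (A a ∩ T.1^[j] ⁻¹' A b) - μ.real (A a) * μ.real (A b)| < 1 / ((r : ℝ) + 1) := by
      rw [eventually_all_finset]
      intro j hj
      rw [eventually_all_finset]
      intro a ha
      rw [eventually_all_finset]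
      intro b hb
      have h₁ := hS' j hj a ha b hb
      filter_upwards [eventually_measureReal_iterate_symmDiff_lt hA S j (hA.1 b)
        (sub_pos.2 h₁)] with t ht T hT
      have h₂ := ht T hT
      have h₃ : |μ.real (A a ∩ T.1^[j] ⁻¹' A b) - μ.real (A a ∩ S.1^[j] ⁻¹' A b)| ≤
          μ.real ((S.1^[j] ⁻¹' A b) ∆ (T.1^[j] ⁻¹' A b)) := by
        refine (abs_measureReal_sub_le_symmDiff μ _ _).trans (measureReal_mono ?_)
        rintro x (⟨⟨h, h'⟩, h''⟩ | ⟨⟨h, h'⟩, h''⟩)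
        · exact Or.inr ⟨h', fun hx => h'' ⟨h, hx⟩⟩
        · exact Or.inl ⟨h', fun hx => h'' ⟨h, hx⟩⟩
      have h₄ := abs_add_le (μ.real (A a ∩ T.1^[j] ⁻¹' A b) - μ.real (A a ∩ S.1^[j] ⁻¹' A b))
        (μ.real (A a ∩ S.1^[j] ⁻¹' A b) - μ.real (A a) * μ.real (A b))
      rw [sub_add_sub_cancel] at h₄
      linarith
    filter_upwards [this] with t ht
    exact ⟨n, hn, fun T hT j hj a ha b hb => ht j hj a ha b hb T hT⟩
  refine ⟨⋂ r, O r, ?_, IsGδ.iInter fun r => (hO r).isGδ, ?_⟩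
  · rintro ⟨T⟩ hT
    have hT' : ∀ r, ∃ n, r ≤ n ∧ Q r n T := fun r => by
      obtain ⟨n, hn, h⟩ := Set.mem_iInter.1 hT r
      exact ⟨n, hn, h T rfl⟩
    choose n hn hQ using hT'
    refine hE T n hn fun B C hB hC η hη => ?_
    obtain ⟨a, ha⟩ := hA.2 B hB (η / 8) (by positivity)
    obtain ⟨b, hb⟩ := hA.2 C hC (η / 8) (by positivity)
    obtain ⟨N, hN⟩ := exists_nat_one_div_lt (show 0 < η / 2 by positivity)
    filter_upwards [eventually_ge_atTop a, eventually_ge_atTop b, eventually_ge_atTop N]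
      with r hra hrb hrN j hj hj'
    have h₁ := hQ r j (Finset.mem_Icc.2 ⟨hj, hj'⟩) a (Finset.mem_range.2 (by omega)) b
      (Finset.mem_range.2 (by omega))
    have h₂ := abs_corr_sub_le (T.2.iterate j) (A := B) (A' := A a) hC (hA.1 b)
    rw [symmDiff_comm B, symmDiff_comm C] at h₂
    have h₃ : 1 / ((r : ℝ) + 1) ≤ 1 / ((N : ℝ) + 1) := by
      have : (N : ℝ) ≤ r := by exact_mod_cast hrN
      gcongr
    have h₄ := abs_add_le ((μ.real (B ∩ T.1^[j] ⁻¹' C) - μ.real B * μ.real C) -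
      (μ.real (A a ∩ T.1^[j] ⁻¹' A b) - μ.real (A a) * μ.real (A b)))
      (μ.real (A a ∩ T.1^[j] ⁻¹' A b) - μ.real (A a) * μ.real (A b))
    rw [sub_add_cancel] at h₄
    linarith
  · rw [Metric.dense_iff]
    rintro ⟨S⟩ ε hε
    obtain ⟨T, hT, hTS⟩ := exists_isMixing_rho_lt (A := A) hA.1 S hε
    refine ⟨T.toAut, hTS, Set.mem_iInter.2 fun r => ?_⟩
    have : ∀ᶠ j in atTop, ∀ a ∈ Finset.range (r + 1), ∀ b ∈ Finset.range (r + 1),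
        |μ.real (A a ∩ T.1^[j] ⁻¹' A b) - μ.real (A a) * μ.real (A b)| < 1 / ((r : ℝ) + 1) := by
      rw [eventually_all_finset]
      intro a _
      rw [eventually_all_finset]
      intro b _
      have h := hT (A a) (A b) (hA.1 a) (hA.1 b)
      exact (Metric.tendsto_nhds.1 h) (1 / ((r : ℝ) + 1)) (by positivity)
    obtain ⟨n, hn⟩ := eventually_atTop.1 this
    refine ⟨max n r, le_max_right _ _, fun T' hT' j hj a ha b hb => ?_⟩
    have hae : ∀ᵐ x ∂μ, T'.1 x = T.1 x := Quotient.exact hT'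
    have hit : ∀ j : ℕ, ∀ᵐ x ∂μ, T'.1^[j] x = T.1^[j] x := by
      intro j
      induction j with
      | zero => simp
      | succ j ih =>
        filter_upwards [hae, T.2.quasiMeasurePreserving.ae ih] with x h₁ h₂
        rw [Function.iterate_succ_apply, Function.iterate_succ_apply, h₁, h₂]
    have : μ.real (A a ∩ T'.1^[j] ⁻¹' A b) = μ.real (A a ∩ T.1^[j] ⁻¹' A b) := by
      refine congrArg ENNReal.toReal (measure_congr ?_)
      filter_upwards [hit j] with x hx
      refine propext (and_congr_right fun _ => ?_)
      exact iff_of_eq (congrArg (· ∈ A b) hx)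
    rw [this]
    exact hn j ((le_max_left _ _).trans (Finset.mem_Icc.1 hj).1) a ha b hb

end

/-! ### Returns under piecewise translations of the unit interval -/

/-- `f` maps `[0, 1)` onto itself, preserves length, and translates every interval that contains
no point of `D`, except perhaps as its left endpoint. -/
structure IsExchange (f : ℝ ≃ᵐ ℝ) (D : Finset ℝ) : Prop where
  mem_iff : ∀ x, f x ∈ Set.Ico (0 : ℝ) 1 ↔ x ∈ Set.Ico (0 : ℝ) 1
  measurePreserving : MeasurePreserving f volume volume
  zero_mem : 0 ∈ D
  sub_eq : ∀ u z, 0 ≤ u → u ≤ z → z < 1 → (∀ d ∈ D, u < d → z < d) → f z = f u + (z - u)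

/-- `h` is the first return time of `z` to `B`. -/
def IsReturnTime (f : ℝ → ℝ) (B : Set ℝ) (z : ℝ) (h : ℕ) : Prop :=
  0 < h ∧ f^[h] z ∈ B ∧ ∀ j, 0 < j → j < h → f^[j] z ∉ B

theorem IsReturnTime.unique {f : ℝ → ℝ} {B : Set ℝ} {z : ℝ} {h k : ℕ}
    (hh : IsReturnTime f B z h) (hk : IsReturnTime f B z k) : h = k := by
  rcases lt_trichotomy h k with hlt | heq | hlt
  · exact absurd hh.2.1 (hk.2.2 h hh.1 hlt)
  · exact heq
  · exact absurd hk.2.1 (hh.2.2 k hk.1 hlt)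

theorem exists_isReturnTime {f : ℝ → ℝ} {B : Set ℝ} {z : ℝ} (hz : ∃ k, 0 < k ∧ f^[k] z ∈ B) :
    ∃ h, IsReturnTime f B z h := by
  classical
  refine ⟨Nat.find hz, (Nat.find_spec hz).1, (Nat.find_spec hz).2, fun j hj hlt hjB => ?_⟩
  exact Nat.find_min hz hlt ⟨hj, hjB⟩

/-- Membership in `B` does not change across intervals without points of `C`. -/
def IsCutBy (B : Set ℝ) (C : Finset ℝ) : Prop :=
  B ⊆ Set.Ico 0 1 ∧
    ∀ u z, 0 ≤ u → u ≤ z → z < 1 → (∀ c ∈ C, u < c → z < c) → (u ∈ B ↔ z ∈ B)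

namespace IsExchange

variable {f : ℝ ≃ᵐ ℝ} {D C : Finset ℝ} {B : Set ℝ}

theorem iterate_mem_iff (hf : IsExchange f D) (n : ℕ) (x : ℝ) :
    f^[n] x ∈ Set.Ico (0 : ℝ) 1 ↔ x ∈ Set.Ico (0 : ℝ) 1 := by
  induction n with
  | zero => rfl
  | succ n ih => rw [Function.iterate_succ_apply', hf.mem_iff, ih]

theorem symm_iterate_mem_iff (hf : IsExchange f D) (n : ℕ) (x : ℝ) :
    f.symm^[n] x ∈ Set.Ico (0 : ℝ) 1 ↔ x ∈ Set.Ico (0 : ℝ) 1 := by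
  rw [← hf.iterate_mem_iff n (f.symm^[n] x)]
  rw [(Function.LeftInverse.iterate f.apply_symm_apply n) x]

theorem iterate_add (hf : IsExchange f D) (hDC : D ⊆ C) {w z : ℝ} (hw : 0 ≤ w) (hwz : w ≤ z)
    (hz : z < 1) {h : ℕ} (hC : ∀ j < h, ∀ c ∈ C, f^[j] w < c → f^[j] w + (z - w) < c) :
    ∀ j ≤ h, f^[j] z = f^[j] w + (z - w) := by
  intro j
  induction j with
  | zero => intro _; simp
  | succ j ih =>
    intro hj
    have h₁ := ih (by omega)
    have hw' := ((hf.iterate_mem_iff j w).2 ⟨hw, hwz.trans_lt hz⟩).1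
    have hz' := ((hf.iterate_mem_iff j z).2 ⟨hw.trans hwz, hz⟩).2
    rw [Function.iterate_succ_apply', Function.iterate_succ_apply',
      hf.sub_eq (f^[j] w) (f^[j] z) hw' (by linarith) hz' ?_, h₁]
    · ring
    · intro d hd hlt
      rw [h₁]
      exact hC j (by omega) d (hDC hd) hlt

/-- The left endpoint of the interval of continuity of the first return map that contains `z`. -/
theorem exists_base (hf : IsExchange f D) (hDC : D ⊆ C) (hB : IsCutBy B C) {z : ℝ} (hz : z ∈ B)
    {h : ℕ} (hh : IsReturnTime f B z h) :
    ∃ w ∈ B, w ≤ z ∧ IsReturnTime f B w h ∧ (∃ j ≤ h, f^[j] w ∈ C) ∧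
      ∀ j ≤ h, ∀ c ∈ C, f^[j] w < c → f^[j] w + (z - w) < c := by
  classical
  have hz01 := hB.1 hz
  -- The least gap g between some f^j z, j ≤ h, and a cut point at or below it is how far z can
  -- slide left, its orbit moving in parallel, before the orbit meets a cut point. Since 0 is a cut
  -- point, g exists and the orbit stays in [0, 1).
  let S := ((Finset.range (h + 1)) ×ˢ C).filter fun q => q.2 ≤ f^[q.1] z
  have hmem : ∀ j ≤ h, f^[j] z ∈ Set.Ico (0 : ℝ) 1 := fun j _ => (hf.iterate_mem_iff j z).2 hz01
  have hS0 : ∀ j ≤ h, (j, (0 : ℝ)) ∈ S := fun j hj => Finset.mem_filter.2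
    ⟨Finset.mem_product.2 ⟨Finset.mem_range.2 (by simp; omega), hDC hf.zero_mem⟩, (hmem j hj).1⟩
  obtain ⟨⟨k, c⟩, hkS, hmin⟩ := S.exists_min_image (fun q => f^[q.1] z - q.2) ⟨_, hS0 0 (by simp)⟩
  have hk := Finset.mem_filter.1 hkS
  have hk₁ := Finset.mem_product.1 hk.1
  have hkh : k ≤ h := by have := Finset.mem_range.1 hk₁.1; simp at this; omega
  set g := f^[k] z - c with hg
  have hg0 : 0 ≤ g := sub_nonneg.2 hk.2
  have hlow : ∀ j ≤ h, 0 ≤ f^[j] z - g := fun j hj => by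
    have : g ≤ f^[j] z - 0 := hmin _ (hS0 j hj)
    linarith
  have hcut : ∀ j ≤ h, ∀ c' ∈ C, f^[j] z - g < c' → f^[j] z < c' := by
    intro j hj c' hc' hlt
    by_contra hcon
    have : g ≤ f^[j] z - c' := hmin (j, c') (Finset.mem_filter.2
      ⟨Finset.mem_product.2 ⟨Finset.mem_range.2 (by simp; omega), hc'⟩, not_lt.1 hcon⟩)
    linarith
  have hit : ∀ j ≤ h, f^[j] (z - g) = f^[j] z - g := by
    intro j
    induction j with
    | zero => intro _; rfl
    | succ j ih =>
      intro hj
      have h₁ := hf.sub_eq (f^[j] z - g) (f^[j] z) (hlow j (by omega)) (by linarith)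
        (hmem j (by omega)).2 (fun d hd => hcut j (by omega) d (hDC hd))
      rw [Function.iterate_succ_apply', Function.iterate_succ_apply', ih (by omega), h₁]
      ring
  have hiff : ∀ j ≤ h, (f^[j] (z - g) ∈ B ↔ f^[j] z ∈ B) := by
    intro j hj
    rw [hit j hj]
    exact hB.2 _ _ (hlow j hj) (by linarith) (hmem j hj).2 (hcut j hj)
  refine ⟨z - g, (hiff 0 (by simp)).2 hz, by linarith, ⟨hh.1, (hiff h le_rfl).2 hh.2.1, ?_⟩,
    ⟨k, hkh, ?_⟩, ?_⟩
  · intro j hj hjh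
    rw [hiff j hjh.le]
    exact hh.2.2 j hj hjh
  · rw [hit k hkh, hg]
    simpa using hk₁.2
  · intro j hj c' hc'
    rw [hit j hj]
    have := hcut j hj c' hc'
    simpa using this

/-- The left endpoints of the intervals of continuity of the first return map to `B`. -/
def baseSet (f : ℝ ≃ᵐ ℝ) (B : Set ℝ) (C : Finset ℝ) : Set ℝ :=
  {w | w ∈ B ∧ ∃ h, IsReturnTime f B w h ∧ ∃ j ≤ h, f^[j] w ∈ C}

/-- Each left endpoint is charged to a cut point met by its orbit up to the return. If two endpoints
meet the same cut point at times j < j', one is the iterate f^{j'-j} of the other, hence a visit to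
B, which before the return is impossible. -/
theorem finite_baseSet (f : ℝ ≃ᵐ ℝ) (B : Set ℝ) (C : Finset ℝ) :
    (baseSet f B C).Finite ∧ (baseSet f B C).ncard ≤ 2 * C.card := by
  classical
  choose h hh j hj hjC using fun w : baseSet f B C => w.2.2
  -- The flag excludes the remaining collision, one endpoint meeting the cut point at time 0 and the
  -- other at its return time; it accounts for the factor 2.
  let F : baseSet f B C → C × Bool := fun w => (⟨f^[j w] w, hjC w⟩, decide (j w = h w))
  have key : ∀ w w' : baseSet f B C, F w = F w' → j w ≤ j w' → (w : ℝ) = w' := by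
    intro w w' hF hle
    have h₁ : f^[j w] (w : ℝ) = f^[j w'] (w' : ℝ) := congrArg (fun q => (q.1 : ℝ)) hF
    have h₂ : j w = h w ↔ j w' = h w' := by
      have : decide (j w = h w) = decide (j w' = h w') := congrArg Prod.snd hF
      simpa using this
    have h₃ : f^[j w' - j w] (w' : ℝ) = w := by
      have e : f^[j w'] (w' : ℝ) = f^[j w] (f^[j w' - j w] (w' : ℝ)) := by
        rw [← Function.iterate_add_apply]; congr 2; omega
      rw [e] at h₁
      exact (f.injective.iterate (j w) h₁).symm
    have h₄ : j w' - j w = 0 := by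
      by_contra hne
      refine (hh w').2.2 (j w' - j w) (by omega) ?_ (h₃ ▸ w.2.1)
      have := hj w'
      have := (hh w).1
      by_cases hw : j w = h w
      · omega
      · have : j w' ≠ h w' := fun hc => hw (h₂.2 hc)
        omega
    rw [h₄] at h₃
    exact h₃.symm
  have hinj : Function.Injective F := by
    intro w w' hF
    rcases le_total (j w) (j w') with hle | hle
    · exact Subtype.ext (key w w' hF hle)
    · exact Subtype.ext (key w' w hF.symm hle).symm
  have hfin : Finite (baseSet f B C) := Finite.of_injective F hinj
  refine ⟨hfin, ?_⟩
  have := Nat.card_le_card_of_injective F hinj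
  have e₁ : Nat.card C = C.card := by simp
  have e₂ : Nat.card Bool = 2 := by simp
  rwa [Nat.card_prod, e₁, e₂, mul_comm, Nat.card_coe_set_eq] at this

/-- By `exists_base`, every return time already occurs at one of the left endpoints. -/
theorem exists_finset_returnTimes (hf : IsExchange f D) (hDC : D ⊆ C) (hB : IsCutBy B C) :
    ∃ R : Finset ℕ, R.card ≤ 2 * C.card ∧ (∀ h ∈ R, ∃ z ∈ B, IsReturnTime f B z h) ∧
      ∀ z ∈ B, ∀ h, IsReturnTime f B z h → h ∈ R := by
  classical
  obtain ⟨hfin, hcard⟩ := finite_baseSet f B C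
  have hret : ∀ w ∈ hfin.toFinset, ∃ h, IsReturnTime f B w h := fun w hw => by
    obtain ⟨-, h, hh, -⟩ := hfin.mem_toFinset.1 hw
    exact ⟨h, hh⟩
  choose! r hr using hret
  refine ⟨hfin.toFinset.image r, ?_, ?_, ?_⟩
  · refine Finset.card_image_le.trans ?_
    rwa [← Set.ncard_eq_toFinset_card _ hfin]
  · intro h hh
    obtain ⟨w, hw, rfl⟩ := Finset.mem_image.1 hh
    exact ⟨w, (hfin.mem_toFinset.1 hw).1, hr w hw⟩
  · intro z hz h hh
    obtain ⟨w, hwB, -, hw, hj, -⟩ := hf.exists_base hDC hB hz hh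
    have hwm : w ∈ hfin.toFinset := hfin.mem_toFinset.2 ⟨hwB, h, hw, hj⟩
    exact Finset.mem_image.2 ⟨w, hwm, (hr w hwm).unique hw⟩

/-! ### Points that are not periodic approach the cut points -/

/-- If the orbit never comes within δ to the right of a cut point, the intervals of length δ to the
left of its points all move in parallel. Two orbit points closer than δ then generate an arithmetic
progression inside [0, 1), whose difference must be 0; so the orbit is periodic. -/
theorem exists_iterate_near (hf : IsExchange f D) {δ : ℝ} (hδ : 0 < δ) {y : ℝ}
    (hy : y ∈ Set.Ico (0 : ℝ) 1) (hper : ∀ k, 0 < k → f^[k] y ≠ y) :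
    ∃ k, ∃ d ∈ D, d ≤ f^[k] y ∧ f^[k] y < d + δ := by
  by_contra! hno
  have hmem : ∀ k, f^[k] y ∈ Set.Ico (0 : ℝ) 1 := fun k => (hf.iterate_mem_iff k y).2 hy
  have hge : ∀ k, δ ≤ f^[k] y := fun k => by
    simpa using hno k 0 hf.zero_mem (hmem k).1
  have step : ∀ k t, 0 ≤ t → t < δ → f (f^[k] y - t) = f^[k + 1] y - t := by
    intro k t ht htδ
    have := hf.sub_eq (f^[k] y - t) (f^[k] y) (by linarith [hge k]) (by linarith) (hmem k).2 ?_
    · rw [Function.iterate_succ_apply']; linarith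
    · intro d hd hlt
      by_contra hcon
      have := hno k d hd (not_lt.1 hcon)
      linarith
  have steps : ∀ n k t, 0 ≤ t → t < δ → f^[n] (f^[k] y - t) = f^[k + n] y - t := by
    intro n
    induction n with
    | zero => intro k t _ _; rfl
    | succ n ih =>
      intro k t ht htδ
      rw [Function.iterate_succ_apply, step k t ht htδ, ih (k + 1) t ht htδ]
      congr 2; omega
  -- Compactness of [0, 1] yields two orbit points closer than δ.
  obtain ⟨i, j, hij, hclose⟩ : ∃ i j, i < j ∧ |f^[j] y - f^[i] y| < δ := by
    obtain ⟨a, -, φ, hφ, hlim⟩ := isCompact_Icc.tendsto_subseq (x := fun k => f^[k] y)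
      (fun k => Set.Ico_subset_Icc_self (hmem k))
    obtain ⟨n, hn⟩ := (Metric.cauchySeq_iff.1 hlim.cauchySeq) δ hδ
    exact ⟨φ n, φ (n + 1), hφ (Nat.lt_succ_self n), by
      have := hn (n + 1) (by omega) n le_rfl
      rwa [Real.dist_eq] at this⟩
  set k := j - i
  have hk : 0 < k := by omega
  set τ := f^[j] y - f^[i] y
  -- Parallel motion is available only to the left of an orbit point, so the sign of τ decides which
  -- of two neighbouring terms is regarded as the shifted one.
  have harith : ∀ m : ℕ, f^[i + m * k] y = f^[i] y + m * τ := by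
    have hdiff : ∀ m : ℕ, f^[i + (m + 1) * k] y = f^[i + m * k] y + τ := by
      intro m
      induction m with
      | zero =>
        have e : i + (0 + 1) * k = j := by omega
        rw [e]; simp [τ]
      | succ m ih =>
        have e₁ : i + (m + 1 + 1) * k = i + (m + 1) * k + k := by ring
        have e₂ : i + (m + 1) * k = i + m * k + k := by ring
        rcases le_total 0 τ with hτ | hτ
        · have h₁ := steps k (i + (m + 1) * k) τ hτ (abs_lt.1 hclose).2
          have h₂ : f^[i + (m + 1) * k] y - τ = f^[i + m * k] y := by rw [ih]; ring
          rw [h₂, ← Function.iterate_add_apply, add_comm k, ← e₂] at h₁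
          rw [e₁]; linarith
        · have h₁ := steps k (i + m * k) (-τ) (by linarith) (by linarith [(abs_lt.1 hclose).1])
          have h₂ : f^[i + m * k] y - -τ = f^[i + (m + 1) * k] y := by rw [ih]; ring
          rw [h₂, ← Function.iterate_add_apply, add_comm k, ← e₁, ← e₂] at h₁
          rw [h₁]; ring
    intro m
    induction m with
    | zero => simp
    | succ m ih =>
      rw [hdiff, ih]; push_cast; ring
  have hτ : τ = 0 := by
    by_contra hne
    obtain ⟨m, hm⟩ := exists_nat_gt (1 / |τ|)
    have hpos : 0 < |τ| := abs_pos.2 hne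
    rw [div_lt_iff₀ hpos] at hm
    have h₁ := hmem (i + m * k)
    have h₂ := hmem i
    rw [harith] at h₁
    have h₃ : |(m : ℝ) * τ| < 1 := abs_lt.2 ⟨by linarith [h₁.1, h₂.2], by linarith [h₁.2, h₂.1]⟩
    rw [abs_mul, Nat.abs_cast] at h₃
    linarith
  refine hper k hk ?_
  have h₁ : f^[j] y = f^[i] y := by simpa [τ, sub_eq_zero] using hτ
  have e : f^[j] y = f^[i] (f^[k] y) := by
    rw [← Function.iterate_add_apply]; congr 2; omega
  rw [e] at h₁
  exact f.injective.iterate i h₁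

end IsExchange

/-! ### A large tower of translated intervals -/

namespace IsExchange

variable {f : ℝ ≃ᵐ ℝ} {D C : Finset ℝ} {B : Set ℝ}

theorem measurePreserving_restrict (hf : IsExchange f D) :
    MeasurePreserving f (volume.restrict (Set.Ico 0 1)) (volume.restrict (Set.Ico (0 : ℝ) 1)) := by
  have h := hf.measurePreserving.restrict_preimage (measurableSet_Ico (a := (0 : ℝ)) (b := 1))
  have e : f ⁻¹' Set.Ico (0 : ℝ) 1 = Set.Ico (0 : ℝ) 1 := Set.ext fun x => hf.mem_iff x
  rwa [e] at h

theorem measurePreserving_symm_restrict (hf : IsExchange f D) :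
    MeasurePreserving f.symm (volume.restrict (Set.Ico 0 1))
      (volume.restrict (Set.Ico (0 : ℝ) 1)) :=
  hf.measurePreserving_restrict.symm f

theorem iterate_symm_iterate (f : ℝ ≃ᵐ ℝ) (n : ℕ) (x : ℝ) : f^[n] (f.symm^[n] x) = x :=
  (Function.LeftInverse.iterate f.apply_symm_apply n) x

theorem iterate_symm_iterate_of_le (f : ℝ ≃ᵐ ℝ) {m n : ℕ} (h : m ≤ n) (x : ℝ) :
    f^[m] (f.symm^[n] x) = f.symm^[n - m] x := by
  obtain ⟨k, rfl⟩ := Nat.exists_eq_add_of_le h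
  rw [Function.iterate_add_apply, iterate_symm_iterate, Nat.add_sub_cancel_left]

/-- Poincaré recurrence for the inverse: a point of f^{-k} B comes back to f^{-k} B under f^{-n} for
some n ≥ k, which puts f^{-(n-k)} of it in B. -/
theorem ae_exists_symm_iterate_mem (hf : IsExchange f D) (hB : MeasurableSet B) :
    ∀ᵐ y ∂volume.restrict (Set.Ico (0 : ℝ) 1), (∃ k, f^[k] y ∈ B) → ∃ n, f.symm^[n] y ∈ B := by
  have hcons := hf.measurePreserving_symm_restrict.conservative
  have h : ∀ k : ℕ, ∀ᵐ y ∂volume.restrict (Set.Ico (0 : ℝ) 1), y ∈ f^[k] ⁻¹' B →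
      ∃ᶠ n in atTop, f.symm^[n] y ∈ f^[k] ⁻¹' B := fun k =>
    hcons.ae_mem_imp_frequently_image_mem ((f.measurable.iterate k) hB).nullMeasurableSet
  filter_upwards [ae_all_iff.2 h] with y hy
  rintro ⟨k, hk⟩
  obtain ⟨n, hn, hkn⟩ := ((hy k hk).and_eventually (eventually_ge_atTop k)).exists
  refine ⟨n - k, ?_⟩
  rwa [Set.mem_preimage, iterate_symm_iterate_of_le f hkn] at hn

/-- The points of `[0, 1)` at distance less than `δ` to the right of `D`. -/
def nearSet (D : Finset ℝ) (δ : ℝ) : Set ℝ :=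
  {x | x ∈ Set.Ico (0 : ℝ) 1 ∧ ∃ d ∈ D, d ≤ x ∧ x < d + δ}

theorem measurableSet_nearSet (D : Finset ℝ) (δ : ℝ) : MeasurableSet (nearSet D δ) := by
  have : nearSet D δ = Set.Ico (0 : ℝ) 1 ∩ ⋃ d ∈ D, Set.Ico d (d + δ) := by
    ext x
    simp only [nearSet, Set.mem_inter_iff, Set.mem_iUnion, Set.mem_Ico, exists_prop,
      Set.mem_ofPred_eq]
  rw [this]
  exact measurableSet_Ico.inter (Finset.measurableSet_biUnion _ fun _ _ => measurableSet_Ico)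

open Classical in
theorem isCutBy_nearSet (D : Finset ℝ) (δ : ℝ) :
    IsCutBy (nearSet D δ) (D ∪ D.image (· + δ)) := by
  refine ⟨fun x hx => hx.1, fun u z hu huz hz hC => ?_⟩
  have hu01 : u ∈ Set.Ico (0 : ℝ) 1 := ⟨hu, huz.trans_lt hz⟩
  have hz01 : z ∈ Set.Ico (0 : ℝ) 1 := ⟨hu.trans huz, hz⟩
  constructor
  · rintro ⟨-, d, hd, hdu, hud⟩
    exact ⟨hz01, d, hd, hdu.trans huz,
      hC _ (Finset.mem_union_right _ (Finset.mem_image_of_mem _ hd)) hud⟩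
  · rintro ⟨-, d, hd, hdz, hzd⟩
    refine ⟨hu01, d, hd, ?_, huz.trans_lt hzd⟩
    by_contra hcon
    exact absurd (hC d (Finset.mem_union_left _ hd) (not_le.1 hcon)) (not_lt.2 hdz)

/-- The set of points of `[0, 1)` that are periodic under `f`. -/
def periodicSet (f : ℝ ≃ᵐ ℝ) : Set ℝ :=
  {y | y ∈ Set.Ico (0 : ℝ) 1 ∧ ∃ k, 0 < k ∧ f^[k] y = y}

/-- Let B be the points less than δ to the right of the cuts. Almost every point that is not
periodic has visited B, and the return map to B has at most 4p continuity intervals, of length at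
most δ. Their towers cover the aperiodic part, so one is large, and being thin it is tall. -/
theorem exists_column (hf : IsExchange f D) {p : ℕ} (hp : D.card ≤ p)
    (hper : (1 / 2 : ℝ) ≤ volume.real (Set.Ico (0 : ℝ) 1 \ periodicSet f)) (n₀ : ℕ) {δ₀ : ℝ}
    (hδ₀ : 0 < δ₀) :
    ∃ (w b : ℝ) (h : ℕ), w < b ∧ Set.Ico w b ⊆ Set.Ico 0 1 ∧ b - w ≤ δ₀ ∧ n₀ < h ∧
      1 / (16 * (p : ℝ)) ≤ h * (b - w) ∧
      (∀ z ∈ Set.Ico w b, ∀ j ≤ h, f^[j] z = f^[j] w + (z - w)) ∧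
      ∀ z ∈ Set.Ico w b, ∀ j, 0 < j → j < h → f^[j] z ∉ Set.Ico w b := by
  classical
  have hp0 : 0 < p := (Finset.card_pos.2 ⟨0, hf.zero_mem⟩).trans_le hp
  have hpR : (0 : ℝ) < p := by exact_mod_cast hp0
  set κ : ℝ := 1 / (16 * (p : ℝ)) with hκ
  have hκ0 : 0 < κ := by positivity
  -- A tower of measure at least κ and width at most δ < κ / n₀ must have more than n₀ levels.
  obtain ⟨δ, hδ, hδδ₀, hδn⟩ : ∃ δ : ℝ, 0 < δ ∧ δ ≤ δ₀ ∧ n₀ * δ < κ := by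
    refine ⟨min δ₀ (κ / (n₀ + 1)), by positivity, min_le_left _ _, ?_⟩
    calc (n₀ : ℝ) * min δ₀ (κ / (n₀ + 1)) ≤ n₀ * (κ / (n₀ + 1)) := by
          gcongr; exact min_le_right _ _
      _ = κ * (n₀ / (n₀ + 1)) := by ring
      _ < κ * 1 := by
          gcongr
          rw [div_lt_one (by positivity)]
          linarith
      _ = κ := mul_one _
  set B := nearSet D δ
  set C := D ∪ D.image (· + δ)
  have hDC : D ⊆ C := Finset.subset_union_left
  have hBC : IsCutBy B C := isCutBy_nearSet D δ
  have hCcard : C.card ≤ 2 * p := by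
    refine (Finset.card_union_le _ _).trans ?_
    have := Finset.card_image_le (s := D) (f := (· + δ))
    omega
  obtain ⟨hfin, hncard⟩ := finite_baseSet f B C
  have hret : ∀ w ∈ hfin.toFinset, ∃ h, IsReturnTime f B w h := fun w hw => by
    obtain ⟨-, h, hh, -⟩ := hfin.mem_toFinset.1 hw
    exact ⟨h, hh⟩
  choose! r hr using hret
  -- The points whose orbit runs parallel to that of w, without a cut point in between, up to the
  -- return of w.
  let K : ℝ → Set ℝ := fun w => {z | w ≤ z ∧ z < 1 ∧
    ∀ j ≤ r w, ∀ c ∈ C, f^[j] w < c → f^[j] w + (z - w) < c}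
  let b : ℝ → ℝ := fun w => sSup (K w)
  have hwB : ∀ w ∈ hfin.toFinset, w ∈ B := fun w hw => (hfin.mem_toFinset.1 hw).1
  have hKδ : ∀ w ∈ hfin.toFinset, ∀ z ∈ K w, z ≤ w + δ := by
    intro w hw z hz
    obtain ⟨-, d, hd, hdw, hwd⟩ := hwB w hw
    have := hz.2.2 0 (Nat.zero_le _) (d + δ)
      (Finset.mem_union_right _ (Finset.mem_image_of_mem _ hd)) hwd
    simp only [Function.iterate_zero, id_eq] at this
    linarith
  have hKw : ∀ w ∈ hfin.toFinset, w ∈ K w := fun w hw =>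
    ⟨le_rfl, (hwB w hw).1.2, fun j _ c _ hlt => by simpa using hlt⟩
  have hKbd : ∀ w, BddAbove (K w) := fun w => ⟨1, fun z hz => hz.2.1.le⟩
  have hwb : ∀ w ∈ hfin.toFinset, w ≤ b w := fun w hw => le_csSup (hKbd w) (hKw w hw)
  have hbδ : ∀ w ∈ hfin.toFinset, b w - w ≤ δ := fun w hw => by
    have := csSup_le ⟨w, hKw w hw⟩ (hKδ w hw)
    simp only [b]; linarith
  -- Closed intervals appear because a point of `K w` is only known to be at most the supremum; the
  -- endpoint has no measure.
  have hcover : ∀ᵐ y ∂volume.restrict (Set.Ico (0 : ℝ) 1), y ∉ periodicSet f →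
      ∃ w ∈ hfin.toFinset, ∃ i < r w, f.symm^[i] y ∈ Set.Icc w (b w) := by
    filter_upwards [hf.ae_exists_symm_iterate_mem (measurableSet_nearSet D δ),
      ae_restrict_mem measurableSet_Ico] with y hy hy01 hyper
    have hnp : ∀ k, 0 < k → f^[k] y ≠ y := fun k hk h => hyper ⟨hy01, k, hk, h⟩
    have hvis : ∀ y', y' ∈ Set.Ico (0 : ℝ) 1 → (∀ k, 0 < k → f^[k] y' ≠ y') →
        ∃ k, f^[k] y' ∈ B := by
      intro y' hy' hnp'
      obtain ⟨k, d, hd, h₁, h₂⟩ := hf.exists_iterate_near hδ hy' hnp'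
      exact ⟨k, (hf.iterate_mem_iff k y').2 hy', d, hd, h₁, h₂⟩
    have hback := hy (hvis y hy01 hnp)
    -- The most recent visit to B in the past: y then lies on level n of the tower over the interval
    -- containing f^{-n} y, below the return time.
    set n := Nat.find hback
    have hn : f.symm^[n] y ∈ B := Nat.find_spec hback
    have hmin : ∀ m < n, f.symm^[m] y ∉ B := fun m hm => Nat.find_min hback hm
    set z := f.symm^[n] y
    obtain ⟨k, hk⟩ := hvis (f y) ((hf.mem_iff y).2 hy01) fun k hk h => hnp k hk <| by
      have : f (f^[k] y) = f y := (Function.Commute.iterate_self f k y).symm.trans h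
      exact f.injective this
    have hzk : f^[k + 1 + n] z = f^[k] (f y) := by
      rw [Function.iterate_add_apply, iterate_symm_iterate, Function.iterate_succ_apply]
    obtain ⟨h, hh⟩ := exists_isReturnTime (f := f) (B := B) (z := z)
      ⟨k + 1 + n, by omega, hzk ▸ hk⟩
    have hnh : n < h := by
      by_contra hcon
      have h₁ := hh.2.1
      rw [iterate_symm_iterate_of_le f (not_lt.1 hcon)] at h₁
      exact hmin _ (by have := hh.1; omega) h₁
    obtain ⟨w, hwB', hwz, hwr, hwC, hcut⟩ := hf.exists_base hDC hBC hn hh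
    have hwm : w ∈ hfin.toFinset := hfin.mem_toFinset.2 ⟨hwB', h, hwr, hwC⟩
    have hrh : r w = h := (hr w hwm).unique hwr
    refine ⟨w, hwm, n, by omega, hwz, le_csSup (hKbd w) ⟨hwz, hn.1.2, ?_⟩⟩
    rw [hrh]
    exact hcut
  -- Otherwise at most 4p towers, each of measure below κ = 1/(16p), would cover a set of measure at
  -- least 1/2 with total measure 1/4.
  obtain ⟨w, hw, hwκ⟩ : ∃ w ∈ hfin.toFinset, κ ≤ r w * (b w - w) := by
    by_contra! hcon
    have hsub : volume (Set.Ico (0 : ℝ) 1 \ periodicSet f) ≤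
        volume (⋃ w ∈ hfin.toFinset, ⋃ i ∈ Finset.range (r w), f.symm^[i] ⁻¹' Set.Icc w (b w)) := by
      refine measure_mono_ae ?_
      rw [ae_restrict_iff' measurableSet_Ico] at hcover
      filter_upwards [hcover] with y hy
      intro hy'
      obtain ⟨w, hw, i, hi, hm⟩ := hy hy'.1 hy'.2
      exact Set.mem_biUnion hw (Set.mem_biUnion (Finset.mem_coe.2 (Finset.mem_range.2 hi)) hm)
    have hone : ∀ w ∈ hfin.toFinset,
        volume (⋃ i ∈ Finset.range (r w), f.symm^[i] ⁻¹' Set.Icc w (b w)) ≤ ENNReal.ofReal κ := by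
      intro w hw
      refine (measure_biUnion_finset_le _ _).trans ?_
      have hmp := hf.measurePreserving.symm f
      have : ∀ i ∈ Finset.range (r w), volume (f.symm^[i] ⁻¹' Set.Icc w (b w)) =
          ENNReal.ofReal (b w - w) := fun i _ => by
        rw [(hmp.iterate i).measure_preimage measurableSet_Icc.nullMeasurableSet, Real.volume_Icc]
      rw [Finset.sum_congr rfl this, Finset.sum_const, Finset.card_range, nsmul_eq_mul,
        ← ENNReal.ofReal_natCast, ← ENNReal.ofReal_mul (by positivity)]
      exact ENNReal.ofReal_le_ofReal (hcon w hw).le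
    have htot := hsub.trans ((measure_biUnion_finset_le _ _).trans (Finset.sum_le_sum hone))
    rw [Finset.sum_const, nsmul_eq_mul, ← ENNReal.ofReal_natCast,
      ← ENNReal.ofReal_mul (by positivity)] at htot
    have h₁ : volume.real (Set.Ico (0 : ℝ) 1 \ periodicSet f) ≤ hfin.toFinset.card * κ :=
      ENNReal.toReal_le_of_le_ofReal (by positivity) htot
    rw [← Set.ncard_eq_toFinset_card _ hfin] at h₁
    have h₂ : ((baseSet f B C).ncard : ℝ) ≤ 4 * p := by
      have : (baseSet f B C).ncard ≤ 4 * p := by omega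
      exact_mod_cast this
    have h₃ : ((baseSet f B C).ncard : ℝ) * κ ≤ 4 * p * κ := by gcongr
    have h₄ : 4 * (p : ℝ) * κ = 1 / 4 := by rw [hκ]; field_simp; norm_num
    linarith
  have hdown : ∀ z ∈ Set.Ico w (b w), z ∈ K w := by
    intro z hz
    obtain ⟨z', hz', hlt⟩ := exists_lt_of_lt_csSup ⟨w, hKw w hw⟩ hz.2
    refine ⟨hz.1, hlt.trans hz'.2.1, fun j hj c hc hlt' => ?_⟩
    have := hz'.2.2 j hj c hc hlt'
    linarith
  have hit : ∀ z ∈ Set.Ico w (b w), ∀ j ≤ r w, f^[j] z = f^[j] w + (z - w) := fun z hz =>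
    hf.iterate_add hDC (hwB w hw).1.1 hz.1 (hdown z hz).2.1
      fun j hj => (hdown z hz).2.2 j hj.le
  have hiff : ∀ z ∈ Set.Ico w (b w), ∀ j ≤ r w, (f^[j] w ∈ B ↔ f^[j] z ∈ B) := by
    intro z hz j hj
    have hz01 : z ∈ Set.Ico (0 : ℝ) 1 := ⟨(hwB w hw).1.1.trans hz.1, (hdown z hz).2.1⟩
    have hzj := (hf.iterate_mem_iff j z).2 hz01
    refine hBC.2 _ _ ((hf.iterate_mem_iff j w).2 (hwB w hw).1).1 ?_ hzj.2 ?_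
    · rw [hit z hz j hj]; linarith [hz.1]
    · intro c hc hlt
      rw [hit z hz j hj]
      exact (hdown z hz).2.2 j hj c hc hlt
  have hlt : w < b w := by
    rcases (hwb w hw).eq_or_lt with h | h
    · rw [← h] at hwκ; simp at hwκ; linarith
    · exact h
  have hGB : Set.Ico w (b w) ⊆ B := fun z hz => (hiff z hz 0 (Nat.zero_le _)).1 (hwB w hw)
  refine ⟨w, b w, r w, hlt, fun z hz => (hGB hz).1, (hbδ w hw).trans hδδ₀, ?_, hwκ, hit, ?_⟩
  · by_contra hcon
    have h₁ : (r w : ℝ) ≤ n₀ := by exact_mod_cast not_lt.1 hcon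
    have h₂ : (r w : ℝ) * (b w - w) ≤ n₀ * δ :=
      mul_le_mul h₁ (hbδ w hw) (by linarith) (by positivity)
    linarith
  · intro z hz j hj hjr hmem
    exact (hr w hw).2.2 j hj hjr ((hiff z hz j hjr.le).2 (hGB hmem))

end IsExchange

/-! ### Partial rigidity at many times -/

namespace IsExchange

variable {f : ℝ ≃ᵐ ℝ} {D : Finset ℝ}

open Classical in
theorem isCutBy_Ico {w b : ℝ} (h : Set.Ico w b ⊆ Set.Ico 0 1) (D : Finset ℝ) :
    IsCutBy (Set.Ico w b) (D ∪ {w, b}) := by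
  refine ⟨h, fun u z hu huz hz hC => ⟨fun hub => ⟨hub.1.trans huz, ?_⟩, fun hzb => ⟨?_, ?_⟩⟩⟩
  · exact hC b (by simp) hub.2
  · by_contra hcon
    exact absurd (hC w (by simp) (not_le.1 hcon)) (not_lt.2 hzb.1)
  · exact huz.trans_lt hzb.2

/-- Finitely many patterns describe the first `N` visits to `G`. -/
theorem exists_visit_patterns {G : Set ℝ} {R : Finset ℕ}
    (hR : ∀ z ∈ G, ∀ h, IsReturnTime f G z h → h ∈ R) {n : ℕ} (hn : ∀ h ∈ R, n ≤ h) (N : ℕ) :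
    ∃ P : Finset (ℕ → ℕ), P.card ≤ R.card ^ N ∧
      (∀ m ∈ P, m 0 = 0 ∧ ∀ i < N, m i + n ≤ m (i + 1)) ∧
      ∀ z ∈ G, (∃ᶠ k in atTop, f^[k] z ∈ G) → ∃ m ∈ P, ∀ i ≤ N, f^[m i] z ∈ G := by
  classical
  induction N with
  | zero =>
    refine ⟨{fun _ => 0}, by simp, by simp, fun z hz _ => ⟨_, Finset.mem_singleton_self _, ?_⟩⟩
    intro i _
    exact hz
  | succ N ih =>
    obtain ⟨P, hPc, hPm, hP⟩ := ih
    -- First the return after t steps, then the visits of the returned point, delayed by t.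
    let s : ℕ → (ℕ → ℕ) → (ℕ → ℕ) := fun t m i => if i = 0 then 0 else t + m (i - 1)
    refine ⟨Finset.image₂ s R P, ?_, ?_, ?_⟩
    · refine (Finset.card_image₂_le s R P).trans ?_
      rw [pow_succ, mul_comm]
      exact Nat.mul_le_mul_right _ hPc
    · intro m hm
      obtain ⟨t, ht, m', hm', rfl⟩ := Finset.mem_image₂.1 hm
      refine ⟨rfl, fun i hi => ?_⟩
      have h₁ := hPm m' hm'
      cases i with
      | zero =>
        have := hn t ht
        simp only [s, if_true]
        simp [h₁.1, this]
      | succ i =>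
        have := h₁.2 i (by omega)
        simp only [s]
        simp only [Nat.succ_ne_zero, if_false, Nat.add_sub_cancel]
        omega
    · intro z hz hfreq
      obtain ⟨k, hk, hk0⟩ := (hfreq.and_eventually (eventually_gt_atTop 0)).exists
      obtain ⟨t, ht⟩ := exists_isReturnTime ⟨k, hk0, hk⟩
      have hfreq' : ∃ᶠ k in atTop, f^[k] (f^[t] z) ∈ G := by
        rw [frequently_atTop] at hfreq ⊢
        intro a
        obtain ⟨k, hk, hkG⟩ := hfreq (a + t)
        refine ⟨k - t, by omega, ?_⟩
        rw [← Function.iterate_add_apply, Nat.sub_add_cancel (by omega)]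
        exact hkG
      obtain ⟨m, hm, hmG⟩ := hP _ ht.2.1 hfreq'
      refine ⟨s t m, Finset.mem_image₂_of_mem (hR z hz t ht) hm, fun i hi => ?_⟩
      cases i with
      | zero => exact hz
      | succ i =>
        have h₁ := hmG i (by omega)
        rw [← Function.iterate_add_apply] at h₁
        simp only [s, Nat.succ_ne_zero, if_false, Nat.add_sub_cancel]
        rw [add_comm t]
        exact h₁

/-- A lower bound for the measure of the sets on which an exchange of `p` intervals is rigid. -/
noncomputable def rigidityConst (p N : ℕ) : ℝ :=
  1 / (16 * (p : ℝ)) / ((2 * (p + 2) : ℕ) : ℝ) ^ N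

theorem rigidityConst_pos {p : ℕ} (hp : 0 < p) (N : ℕ) : 0 < rigidityConst p N := by
  have : (0 : ℝ) < p := by exact_mod_cast hp
  unfold rigidityConst
  positivity

theorem rigidityConst_le {p : ℕ} (hp : 0 < p) (N : ℕ) : rigidityConst p N ≤ 1 / 16 := by
  have h₁ : (1 : ℝ) ≤ p := by exact_mod_cast hp
  have h₂ : (1 : ℝ) ≤ ((2 * (p + 2) : ℕ) : ℝ) ^ N := one_le_pow₀ (by exact_mod_cast (by omega))
  unfold rigidityConst
  calc 1 / (16 * (p : ℝ)) / ((2 * (p + 2) : ℕ) : ℝ) ^ N ≤ 1 / (16 * (p : ℝ)) :=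
        div_le_self (by positivity) h₂
    _ ≤ 1 / 16 := by
        apply one_div_le_one_div_of_le (by norm_num)
        linarith

/-- The base of the tower is an interval with two endpoints, which adds at most two cuts and leaves
at most 2(p+2) return times. A share of at least 1 / (2(p+2))^N of the base makes its first N
returns at common times; E consists of the columns over that share, and the tower spends at least n
steps between returns. -/
theorem exists_rigid_of_aperiodic (hf : IsExchange f D) {p : ℕ} (hp : D.card ≤ p)
    (hper : (1 / 2 : ℝ) ≤ volume.real (Set.Ico (0 : ℝ) 1 \ periodicSet f)) (N n : ℕ) {ε : ℝ}
    (hε : 0 < ε) :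
    ∃ (E : Set ℝ) (m : ℕ → ℕ), MeasurableSet E ∧ E ⊆ Set.Ico 0 1 ∧
      (∀ i < N, m i + n ≤ m (i + 1)) ∧ rigidityConst p N ≤ volume.real E ∧
      volume.real (E ∆ (f ⁻¹' E)) ≤ ε ∧ ∀ i ≤ N, ∀ x ∈ E, |f^[m i] x - x| ≤ ε := by
  classical
  have hp0 : 0 < p := (Finset.card_pos.2 ⟨0, hf.zero_mem⟩).trans_le hp
  have hpR : (0 : ℝ) < p := by exact_mod_cast hp0
  -- The h levels of E are disjoint copies of its base inside [0, 1); h > 2/ε makes the base at most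
  -- ε/2.
  obtain ⟨n₁, hn₁⟩ := exists_nat_gt (2 / ε)
  obtain ⟨w, b, h, hwb, hG01, hbw, hnh, hκ, hit, hno⟩ :=
    hf.exists_column hp hper (max n n₁) hε
  set G := Set.Ico w b
  have hGm : MeasurableSet G := measurableSet_Ico
  obtain ⟨R, hRc, hRz, hR⟩ := hf.exists_finset_returnTimes (C := D ∪ {w, b})
    Finset.subset_union_left (isCutBy_Ico hG01 D)
  have hRn : ∀ t ∈ R, n ≤ t := by
    intro t ht
    obtain ⟨z, hz, hzt⟩ := hRz t ht
    by_contra hcon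
    exact hno z hz t hzt.1 (by omega) hzt.2.1
  have hRp : R.card ≤ 2 * (p + 2) := by
    refine hRc.trans (Nat.mul_le_mul_left 2 ((Finset.card_union_le _ _).trans ?_))
    have := Finset.card_le_two (a := w) (b := b)
    omega
  obtain ⟨P, hPc, hPm, hP⟩ := exists_visit_patterns (f := f) hR hRn N
  -- Points of the base that are again in the base at all the times of the pattern.
  let Gm : (ℕ → ℕ) → Set ℝ := fun m => {z | z ∈ G ∧ ∀ i ≤ N, f^[m i] z ∈ G}
  have hGmm : ∀ m, MeasurableSet (Gm m) := by
    intro m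
    have : Gm m = G ∩ ⋂ i ∈ Finset.range (N + 1), f^[m i] ⁻¹' G := by
      ext z
      simp [Gm]
    rw [this]
    exact hGm.inter (Finset.measurableSet_biInter _ fun i _ => (f.measurable.iterate _) hGm)
  have hGfin : ∀ m, volume (Gm m) ≠ ⊤ := fun m =>
    ((measure_mono (fun z hz => hG01 hz.1)).trans_lt (by simp : volume (Set.Ico (0 : ℝ) 1) < ⊤)).ne
  have hcover : ∀ᵐ z ∂(volume : Measure ℝ), z ∈ G → ∃ m ∈ P, z ∈ Gm m := by
    have hcons := hf.measurePreserving_restrict.conservative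
    have h₁ := hcons.ae_mem_imp_frequently_image_mem (s := G) hGm.nullMeasurableSet
    rw [ae_restrict_iff' measurableSet_Ico] at h₁
    filter_upwards [h₁] with z hz hzG
    obtain ⟨m, hm, hmG⟩ := hP z hzG (hz (hG01 hzG) hzG)
    exact ⟨m, hm, hzG, hmG⟩
  obtain ⟨m, hm, hmG⟩ : ∃ m ∈ P, (b - w) / ((2 * (p + 2) : ℕ) : ℝ) ^ N ≤ volume.real (Gm m) := by
    by_contra! hcon
    have hsub : volume.real G ≤ volume.real (⋃ m ∈ P, Gm m) := by
      refine ENNReal.toReal_mono ?_ (measure_mono_ae ?_)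
      · exact ((measure_biUnion_finset_le _ _).trans_lt
          (ENNReal.sum_lt_top.2 fun m _ => (hGfin m).lt_top)).ne
      · filter_upwards [hcover] with z hz hzG
        obtain ⟨m, hm, hzm⟩ := hz hzG
        exact Set.mem_biUnion (Finset.mem_coe.2 hm) hzm
    have hvG : volume.real G = b - w := by
      rw [Real.volume_real_Ico_of_le hwb.le]
    rcases P.eq_empty_or_nonempty with hPe | hPe
    · rw [hPe, hvG] at hsub
      simp at hsub
      linarith
    have hlt := (measureReal_biUnion_finset_le P Gm).trans_lt
      (Finset.sum_lt_sum_of_nonempty hPe hcon)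
    rw [Finset.sum_const, nsmul_eq_mul] at hlt
    have hq : (P.card : ℝ) ≤ ((2 * (p + 2) : ℕ) : ℝ) ^ N := by
      have : P.card ≤ (2 * (p + 2)) ^ N := hPc.trans (Nat.pow_le_pow_left hRp N)
      exact_mod_cast this
    have hq0 : (0 : ℝ) < ((2 * (p + 2) : ℕ) : ℝ) ^ N := by positivity
    have : (P.card : ℝ) * ((b - w) / ((2 * (p + 2) : ℕ) : ℝ) ^ N) ≤ b - w := by
      calc _ ≤ ((2 * (p + 2) : ℕ) : ℝ) ^ N * ((b - w) / ((2 * (p + 2) : ℕ) : ℝ) ^ N) := by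
            have : 0 ≤ (b - w) / ((2 * (p + 2) : ℕ) : ℝ) ^ N :=
              div_nonneg (by linarith) hq0.le
            gcongr
        _ = b - w := by field_simp
    linarith
  let E : Set ℝ := ⋃ k ∈ Finset.range h, f.symm^[k] ⁻¹' Gm m
  have hEm : MeasurableSet E :=
    Finset.measurableSet_biUnion _ fun k _ => (f.symm.measurable.iterate k) (hGmm m)
  have hmemE : ∀ x, x ∈ E ↔ ∃ k < h, f.symm^[k] x ∈ Gm m := by
    intro x; simp [E]
  have hE01 : E ⊆ Set.Ico 0 1 := by
    intro x hx
    obtain ⟨k, -, hk⟩ := (hmemE x).1 hx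
    exact (hf.symm_iterate_mem_iff k x).1 (hG01 hk.1)
  have hmpk := fun k => (hf.measurePreserving.symm f).iterate k
  have hEvol : volume.real E = h * volume.real (Gm m) := by
    rw [measureReal_def, measure_biUnion_finset, Finset.sum_congr rfl fun k _ =>
      (hmpk k).measure_preimage (hGmm m).nullMeasurableSet, Finset.sum_const, Finset.card_range,
      nsmul_eq_mul, ENNReal.toReal_mul, ENNReal.toReal_natCast, measureReal_def]
    · have key : ∀ k l : ℕ, k < h → l < k → ∀ x, f.symm^[k] x ∈ Gm m → f.symm^[l] x ∉ Gm m := by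
        intro k l hk hlk x hxk hxl
        refine hno _ hxk.1 (k - l) (by omega) (by omega) ?_
        rw [iterate_symm_iterate_of_le f (by omega), Nat.sub_sub_self hlk.le]
        exact hxl.1
      intro k hk l hl hkl
      refine Set.disjoint_left.2 fun x hxk hxl => ?_
      have hk' := Finset.mem_range.1 (Finset.mem_coe.1 hk)
      have hl' := Finset.mem_range.1 (Finset.mem_coe.1 hl)
      rcases lt_or_gt_of_ne hkl with hlt | hlt
      · exact key l k hl' hlt x hxl hxk
      · exact key k l hk' hlt x hxk hxl
    · exact fun k _ => (f.symm.measurable.iterate k) (hGmm m)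
  have hh0 : (0 : ℝ) < h := by
    have : 0 < h := by omega
    exact_mod_cast this
  refine ⟨E, m, hEm, hE01, (hPm m hm).2, ?_, ?_, ?_⟩
  · rw [hEvol]
    calc rigidityConst p N ≤ h * (b - w) / ((2 * (p + 2) : ℕ) : ℝ) ^ N := by
          unfold rigidityConst; gcongr
      _ = h * ((b - w) / ((2 * (p + 2) : ℕ) : ℝ) ^ N) := by ring
      _ ≤ h * volume.real (Gm m) := by gcongr
  · have hone : volume.real E ≤ 1 := by
      refine (measureReal_mono hE01 (by simp)).trans ?_
      simp
    have hGsmall : volume.real (Gm m) ≤ ε / 2 := by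
      have h₁ : (n₁ : ℝ) ≤ h := by
        have : n₁ ≤ h := by omega
        exact_mod_cast this
      have h₂ : 2 / ε < h := hn₁.trans_le h₁
      rw [hEvol] at hone
      rw [div_lt_iff₀ hε] at h₂
      by_contra hcon
      push Not at hcon
      have : (h : ℝ) * (ε / 2) < h * volume.real (Gm m) := by gcongr
      linarith
    -- E fails to be invariant only where orbits leave through the top level or enter through the
    -- bottom one.
    have hsub : E ∆ (f ⁻¹' E) ⊆ f ⁻¹' Gm m ∪ f.symm^[h - 1] ⁻¹' Gm m := by
      rintro x (⟨hx, hx'⟩ | ⟨hx, hx'⟩)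
      · obtain ⟨k, hk, hkx⟩ := (hmemE x).1 hx
        right
        have : k + 1 = h := by
          by_contra hne
          refine hx' ((hmemE _).2 ⟨k + 1, by omega, ?_⟩)
          rwa [Function.iterate_succ_apply, f.symm_apply_apply]
        rw [← this]
        exact hkx
      · obtain ⟨k, hk, hkx⟩ := (hmemE _).1 hx
        left
        cases k with
        | zero => exact hkx
        | succ k =>
          rw [Function.iterate_succ_apply, f.symm_apply_apply] at hkx
          exact absurd ((hmemE x).2 ⟨k, by omega, hkx⟩) hx'
    have h₁ : volume.real (f ⁻¹' Gm m) = volume.real (Gm m) :=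
      congrArg ENNReal.toReal (hf.measurePreserving.measure_preimage (hGmm m).nullMeasurableSet)
    have h₂ : volume.real (f.symm^[h - 1] ⁻¹' Gm m) = volume.real (Gm m) :=
      congrArg ENNReal.toReal ((hmpk _).measure_preimage (hGmm m).nullMeasurableSet)
    refine (measureReal_mono hsub (measure_union_lt_top ?_ ?_).ne).trans
      ((measureReal_union_le _ _).trans ?_)
    · rw [hf.measurePreserving.measure_preimage (hGmm m).nullMeasurableSet]
      exact (hGfin m).lt_top
    · rw [(hmpk _).measure_preimage (hGmm m).nullMeasurableSet]
      exact (hGfin m).lt_top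
    · linarith
  · intro i hi x hx
    obtain ⟨k, hk, hkx⟩ := (hmemE x).1 hx
    set z := f.symm^[k] x
    have hxz : x = f^[k] z := (iterate_symm_iterate f k x).symm
    have h₁ : f^[m i] x = f^[k] (f^[m i] z) := by
      rw [hxz, ← Function.iterate_add_apply, ← Function.iterate_add_apply, add_comm]
    have hz' := hkx.2 i hi
    -- Level k is a translate of the base, so x and f^{m i} x are as close as their projections z
    -- and f^{m i} z, two points of an interval of length at most ε.
    rw [h₁, hit _ hz' k hk.le, hxz, hit _ hkx.1 k hk.le, abs_le]
    have a₁ := hkx.1.1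
    have a₂ := hkx.1.2
    have a₃ := hz'.1
    have a₄ := hz'.2
    constructor <;> linarith

/-- The points fixed by f^{k!} increase to the periodic set, so some k captures measure 1/4;
multiples of k! are exact return times there. -/
theorem exists_rigid_of_periodic (hf : IsExchange f D)
    (hper : (1 / 2 : ℝ) ≤ volume.real (periodicSet f)) (n : ℕ) :
    ∃ (E : Set ℝ) (m : ℕ → ℕ), MeasurableSet E ∧ E ⊆ Set.Ico 0 1 ∧
      (∀ i, m i + n ≤ m (i + 1)) ∧ 1 / 4 ≤ volume.real E ∧ f ⁻¹' E = E ∧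
      ∀ i, ∀ x ∈ E, f^[m i] x = x := by
  let Q : ℕ → Set ℝ := fun k => {x | x ∈ Set.Ico (0 : ℝ) 1 ∧ f^[k.factorial] x = x}
  have hQm : ∀ k, MeasurableSet (Q k) := fun k =>
    measurableSet_Ico.inter (measurableSet_eq_fun (f.measurable.iterate _) measurable_id)
  have hfix : ∀ {a b : ℕ} {x : ℝ}, a ∣ b → f^[a] x = x → f^[b] x = x := by
    intro a b x hab hx
    exact (Function.IsPeriodicPt.trans_dvd (m := a) hx hab)
  have hmono : Monotone Q := fun a b hab x hx =>
    ⟨hx.1, hfix (Nat.factorial_dvd_factorial hab) hx.2⟩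
  have hU : periodicSet f = ⋃ k, Q k := by
    ext x
    rw [Set.mem_iUnion]
    constructor
    · rintro ⟨hx, k, hk, hkx⟩
      exact ⟨k, hx, hfix (Nat.dvd_factorial hk le_rfl) hkx⟩
    · rintro ⟨k, hx, hkx⟩
      exact ⟨hx, k.factorial, Nat.factorial_pos k, hkx⟩
  have hfin : volume (periodicSet f) ≠ ⊤ :=
    ((measure_mono (fun z hz => hz.1)).trans_lt (by simp : volume (Set.Ico (0 : ℝ) 1) < ⊤)).ne
  have hlim : Tendsto (fun k => volume.real (Q k)) atTop (𝓝 (volume.real (periodicSet f))) := by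
    have h := tendsto_measure_iUnion_atTop (μ := (volume : Measure ℝ)) hmono
    rw [← hU] at h
    exact (ENNReal.tendsto_toReal hfin).comp h
  obtain ⟨k, hk⟩ := (hlim.eventually_const_lt (show (1 / 4 : ℝ) < _ by linarith)).exists
  refine ⟨Q k, fun i => i * (n * k.factorial), hQm k, fun x hx => hx.1, fun i => ?_, hk.le, ?_, ?_⟩
  · have : n ≤ n * k.factorial := Nat.le_mul_of_pos_right n (Nat.factorial_pos k)
    change i * (n * k.factorial) + n ≤ (i + 1) * (n * k.factorial)
    rw [add_mul, one_mul]; omega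
  · ext x
    refine and_congr (hf.mem_iff x) ?_
    rw [← Function.iterate_succ_apply, Function.iterate_succ_apply', f.injective.eq_iff]
  · intro i x hx
    exact hfix ⟨i * n, by ring⟩ hx.2

theorem exists_rigid (hf : IsExchange f D) {p : ℕ} (hp : D.card ≤ p) (N n : ℕ) {ε : ℝ}
    (hε : 0 < ε) :
    ∃ (E : Set ℝ) (m : ℕ → ℕ), MeasurableSet E ∧ E ⊆ Set.Ico 0 1 ∧
      (∀ i < N, m i + n ≤ m (i + 1)) ∧ rigidityConst p N ≤ volume.real E ∧
      volume.real (E ∆ (f ⁻¹' E)) ≤ ε ∧ ∀ i ≤ N, ∀ x ∈ E, |f^[m i] x - x| ≤ ε := by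
  by_cases hper : (1 / 2 : ℝ) ≤ volume.real (Set.Ico (0 : ℝ) 1 \ periodicSet f)
  · exact hf.exists_rigid_of_aperiodic hp hper N n hε
  · have hp0 : 0 < p := (Finset.card_pos.2 ⟨0, hf.zero_mem⟩).trans_le hp
    have h₁ : (1 / 2 : ℝ) ≤ volume.real (periodicSet f) := by
      have h₂ : volume.real (Set.Ico (0 : ℝ) 1) ≤
          volume.real (Set.Ico (0 : ℝ) 1 \ periodicSet f) + volume.real (periodicSet f) := by
        refine (measureReal_mono (fun x hx => ?_) ?_).trans (measureReal_union_le _ _)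
        · by_cases h : x ∈ periodicSet f
          · exact Or.inr h
          · exact Or.inl ⟨hx, h⟩
        · exact ((measure_mono (Set.union_subset Set.sdiff_subset fun x hx => hx.1)).trans_lt
            (by simp : volume (Set.Ico (0 : ℝ) 1) < ⊤)).ne
      simp at h₂
      linarith
    obtain ⟨E, m, hEm, hE, hm, hvol, hinv, hrig⟩ := hf.exists_rigid_of_periodic h₁ n
    refine ⟨E, m, hEm, hE, fun i _ => hm i, ?_, ?_, fun i _ x hx => ?_⟩
    · have := rigidityConst_le hp0 N
      linarith
    · rw [hinv]; simpa using hε.le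
    · rw [hrig i x hx]; simpa using hε.le

end IsExchange

/-! ### Interval exchanges with possibly degenerate intervals -/

section Exchange

variable {p : ℕ}

/-- The left endpoint of the `j`-th interval when intervals of lengths `l` are placed side by side
in the order given by `σ`. -/
def leftEnd (l : Fin p → ℝ) (σ : Equiv.Perm (Fin p)) (j : Fin p) : ℝ := ∑ i with σ i < σ j, l i

/-- The `j`-th interval when intervals of lengths `l` are placed in the order given by `σ`. -/
def piece (l : Fin p → ℝ) (σ : Equiv.Perm (Fin p)) (j : Fin p) : Set ℝ :=
  Set.Ico (leftEnd l σ j) (leftEnd l σ j + l j)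

theorem leftEnd_add_le {l : Fin p → ℝ} (hl : ∀ i, 0 ≤ l i) (σ : Equiv.Perm (Fin p)) {i j : Fin p}
    (hij : σ i < σ j) : leftEnd l σ i + l i ≤ leftEnd l σ j := by
  unfold leftEnd
  have hi : i ∉ Finset.univ.filter fun k => σ k < σ i := by simp
  rw [add_comm, ← Finset.sum_insert hi]
  refine Finset.sum_le_sum_of_subset_of_nonneg (fun k hk => ?_) fun k _ _ => hl k
  rcases Finset.mem_insert.1 hk with rfl | hk
  · simpa using hij
  · simpa using (Finset.mem_filter.1 hk).2.trans hij

theorem eq_of_mem_piece {l : Fin p → ℝ} (hl : ∀ i, 0 ≤ l i) {σ : Equiv.Perm (Fin p)} {i j : Fin p}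
    {x : ℝ} (hi : x ∈ piece l σ i) (hj : x ∈ piece l σ j) : i = j := by
  rcases lt_trichotomy (σ i) (σ j) with h | h | h
  · exact absurd (hi.2.trans_le ((leftEnd_add_le hl σ h).trans hj.1)) (lt_irrefl _)
  · exact σ.injective h
  · exact absurd (hj.2.trans_le ((leftEnd_add_le hl σ h).trans hi.1)) (lt_irrefl _)

theorem leftEnd_nonneg {l : Fin p → ℝ} (hl : ∀ i, 0 ≤ l i) (σ : Equiv.Perm (Fin p)) (j : Fin p) :
    0 ≤ leftEnd l σ j := Finset.sum_nonneg fun i _ => hl i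

theorem leftEnd_add_le_one {l : Fin p → ℝ} (hl : l ∈ stdSimplex ℝ (Fin p))
    (σ : Equiv.Perm (Fin p)) (j : Fin p) : leftEnd l σ j + l j ≤ 1 := by
  unfold leftEnd
  have hi : j ∉ Finset.univ.filter fun k => σ k < σ j := by simp
  rw [add_comm, ← Finset.sum_insert hi, ← hl.2]
  exact Finset.sum_le_sum_of_subset_of_nonneg (Finset.subset_univ _) fun k _ _ => hl.1 k

theorem piece_subset {l : Fin p → ℝ} (hl : l ∈ stdSimplex ℝ (Fin p)) (σ : Equiv.Perm (Fin p))
    (j : Fin p) : piece l σ j ⊆ Set.Ico 0 1 := fun _ hx =>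
  ⟨(leftEnd_nonneg hl.1 σ j).trans hx.1, hx.2.trans_le (leftEnd_add_le_one hl σ j)⟩

theorem card_pos_of_mem_stdSimplex {l : Fin p → ℝ} (hl : l ∈ stdSimplex ℝ (Fin p)) : 0 < p := by
  rcases Nat.eq_zero_or_pos p with rfl | h
  · have := hl.2; simp at this
  · exact h

theorem exists_leftEnd_eq_zero (hp : 0 < p) (l : Fin p → ℝ) (σ : Equiv.Perm (Fin p)) :
    ∃ j, leftEnd l σ j = 0 := by
  refine ⟨σ.symm ⟨0, hp⟩, ?_⟩
  unfold leftEnd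
  rw [Finset.filter_false_of_mem, Finset.sum_empty]
  intro i _
  simp [Fin.lt_def]

/-- Among the pieces starting at or before x, the last one in the order σ contains x: the next
piece, if any, starts where it ends. Lengths may vanish, so several pieces can start at the same
point. -/
theorem exists_mem_piece {l : Fin p → ℝ} (hl : l ∈ stdSimplex ℝ (Fin p)) (σ : Equiv.Perm (Fin p))
    {x : ℝ} (hx : x ∈ Set.Ico (0 : ℝ) 1) : ∃ j, x ∈ piece l σ j := by
  classical
  obtain ⟨j₀, hj₀⟩ := exists_leftEnd_eq_zero (card_pos_of_mem_stdSimplex hl) l σ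
  let S := Finset.univ.filter fun j => leftEnd l σ j ≤ x
  obtain ⟨j, hjS, hmax⟩ := S.exists_max_image σ
    ⟨j₀, Finset.mem_filter.2 ⟨Finset.mem_univ _, hj₀.trans_le hx.1⟩⟩
  refine ⟨j, (Finset.mem_filter.1 hjS).2, ?_⟩
  by_contra hcon
  push Not at hcon
  have hset : leftEnd l σ j + l j = ∑ i with σ i ≤ σ j, l i := by
    unfold leftEnd
    have hi : j ∉ Finset.univ.filter fun k => σ k < σ j := by simp
    rw [add_comm, ← Finset.sum_insert hi]
    congr 1
    ext k
    simp [le_iff_lt_or_eq, or_comm]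
  by_cases hlast : ∃ k, σ j < σ k
  · let R := Finset.univ.filter fun k => σ j < σ k
    obtain ⟨k, hkR, hmin⟩ := R.exists_min_image σ (by
      obtain ⟨k, hk⟩ := hlast
      exact ⟨k, Finset.mem_filter.2 ⟨Finset.mem_univ _, hk⟩⟩)
    have hjk := (Finset.mem_filter.1 hkR).2
    have hk : leftEnd l σ k = leftEnd l σ j + l j := by
      rw [hset]
      unfold leftEnd
      congr 1
      ext i
      simp only [Finset.mem_filter, Finset.mem_univ, true_and]
      constructor
      · intro h
        by_contra hc
        exact absurd (hmin i (Finset.mem_filter.2 ⟨Finset.mem_univ _, not_le.1 hc⟩)) (not_le.2 h)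
      · exact fun h => h.trans_lt hjk
    exact absurd (hmax k (Finset.mem_filter.2 ⟨Finset.mem_univ _, hk.trans_le hcon⟩))
      (not_le.2 hjk)
  · push Not at hlast
    rw [hset, Finset.filter_true_of_mem fun i _ => hlast i, hl.2] at hcon
    exact absurd hx.2 (not_lt.2 hcon)

/-- Rearrange intervals of lengths `l` from the order given by `σ` to the order given by `τ`. -/
noncomputable def rearrange (l : Fin p → ℝ) (σ τ : Equiv.Perm (Fin p)) (x : ℝ) : ℝ :=
  x + ∑ j, (piece l σ j).indicator (fun _ => leftEnd l τ j - leftEnd l σ j) x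

theorem rearrange_of_mem {l : Fin p → ℝ} (hl : ∀ i, 0 ≤ l i) {σ : Equiv.Perm (Fin p)}
    (τ : Equiv.Perm (Fin p)) {j : Fin p} {x : ℝ} (hx : x ∈ piece l σ j) :
    rearrange l σ τ x = x + (leftEnd l τ j - leftEnd l σ j) := by
  unfold rearrange
  rw [Finset.sum_eq_single j, Set.indicator_of_mem hx]
  · intro i _ hij
    exact Set.indicator_of_notMem (fun hi => hij (eq_of_mem_piece hl hi hx)) _
  · simp

theorem rearrange_mem_piece {l : Fin p → ℝ} (hl : ∀ i, 0 ≤ l i) {σ : Equiv.Perm (Fin p)}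
    (τ : Equiv.Perm (Fin p)) {j : Fin p} {x : ℝ} (hx : x ∈ piece l σ j) :
    rearrange l σ τ x ∈ piece l τ j := by
  rw [rearrange_of_mem hl τ hx]
  have h₁ := hx.1
  have h₂ := hx.2
  constructor <;> linarith

theorem rearrange_of_notMem {l : Fin p → ℝ} (hl : l ∈ stdSimplex ℝ (Fin p))
    (σ τ : Equiv.Perm (Fin p)) {x : ℝ} (hx : x ∉ Set.Ico (0 : ℝ) 1) : rearrange l σ τ x = x := by
  unfold rearrange
  rw [Finset.sum_eq_zero, add_zero]
  intro i _
  exact Set.indicator_of_notMem (fun hi => hx (piece_subset hl σ i hi)) _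

theorem rearrange_rearrange {l : Fin p → ℝ} (hl : l ∈ stdSimplex ℝ (Fin p))
    (σ τ : Equiv.Perm (Fin p)) (x : ℝ) : rearrange l τ σ (rearrange l σ τ x) = x := by
  by_cases hx : x ∈ Set.Ico (0 : ℝ) 1
  · obtain ⟨j, hj⟩ := exists_mem_piece hl σ hx
    rw [rearrange_of_mem hl.1 σ (rearrange_mem_piece hl.1 τ hj), rearrange_of_mem hl.1 τ hj]
    ring
  · rw [rearrange_of_notMem hl σ τ hx, rearrange_of_notMem hl τ σ hx]

theorem rearrange_mem_Ico_iff {l : Fin p → ℝ} (hl : l ∈ stdSimplex ℝ (Fin p))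
    (σ τ : Equiv.Perm (Fin p)) (x : ℝ) :
    rearrange l σ τ x ∈ Set.Ico (0 : ℝ) 1 ↔ x ∈ Set.Ico (0 : ℝ) 1 := by
  constructor
  · intro h
    by_contra hx
    rw [rearrange_of_notMem hl σ τ hx] at h
    exact hx h
  · intro hx
    obtain ⟨j, hj⟩ := exists_mem_piece hl σ hx
    exact piece_subset hl τ j (rearrange_mem_piece hl.1 τ hj)

theorem measurable_rearrange (l : Fin p → ℝ) (σ τ : Equiv.Perm (Fin p)) :
    Measurable (rearrange l σ τ) :=
  measurable_id.add (Finset.measurable_sum _ fun _ _ =>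
    measurable_const.indicator measurableSet_Ico)

/-- `rearrange` as an invertible map. -/
noncomputable def rearrangeEquiv {l : Fin p → ℝ} (hl : l ∈ stdSimplex ℝ (Fin p))
    (σ τ : Equiv.Perm (Fin p)) : ℝ ≃ᵐ ℝ where
  toFun := rearrange l σ τ
  invFun := rearrange l τ σ
  left_inv := rearrange_rearrange hl σ τ
  right_inv := rearrange_rearrange hl τ σ
  measurable_toFun := measurable_rearrange l σ τ
  measurable_invFun := measurable_rearrange l τ σ

theorem coe_rearrangeEquiv {l : Fin p → ℝ} (hl : l ∈ stdSimplex ℝ (Fin p))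
    (σ τ : Equiv.Perm (Fin p)) : ⇑(rearrangeEquiv hl σ τ) = rearrange l σ τ := rfl

theorem volume_eq_sum_pieces {l : Fin p → ℝ} (hl : l ∈ stdSimplex ℝ (Fin p))
    (σ : Equiv.Perm (Fin p)) {B : Set ℝ} (hB : MeasurableSet B) :
    volume B = volume (B \ Set.Ico 0 1) + ∑ j, volume (B ∩ piece l σ j) := by
  have h₁ : B ∩ Set.Ico 0 1 = ⋃ j, B ∩ piece l σ j := by
    ext x
    rw [Set.mem_iUnion]
    constructor
    · rintro ⟨hx, hx'⟩
      obtain ⟨j, hj⟩ := exists_mem_piece hl σ hx'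
      exact ⟨j, hx, hj⟩
    · rintro ⟨j, hx, hj⟩
      exact ⟨hx, piece_subset hl σ j hj⟩
  rw [← measure_sdiff_add_inter B measurableSet_Ico, h₁, measure_iUnion, tsum_fintype]
  · intro i j hij
    refine Set.disjoint_left.2 fun x hx hx' => hij (eq_of_mem_piece hl.1 hx.2 hx'.2)
  · exact fun j => hB.inter measurableSet_Ico

theorem measurePreserving_rearrange {l : Fin p → ℝ} (hl : l ∈ stdSimplex ℝ (Fin p))
    (σ τ : Equiv.Perm (Fin p)) : MeasurePreserving (rearrange l σ τ) volume volume := by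
  refine ⟨measurable_rearrange l σ τ, ?_⟩
  ext B hB
  have hB' := measurable_rearrange l σ τ hB
  rw [Measure.map_apply (measurable_rearrange l σ τ) hB, volume_eq_sum_pieces hl σ hB',
    volume_eq_sum_pieces hl τ hB]
  congr 1
  · congr 1
    ext x
    refine and_congr_left fun hx => ?_
    rw [Set.mem_preimage, rearrange_of_notMem hl σ τ hx]
  · refine Finset.sum_congr rfl fun j _ => ?_
    have : rearrange l σ τ ⁻¹' B ∩ piece l σ j =
        (fun x => x + (leftEnd l τ j - leftEnd l σ j)) ⁻¹' (B ∩ piece l τ j) := by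
      ext x
      constructor
      · rintro ⟨hx, hj⟩
        have h₁ := rearrange_mem_piece hl.1 τ hj
        rw [Set.mem_preimage, rearrange_of_mem hl.1 τ hj] at hx
        rw [rearrange_of_mem hl.1 τ hj] at h₁
        exact ⟨hx, h₁⟩
      · rintro ⟨hx, hj⟩
        have hj' : x ∈ piece l σ j := by
          have h₁ := hj.1
          have h₂ := hj.2
          simp only at h₁ h₂
          constructor <;> linarith
        refine ⟨?_, hj'⟩
        rw [Set.mem_preimage, rearrange_of_mem hl.1 τ hj']
        exact hx
    rw [this, measure_preimage_add_right]

open Classical in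
theorem isExchange_rearrange {l : Fin p → ℝ} (hl : l ∈ stdSimplex ℝ (Fin p))
    (σ τ : Equiv.Perm (Fin p)) :
    IsExchange (rearrangeEquiv hl σ τ) (Finset.univ.image (leftEnd l σ)) where
  mem_iff := rearrange_mem_Ico_iff hl σ τ
  measurePreserving := measurePreserving_rearrange hl σ τ
  zero_mem := by
    obtain ⟨j, hj⟩ := exists_leftEnd_eq_zero (card_pos_of_mem_stdSimplex hl) l σ
    exact Finset.mem_image.2 ⟨j, Finset.mem_univ _, hj⟩
  sub_eq u z hu huz hz hd := by
    obtain ⟨j, hj⟩ := exists_mem_piece hl σ ⟨hu.trans huz, hz⟩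
    have hju : u ∈ piece l σ j := by
      refine ⟨?_, huz.trans_lt hj.2⟩
      by_contra hcon
      exact absurd (hd _ (Finset.mem_image_of_mem _ (Finset.mem_univ j)) (not_le.1 hcon))
        (not_lt.2 hj.1)
    rw [coe_rearrangeEquiv, rearrange_of_mem hl.1 τ hj, rearrange_of_mem hl.1 τ hju]
    ring

/-! ### Dependence on the lengths -/

theorem tendsto_leftEnd {u : ℕ → Fin p → ℝ} {l : Fin p → ℝ} (hu : Tendsto u atTop (𝓝 l))
    (σ : Equiv.Perm (Fin p)) (j : Fin p) :
    Tendsto (fun k => leftEnd (u k) σ j) atTop (𝓝 (leftEnd l σ j)) :=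
  tendsto_finsetSum _ fun i _ => tendsto_pi_nhds.1 hu i

/-- A point that is not a left endpoint is interior to its piece, so nearby points under nearby
lengths lie in the piece with the same index. -/
theorem tendsto_rearrange {u : ℕ → Fin p → ℝ} {l : Fin p → ℝ} (hu : Tendsto u atTop (𝓝 l))
    (hus : ∀ k, u k ∈ stdSimplex ℝ (Fin p)) (hl : l ∈ stdSimplex ℝ (Fin p))
    (σ τ : Equiv.Perm (Fin p)) {y : ℕ → ℝ} {x : ℝ} (hy : Tendsto y atTop (𝓝 x))
    (hx : x ∈ Set.Ico (0 : ℝ) 1) (hxD : ∀ j, leftEnd l σ j ≠ x) :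
    Tendsto (fun k => rearrange (u k) σ τ (y k)) atTop (𝓝 (rearrange l σ τ x)) := by
  obtain ⟨j, hj⟩ := exists_mem_piece hl σ hx
  have h₁ := tendsto_leftEnd hu σ j
  have h₂ := tendsto_leftEnd hu τ j
  have h₃ := tendsto_pi_nhds.1 hu j
  have hlt : leftEnd l σ j < x := lt_of_le_of_ne hj.1 (hxD j)
  rw [rearrange_of_mem hl.1 τ hj]
  refine (hy.add (h₂.sub h₁)).congr' ?_
  filter_upwards [h₁.eventually_lt hy hlt, hy.eventually_lt (h₁.add h₃) hj.2] with k hk hk'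
  exact (rearrange_of_mem (hus k).1 τ ⟨hk.le, hk'⟩).symm

/-- Only the countably many points whose limiting orbit meets a left endpoint are excluded. -/
theorem ae_tendsto_rearrange_iterate {u : ℕ → Fin p → ℝ} {l : Fin p → ℝ}
    (hu : Tendsto u atTop (𝓝 l)) (hus : ∀ k, u k ∈ stdSimplex ℝ (Fin p))
    (hl : l ∈ stdSimplex ℝ (Fin p)) (σ τ : Equiv.Perm (Fin p)) :
    ∀ᵐ x ∂volume.restrict (Set.Ico (0 : ℝ) 1), ∀ m : ℕ,
      Tendsto (fun k => (rearrange (u k) σ τ)^[m] x) atTop (𝓝 ((rearrange l σ τ)^[m] x)) := by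
  have hinj : Function.Injective (rearrange l σ τ) := (rearrangeEquiv hl σ τ).injective
  have hcount : (⋃ m : ℕ, (rearrange l σ τ)^[m] ⁻¹' Set.range (leftEnd l σ)).Countable :=
    Set.countable_iUnion fun m =>
      (Set.finite_range _).countable.preimage_of_injOn (hinj.iterate m).injOn
  have hnull := hcount.measure_zero (volume.restrict (Set.Ico (0 : ℝ) 1))
  filter_upwards [measure_eq_zero_iff_ae_notMem.1 hnull, ae_restrict_mem measurableSet_Ico]
    with x hx hx01 m
  induction m with
  | zero => simp
  | succ m ih =>
    simp only [Function.iterate_succ_apply']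
    refine tendsto_rearrange hu hus hl σ τ ih ?_ ?_
    · exact ((isExchange_rearrange hl σ τ).iterate_mem_iff m x).2 hx01
    · intro j hj
      exact hx (Set.mem_iUnion.2 ⟨m, j, hj⟩)

end Exchange

/-! ### Partial rigidity, uniformly over all exchanges of a given number of intervals -/

/-- There are a continuous weight `φ` of mass at least `c`, almost invariant under `f`, and `N + 1`
times below `M`, at distance at least `n` from each other, at which `f` is close to the identity
where `φ` is not small. -/
def IsRigidFor (f : ℝ → ℝ) (N n M : ℕ) (c ε : ℝ) : Prop :=
  ∃ (φ : ℝ → ℝ) (m : ℕ → ℕ), Continuous φ ∧ (∀ x, 0 ≤ φ x ∧ φ x ≤ 1) ∧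
    (∀ i < N, m i + n ≤ m (i + 1)) ∧ (∀ i ≤ N, m i ≤ M) ∧
    c ≤ ∫ x in Set.Ico (0 : ℝ) 1, φ x ∧
    ∫ x in Set.Ico (0 : ℝ) 1, |φ (f x) - φ x| ≤ ε ∧
    ∀ i ≤ N, ∫ x in Set.Ico (0 : ℝ) 1, φ x * |f^[m i] x - x| ≤ ε

theorem IsRigidFor.mono {f : ℝ → ℝ} {N n M M' : ℕ} {c ε : ℝ} (h : IsRigidFor f N n M c ε)
    (hM : M ≤ M') : IsRigidFor f N n M' c ε := by
  obtain ⟨φ, m, h₁, h₂, h₃, h₄, h₅⟩ := h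
  exact ⟨φ, m, h₁, h₂, h₃, fun i hi => (h₄ i hi).trans hM, h₅⟩

/-- The indicator of E is smoothed because φ ∘ f must converge when f converges almost everywhere,
as the compactness argument requires. -/
theorem exists_continuous_near_indicator {E : Set ℝ} (hE : MeasurableSet E)
    (hE1 : volume E ≠ ⊤) {ε : ℝ} (hε : 0 < ε) :
    ∃ φ : ℝ → ℝ, Continuous φ ∧ (∀ x, 0 ≤ φ x ∧ φ x ≤ 1) ∧
      ∫ x in Set.Ico (0 : ℝ) 1, |φ x - E.indicator 1 x| ≤ ε := by
  have hint : Integrable (E.indicator (1 : ℝ → ℝ)) :=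
    (integrable_indicator_iff hE).2 (integrableOn_const hE1)
  obtain ⟨g, -, hg, hgc, hgi⟩ := hint.exists_hasCompactSupport_integral_sub_le hε
  refine ⟨fun x => max 0 (min 1 (g x)), by fun_prop, fun x => ⟨le_max_left _ _, ?_⟩, ?_⟩
  · exact max_le zero_le_one (min_le_left _ _)
  · have hle : ∀ x, |max 0 (min 1 (g x)) - E.indicator 1 x| ≤ ‖E.indicator 1 x - g x‖ := by
      intro x
      rw [Real.norm_eq_abs, abs_sub_comm _ (g x)]
      by_cases hx : x ∈ E
      · rw [Set.indicator_of_mem hx]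
        simp only [Pi.one_apply]
        rcases le_total 1 (g x) with h | h
        · rw [min_eq_left h, max_eq_right zero_le_one]; simp
        · rw [min_eq_right h]
          rcases le_total 0 (g x) with h' | h'
          · rw [max_eq_right h']
          · rw [max_eq_left h', abs_of_nonpos (by norm_num), abs_of_nonpos (by linarith)]
            linarith
      · rw [Set.indicator_of_notMem hx, sub_zero, sub_zero]
        rcases le_total 0 (g x) with h' | h'
        · rw [max_eq_right (le_min zero_le_one h'), abs_of_nonneg (le_min zero_le_one h'),
            abs_of_nonneg h']
          exact min_le_right _ _
        · rw [max_eq_left ((min_le_right _ _).trans h')]; simp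
    have hi : Integrable fun x => ‖E.indicator 1 x - g x‖ := (hint.sub hgi).norm
    calc ∫ x in Set.Ico (0 : ℝ) 1, |max 0 (min 1 (g x)) - E.indicator 1 x|
        ≤ ∫ x in Set.Ico (0 : ℝ) 1, ‖E.indicator 1 x - g x‖ :=
          integral_mono_of_nonneg (ae_of_all _ fun x => abs_nonneg _) hi.integrableOn
            (ae_of_all _ hle)
      _ ≤ ∫ x, ‖E.indicator 1 x - g x‖ :=
          setIntegral_le_integral hi (ae_of_all _ fun x => norm_nonneg _)
      _ ≤ ε := hg

theorem integrable_of_bounded_measurable {Y : Type*} [MeasurableSpace Y] {ν : Measure Y}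
    [IsFiniteMeasure ν] {g : Y → ℝ} (hg : Measurable g) {K : ℝ} (hK : ∀ᵐ y ∂ν, |g y| ≤ K) :
    Integrable g ν :=
  Integrable.of_bound hg.aestronglyMeasurable K hK

theorem IsExchange.exists_isRigidFor {f : ℝ ≃ᵐ ℝ} {D : Finset ℝ} (hf : IsExchange f D) {p : ℕ}
    (hp : D.card ≤ p) (N n : ℕ) {ε : ℝ} (hε : 0 < ε) :
    ∃ M, IsRigidFor f N n M (rigidityConst p N / 2) ε := by
  have hp0 : 0 < p := (Finset.card_pos.2 ⟨0, hf.zero_mem⟩).trans_le hp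
  have hc := rigidityConst_pos hp0 N
  set c := rigidityConst p N
  -- The bound c/2 keeps half of the mass; ε/3 serves the three-term splitting of φ ∘ f - φ through
  -- the indicator of E.
  obtain ⟨ε', hε', hε'c, hε'ε⟩ : ∃ ε' : ℝ, 0 < ε' ∧ ε' ≤ c / 2 ∧ ε' ≤ ε / 3 :=
    ⟨min (c / 2) (ε / 3), by positivity, min_le_left _ _, min_le_right _ _⟩
  obtain ⟨E, m, hEm, hE01, hm, hvol, hinv, hrig⟩ := hf.exists_rigid hp N n
    (show 0 < ε / 3 by positivity)
  have hEfin : volume E ≠ ⊤ :=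
    ((measure_mono hE01).trans_lt (by simp : volume (Set.Ico (0 : ℝ) 1) < ⊤)).ne
  obtain ⟨φ, hφc, hφ, hφE⟩ := exists_continuous_near_indicator hEm hEfin hε'
  have hχm : Measurable (E.indicator (1 : ℝ → ℝ)) := measurable_one.indicator hEm
  have hχ : ∀ x, 0 ≤ E.indicator (1 : ℝ → ℝ) x ∧ E.indicator (1 : ℝ → ℝ) x ≤ 1 := fun x => by
    by_cases hx : x ∈ E <;> simp [hx]
  have hdm : Measurable fun x => |φ x - E.indicator 1 x| := (hφc.measurable.sub hχm).abs
  set lam := volume.restrict (Set.Ico (0 : ℝ) 1)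
  have hd1 : ∀ x, |(|φ x - E.indicator 1 x|)| ≤ 1 := fun x => by
    rw [abs_abs, abs_le]
    constructor <;> linarith [(hφ x).1, (hφ x).2, (hχ x).1, (hχ x).2]
  have hdi : Integrable (fun x => |φ x - E.indicator 1 x|) lam :=
    integrable_of_bounded_measurable hdm (ae_of_all _ hd1)
  have hφi : Integrable φ lam := integrable_of_bounded_measurable (K := 1) hφc.measurable
    (ae_of_all _ fun x => abs_le.2 ⟨by linarith [(hφ x).1], (hφ x).2⟩)
  have hχi : Integrable (E.indicator (1 : ℝ → ℝ)) lam :=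
    integrable_of_bounded_measurable (K := 1) hχm
      (ae_of_all _ fun x => abs_le.2 ⟨by linarith [(hχ x).1], (hχ x).2⟩)
  have hχint : ∫ x, E.indicator (1 : ℝ → ℝ) x ∂lam = volume.real E := by
    rw [integral_indicator_one hEm, measureReal_def, Measure.restrict_apply hEm,
      Set.inter_eq_self_of_subset_left hE01, measureReal_def]
  refine ⟨(Finset.range (N + 1)).sup m, φ, m, hφc, hφ, hm, fun i hi =>
    Finset.le_sup (Finset.mem_range.2 (by omega)), ?_, ?_, ?_⟩
  · have h₁ : ∫ x, (E.indicator 1 x - φ x) ∂lam ≤ ∫ x, |φ x - E.indicator 1 x| ∂lam :=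
      integral_mono (hχi.sub hφi) hdi fun x => by
        rw [abs_sub_comm]; exact le_abs_self _
    rw [integral_sub hχi hφi, hχint] at h₁
    linarith
  · have hmp := hf.measurePreserving_restrict
    have h₁ : ∫ x, |φ (f x) - E.indicator 1 (f x)| ∂lam = ∫ x, |φ x - E.indicator 1 x| ∂lam :=
      hmp.integral_comp f.measurableEmbedding (fun x => |φ x - E.indicator 1 x|)
    have h₂ : ∫ x, |E.indicator (1 : ℝ → ℝ) (f x) - E.indicator 1 x| ∂lam ≤ ε / 3 := by
      have hle : (fun x => |E.indicator (1 : ℝ → ℝ) (f x) - E.indicator 1 x|) =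
          (E ∆ (f ⁻¹' E)).indicator 1 := by
        ext x
        by_cases hx : x ∈ E <;> by_cases hx' : f x ∈ E <;>
          simp [Set.indicator, Set.mem_symmDiff, hx, hx']
      rw [hle, integral_indicator_one (hEm.symmDiff (f.measurable hEm))]
      refine (ENNReal.toReal_mono ?_ (Measure.restrict_apply_le _ _)).trans hinv
      refine ((measure_mono (t := Set.Ico (0 : ℝ) 1) ?_).trans_lt (by simp)).ne
      rintro x (⟨hx, -⟩ | ⟨hx, -⟩)
      · exact hE01 hx
      · exact (hf.mem_iff x).1 (hE01 hx)
    have hi₁ : Integrable (fun x => |φ (f x) - E.indicator 1 (f x)|) lam :=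
      integrable_of_bounded_measurable (hdm.comp f.measurable) (ae_of_all _ fun x => hd1 (f x))
    have hi₂ : Integrable (fun x => |E.indicator (1 : ℝ → ℝ) (f x) - E.indicator 1 x|) lam :=
      integrable_of_bounded_measurable (K := 1) ((hχm.comp f.measurable).sub hχm).abs
        (ae_of_all _ fun x => by
          rw [abs_abs, abs_le]
          constructor <;> linarith [(hχ x).1, (hχ x).2, (hχ (f x)).1, (hχ (f x)).2])
    calc ∫ x, |φ (f x) - φ x| ∂lam
        ≤ ∫ x, ((|φ (f x) - E.indicator 1 (f x)| + |E.indicator (1 : ℝ → ℝ) (f x) -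
            E.indicator 1 x|) + |φ x - E.indicator 1 x|) ∂lam := by
          refine integral_mono_of_nonneg (ae_of_all _ fun x => abs_nonneg _)
            ((hi₁.add hi₂).add hdi) (ae_of_all _ fun x => ?_)
          have e : φ (f x) - φ x = (φ (f x) - E.indicator 1 (f x)) +
            (E.indicator (1 : ℝ → ℝ) (f x) - E.indicator 1 x) - (φ x - E.indicator 1 x) := by ring
          simp only
          rw [e]
          refine (abs_sub _ _).trans ?_
          gcongr
          exact abs_add_le _ _
      _ ≤ ε := by
          have h₅ := integral_add (hi₁.add hi₂) hdi
          simp only [Pi.add_apply] at h₅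
          rw [h₅, integral_add hi₁ hi₂, h₁]
          linarith
  · intro i hi
    have hpt : ∀ᵐ x ∂lam, φ x * |f^[m i] x - x| ≤ |φ x - E.indicator 1 x| + ε / 3 := by
      filter_upwards [ae_restrict_mem measurableSet_Ico] with x hx
      have hx' := (hf.iterate_mem_iff (m i) x).2 hx
      have h₁ : |f^[m i] x - x| ≤ 1 := abs_le.2
        ⟨by linarith [hx.2, hx'.1], by linarith [hx.1, hx'.2]⟩
      have h₂ : E.indicator (1 : ℝ → ℝ) x * |f^[m i] x - x| ≤ ε / 3 := by
        by_cases hxE : x ∈ E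
        · rw [Set.indicator_of_mem hxE]
          simpa using hrig i hi x hxE
        · rw [Set.indicator_of_notMem hxE]
          simp; positivity
      have h₃ : (φ x - E.indicator 1 x) * |f^[m i] x - x| ≤ |φ x - E.indicator 1 x| :=
        (mul_le_mul_of_nonneg_right (le_abs_self _) (abs_nonneg _)).trans
          (mul_le_of_le_one_right (abs_nonneg _) h₁)
      linarith
    have hprob : lam.real Set.univ = 1 := by simp [lam, measureReal_def]
    calc ∫ x, φ x * |f^[m i] x - x| ∂lam ≤ ∫ x, (|φ x - E.indicator 1 x| + ε / 3) ∂lam :=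
          integral_mono_of_nonneg
            (ae_of_all _ fun x => mul_nonneg (hφ x).1 (abs_nonneg _))
            (hdi.add (integrable_const _)) hpt
      _ ≤ ε := by
          rw [integral_add hdi (integrable_const _), integral_const, hprob]
          simp only [smul_eq_mul, one_mul]
          linarith

/-- Compactness of the closed simplex, the reason for admitting zero lengths: if no bound worked,
exchanges violating larger and larger bounds would converge to an exchange whose own weight and
times, by dominated convergence, also serve the late terms. -/
theorem exists_uniform_isRigidFor {p : ℕ} (hp : 0 < p) (N n : ℕ) {ε : ℝ} (hε : 0 < ε) :
    ∃ M, ∀ l ∈ stdSimplex ℝ (Fin p), ∀ π : Equiv.Perm (Fin p),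
      IsRigidFor (rearrange l 1 π) N n M (IsExchange.rigidityConst p N / 4) ε := by
  classical
  have hc := IsExchange.rigidityConst_pos hp N
  set c := IsExchange.rigidityConst p N
  suffices h : ∀ π : Equiv.Perm (Fin p), ∃ M, ∀ l ∈ stdSimplex ℝ (Fin p),
      IsRigidFor (rearrange l 1 π) N n M (c / 4) ε by
    choose M hM using h
    exact ⟨Finset.univ.sup M, fun l hl π => (hM π l hl).mono (Finset.le_sup (Finset.mem_univ π))⟩
  intro π
  by_contra! hcon
  choose u hus hbad using hcon
  obtain ⟨l, hl, ψ, hψ, hlim⟩ := (isCompact_stdSimplex ℝ (Fin p)).tendsto_subseq hus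
  have hcard : (Finset.univ.image (leftEnd l 1)).card ≤ p := by
    simpa using Finset.card_image_le (s := (Finset.univ : Finset (Fin p))) (f := leftEnd l 1)
  obtain ⟨M, φ, m, hφc, hφ, hm, hmM, hmass, hinv, hrig⟩ :=
    (isExchange_rearrange hl 1 π).exists_isRigidFor hcard N n (show 0 < ε / 2 by positivity)
  rw [coe_rearrangeEquiv] at hinv hrig
  have hus' : ∀ k, u (ψ k) ∈ stdSimplex ℝ (Fin p) := fun k => hus _
  have hae := ae_tendsto_rearrange_iterate hlim hus' hl 1 π
  set lam := volume.restrict (Set.Ico (0 : ℝ) 1)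
  have hmeas := fun k => measurable_rearrange (u (ψ k)) 1 π
  have t₁ : Tendsto (fun k => ∫ x, |φ (rearrange (u (ψ k)) 1 π x) - φ x| ∂lam) atTop
      (𝓝 (∫ x, |φ (rearrange l 1 π x) - φ x| ∂lam)) := by
    refine tendsto_integral_of_dominated_convergence (fun _ => 1) (fun k => ?_)
      (integrable_const _) (fun k => ae_of_all _ fun x => ?_) ?_
    · exact ((hφc.measurable.comp (hmeas k)).sub hφc.measurable).abs.aestronglyMeasurable
    · rw [Real.norm_eq_abs, abs_abs, abs_le]
      have a := hφ x
      have b := hφ (rearrange (u (ψ k)) 1 π x)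
      constructor <;> linarith [a.1, a.2, b.1, b.2]
    · filter_upwards [hae] with x hx
      have h₁ := hx 1
      simp only [Function.iterate_one] at h₁
      exact (((hφc.tendsto _).comp h₁).sub_const _).abs
  have t₂ : ∀ i, Tendsto (fun k => ∫ x, φ x * |(rearrange (u (ψ k)) 1 π)^[m i] x - x| ∂lam) atTop
      (𝓝 (∫ x, φ x * |(rearrange l 1 π)^[m i] x - x| ∂lam)) := by
    intro i
    refine tendsto_integral_of_dominated_convergence (fun _ => 1) (fun k => ?_)
      (integrable_const _) (fun k => ?_) ?_
    · exact (hφc.measurable.mul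
        (((hmeas k).iterate (m i)).sub measurable_id).abs).aestronglyMeasurable
    · filter_upwards [ae_restrict_mem measurableSet_Ico] with x hx
      have hx' := ((isExchange_rearrange (hus' k) 1 π).iterate_mem_iff (m i) x).2 hx
      rw [coe_rearrangeEquiv] at hx'
      have h₁ : |(rearrange (u (ψ k)) 1 π)^[m i] x - x| ≤ 1 := abs_le.2
        ⟨by linarith [hx.2, hx'.1], by linarith [hx.1, hx'.2]⟩
      rw [Real.norm_eq_abs, abs_mul, abs_abs, abs_of_nonneg (hφ x).1]
      exact mul_le_one₀ (hφ x).2 (abs_nonneg _) h₁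
    · filter_upwards [hae] with x hx
      exact ((hx (m i)).sub_const _).abs.const_mul _
  have e₁ := t₁.eventually_lt_const (show _ < ε by linarith)
  have e₂ : ∀ᶠ k in atTop, ∀ i ∈ Finset.range (N + 1),
      ∫ x, φ x * |(rearrange (u (ψ k)) 1 π)^[m i] x - x| ∂lam < ε := by
    rw [eventually_all_finset]
    intro i hi
    have := hrig i (by have := Finset.mem_range.1 hi; omega)
    exact (t₂ i).eventually_lt_const (show _ < ε by linarith)
  -- With k ≥ M also ψ k ≥ M, so the times of the limit respect the bound that u (ψ k) is supposed
  -- to violate.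
  obtain ⟨k, hk₁, hk₂, hkM⟩ := (e₁.and (e₂.and (eventually_ge_atTop M))).exists
  refine hbad (ψ k) ⟨φ, m, hφc, hφ, hm, fun i hi => (hmM i hi).trans (hkM.trans (hψ.id_le k)), ?_,
    hk₁.le, fun i hi => (hk₂ i (Finset.mem_range.2 (by omega))).le⟩
  linarith

/-! ### Averages -/

/-- An average of almost orthogonal functions is small in mean. -/
theorem integral_abs_average_mul_le {Z : Type*} [MeasurableSpace Z] {γ : Measure Z}
    [IsProbabilityMeasure γ] {u : Z → ℝ} (hu : Measurable u) (hu1 : ∀ z, 0 ≤ u z ∧ u z ≤ 1)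
    {w : ℕ → Z → ℝ} (hw : ∀ a, Measurable (w a)) (hw1 : ∀ a z, |w a z| ≤ 1) {L : ℕ} (hL : 0 < L)
    {κ : ℝ} (hκ : 0 ≤ κ)
    (h : ∀ a < L, ∀ b < L, a < b → ∫ z, w a z * w b z * u z ∂γ ≤ κ) {s : ℝ} (hs : 0 < s) :
    ∫ z, |(∑ a ∈ Finset.range L, w a z) / L| * u z ∂γ ≤
      s * ∫ z, u z ∂γ + ((∫ z, u z ∂γ) / L + κ) / s := by
  have hLr : (0 : ℝ) < L := by exact_mod_cast hL
  have hui : Integrable u γ := integrable_of_bounded_measurable (K := 1) hu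
    (ae_of_all _ fun z => abs_le.2 ⟨by linarith [(hu1 z).1], (hu1 z).2⟩)
  have hbi : ∀ a b, Integrable (fun z => w a z * w b z * u z) γ := fun a b =>
    integrable_of_bounded_measurable (K := 1) (((hw a).mul (hw b)).mul hu) (ae_of_all _ fun z => by
      rw [abs_mul, abs_mul, abs_of_nonneg (hu1 z).1]
      exact mul_le_one₀ (mul_le_one₀ (hw1 a z) (abs_nonneg _) (hw1 b z)) (hu1 z).1 (hu1 z).2)
  -- Diagonal terms cost at most the integral of u, the others at most κ.
  have hoff : ∀ a < L, ∀ b < L, ∫ z, w a z * w b z * u z ∂γ ≤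
      (if a = b then ∫ z, u z ∂γ else 0) + κ := by
    intro a ha b hb
    rcases lt_trichotomy a b with hab | rfl | hab
    · rw [if_neg hab.ne, zero_add]; exact h a ha b hb hab
    · rw [if_pos rfl]
      refine (integral_mono (hbi a a) hui fun z => ?_).trans (le_add_of_nonneg_right hκ)
      refine mul_le_of_le_one_left (hu1 z).1 ?_
      rw [← abs_mul_abs_self]
      exact mul_le_one₀ (hw1 a z) (abs_nonneg _) (hw1 a z)
    · rw [if_neg hab.ne', zero_add]
      refine le_trans (le_of_eq ?_) (h b hb a ha hab)
      exact integral_congr_ae (ae_of_all _ fun z => by simp only; ring)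
  have hsum : ∫ z, ∑ a ∈ Finset.range L, ∑ b ∈ Finset.range L, w a z * w b z * u z ∂γ ≤
      L * ∫ z, u z ∂γ + L * L * κ := by
    rw [integral_finsetSum _ fun a _ => integrable_finsetSum _ fun b _ => hbi a b]
    calc ∑ a ∈ Finset.range L, ∫ z, ∑ b ∈ Finset.range L, w a z * w b z * u z ∂γ
        ≤ ∑ a ∈ Finset.range L, ∑ b ∈ Finset.range L,
          ((if a = b then ∫ z, u z ∂γ else 0) + κ) := by
          refine Finset.sum_le_sum fun a ha => ?_
          rw [integral_finsetSum _ fun b _ => hbi a b]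
          exact Finset.sum_le_sum fun b hb =>
            hoff a (Finset.mem_range.1 ha) b (Finset.mem_range.1 hb)
      _ = ∑ a ∈ Finset.range L, ((∫ z, u z ∂γ) + L * κ) := by
          refine Finset.sum_congr rfl fun a ha => ?_
          rw [Finset.sum_add_distrib, Finset.sum_ite_eq, if_pos ha]
          simp
      _ = L * ∫ z, u z ∂γ + L * L * κ := by
          simp only [Finset.sum_const, Finset.card_range, nsmul_eq_mul]; ring
  have hSi : Integrable (fun z => ∑ a ∈ Finset.range L, ∑ b ∈ Finset.range L,
      w a z * w b z * u z) γ :=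
    integrable_finsetSum _ fun a _ => integrable_finsetSum _ fun b _ => hbi a b
  calc ∫ z, |(∑ a ∈ Finset.range L, w a z) / L| * u z ∂γ
      ≤ ∫ z, (s * u z + (1 / (L * L * s)) * ∑ a ∈ Finset.range L, ∑ b ∈ Finset.range L,
          w a z * w b z * u z) ∂γ := by
        refine integral_mono_of_nonneg
          (ae_of_all _ fun z => mul_nonneg (abs_nonneg _) (hu1 z).1)
          ((hui.const_mul s).add (hSi.const_mul _)) (ae_of_all _ fun z => ?_)
        have e : ∑ a ∈ Finset.range L, ∑ b ∈ Finset.range L, w a z * w b z * u z =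
            (∑ a ∈ Finset.range L, w a z) ^ 2 * u z := by
          rw [sq, Finset.sum_mul_sum, Finset.sum_mul]
          exact Finset.sum_congr rfl fun a _ => (Finset.sum_mul ..).symm
        simp only
        rw [e]
        set W := (∑ a ∈ Finset.range L, w a z) / L with hW
        have e₂ : 1 / (L * L * s) * ((∑ a ∈ Finset.range L, w a z) ^ 2 * u z) =
            W ^ 2 / s * u z := by
          rw [hW]; field_simp
        rw [e₂, ← add_mul]
        refine mul_le_mul_of_nonneg_right ?_ (hu1 z).1
        -- The elementary inequality |W| ≤ s + W² / s takes the place of Cauchy–Schwarz.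
        rcases le_total |W| s with hle | hle
        · exact hle.trans (le_add_of_nonneg_right (by positivity))
        · refine le_trans ?_ (le_add_of_nonneg_left hs.le)
          rw [le_div_iff₀ hs, ← sq_abs, sq]
          exact mul_le_mul_of_nonneg_left hle (abs_nonneg _)
    _ = s * ∫ z, u z ∂γ + (1 / (L * L * s)) * ∫ z, ∑ a ∈ Finset.range L,
          ∑ b ∈ Finset.range L, w a z * w b z * u z ∂γ := by
        rw [integral_add (hui.const_mul s) (hSi.const_mul _), integral_const_mul,
          integral_const_mul]
    _ ≤ s * ∫ z, u z ∂γ + (1 / (L * L * s)) * (L * ∫ z, u z ∂γ + L * L * κ) := by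
        gcongr
    _ = s * ∫ z, u z ∂γ + ((∫ z, u z ∂γ) / L + κ) / s := by
        field_simp

/-! ### Mean ergodic theorem and almost invariant functions -/

theorem LinearIsometry.exists_tendsto_birkhoffAverage {H : Type*} [NormedAddCommGroup H]
    [InnerProductSpace ℝ H] [CompleteSpace H] (U : H →ₗᵢ[ℝ] H) (x : H) :
    ∃ P, U P = P ∧ Tendsto (fun n => birkhoffAverage ℝ U _root_.id n x) atTop (𝓝 P) :=
  ⟨_, ((U.toContinuousLinearMap.eqLocus (1 : H →L[ℝ] H)).orthogonalProjectionOnto x).2,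
    U.toContinuousLinearMap.tendsto_birkhoffAverage_orthogonalProjection
      U.norm_toContinuousLinearMap_le x⟩

/-- The mean ergodic theorem: the averages of an element of `L²` along an ergodic map converge to
a constant. -/
theorem Ergodic.exists_tendsto_birkhoffAverage {Y : Type*} [MeasurableSpace Y] {ν : Measure Y}
    [IsProbabilityMeasure ν] {S : Y → Y} (hS : Ergodic S ν) (x : Lp ℝ 2 ν) :
    ∃ (c : ℝ) (P : Lp ℝ 2 ν), P =ᵐ[ν] Function.const Y c ∧
      Tendsto (fun n => birkhoffAverage ℝ (Lp.compMeasurePreserving S hS.toMeasurePreserving)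
        _root_.id n x) atTop (𝓝 P) := by
  have hSm := hS.toMeasurePreserving
  obtain ⟨P, hPfix, hlim⟩ :=
    (Lp.compMeasurePreservingₗᵢ ℝ S hSm).exists_tendsto_birkhoffAverage x
  change Lp.compMeasurePreserving S hSm P = P at hPfix
  have hPinv : (P : Y → ℝ) ∘ S =ᵐ[ν] P := by
    have := Lp.coeFn_compMeasurePreserving P hSm
    rw [hPfix] at this
    exact this.symm
  obtain ⟨c, hc⟩ := hS.ae_eq_const_of_ae_eq_comp_ae (Lp.aestronglyMeasurable P) hPinv
  exact ⟨c, P, hc, hlim⟩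

theorem coeFn_birkhoffAverage_toLp {Y : Type*} [MeasurableSpace Y] {ν : Measure Y}
    {S : Y → Y} (hS : MeasurePreserving S ν ν) {ψ : Y → ℝ} (hψ : MemLp ψ 2 ν) (n : ℕ) :
    (birkhoffAverage ℝ (Lp.compMeasurePreserving (E := ℝ) (p := 2) S hS) _root_.id n
      (hψ.toLp ψ) : Lp ℝ 2 ν) =ᵐ[ν] fun y => (∑ k ∈ Finset.range n, ψ (S^[k] y)) / n := by
  set x : Lp ℝ 2 ν := MemLp.toLp ψ hψ
  set U := Lp.compMeasurePreserving (E := ℝ) (p := 2) S hS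
  have hUk : ∀ k, ((U^[k] x : Lp ℝ 2 ν) : Y → ℝ) =ᵐ[ν] fun y => ψ (S^[k] y) := by
    intro k
    induction k with
    | zero => exact MemLp.coeFn_toLp hψ
    | succ k ih =>
      rw [Function.iterate_succ_apply']
      have h₁ := Lp.coeFn_compMeasurePreserving (U^[k] x) hS
      refine h₁.trans ?_
      filter_upwards [hS.quasiMeasurePreserving.ae ih] with y hy
      simp only [Function.comp_apply, hy, Function.iterate_succ_apply]
  have h₁ : birkhoffAverage ℝ U _root_.id n x =
      (n : ℝ)⁻¹ • ∑ k ∈ Finset.range n, U^[k] x := rfl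
  rw [h₁]
  refine (Lp.coeFn_smul _ _).trans ?_
  have h₂ : ∀ s : Finset ℕ, ((∑ k ∈ s, U^[k] x : Lp ℝ 2 ν) : Y → ℝ) =ᵐ[ν]
      fun y => ∑ k ∈ s, ψ (S^[k] y) := by
    intro s
    induction s using Finset.induction_on with
    | empty => exact Lp.coeFn_zero ℝ 2 ν
    | insert a s ha ih =>
      rw [Finset.sum_insert ha]
      filter_upwards [Lp.coeFn_add (U^[a] x) (∑ k ∈ s, U^[k] x), hUk a, ih] with y h₁ h₂ h₃
      rw [h₁, Pi.add_apply, h₂, h₃, Finset.sum_insert ha]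
  filter_upwards [h₂ (Finset.range n)] with y hy
  simp only [Pi.smul_apply, hy, smul_eq_mul]
  rw [div_eq_inv_mul]

theorem integral_abs_le_norm_Lp {Y : Type*} [MeasurableSpace Y] {ν : Measure Y}
    [IsProbabilityMeasure ν] (D : Lp ℝ 2 ν) : ∫ y, |D y| ∂ν ≤ ‖D‖ := by
  have h₁ := integral_norm_eq_lintegral_enorm (Lp.aestronglyMeasurable D)
  simp only [Real.norm_eq_abs] at h₁
  rw [h₁, ← eLpNorm_one_eq_lintegral_enorm, Lp.norm_def]
  exact ENNReal.toReal_mono (Lp.eLpNorm_ne_top D)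
    (eLpNorm_le_eLpNorm_of_exponent_le (by norm_num) (Lp.aestronglyMeasurable D))

/-- The mean ergodic theorem in `L¹`, for bounded functions. -/
theorem Ergodic.exists_integral_abs_average_sub_le {Y : Type*} [MeasurableSpace Y] {ν : Measure Y}
    [IsProbabilityMeasure ν] {S : Y → Y} (hS : Ergodic S ν) {ψ : Y → ℝ} (hψ : Measurable ψ)
    {K : ℝ} (hK : ∀ y, |ψ y| ≤ K) {η : ℝ} (hη : 0 < η) :
    ∃ L : ℕ, 0 < L ∧
      ∫ y, |(∑ k ∈ Finset.range L, ψ (S^[k] y)) / L - ∫ y, ψ y ∂ν| ∂ν ≤ η := by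
  have hSm := hS.toMeasurePreserving
  have hmem : MemLp ψ 2 ν := MemLp.of_bound hψ.aestronglyMeasurable K (ae_of_all _ hK)
  obtain ⟨c, P, hc, hlim⟩ := hS.exists_tendsto_birkhoffAverage (hmem.toLp ψ)
  obtain ⟨B, hB⟩ : ∃ B, B = fun n => birkhoffAverage ℝ
    (Lp.compMeasurePreserving (E := ℝ) (p := 2) S hSm) _root_.id n (hmem.toLp ψ) := ⟨_, rfl⟩
  have hav : ∀ n, B n =ᵐ[ν] fun y => (∑ k ∈ Finset.range n, ψ (S^[k] y)) / n := fun n => by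
    rw [hB]; exact coeFn_birkhoffAverage_toLp hSm hmem n
  rw [← hB] at hlim
  set av : ℕ → Y → ℝ := fun n y => (∑ k ∈ Finset.range n, ψ (S^[k] y)) / n
  have hnorm : ∀ n, ∫ y, |av n y - c| ∂ν ≤ ‖B n - P‖ := by
    intro n
    refine le_trans (le_of_eq (integral_congr_ae ?_)) (integral_abs_le_norm_Lp (B n - P))
    filter_upwards [Lp.coeFn_sub (B n) P, hav n, hc] with y h₁ h₂ h₃
    rw [h₁, Pi.sub_apply, h₂, h₃]; rfl
  have hψk : ∀ k, Integrable (fun y => ψ (S^[k] y)) ν := fun k =>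
    integrable_of_bounded_measurable (hψ.comp (hSm.measurable.iterate k)) (ae_of_all _ fun y => hK _)
  have havi : ∀ n, Integrable (av n) ν := fun n =>
    (integrable_finsetSum _ fun k _ => hψk k).div_const _
  have hav_int : ∀ n, 0 < n → ∫ y, av n y ∂ν = ∫ y, ψ y ∂ν := by
    intro n hn
    have hn' : (n : ℝ) ≠ 0 := by exact_mod_cast hn.ne'
    have hk : ∀ k, ∫ y, ψ (S^[k] y) ∂ν = ∫ y, ψ y ∂ν := fun k => by
      have hk' := hSm.iterate k
      have := integral_map (μ := ν) hk'.measurable.aemeasurable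
        (f := ψ) hψ.aestronglyMeasurable
      rw [hk'.map_eq] at this
      exact this.symm
    simp only [av]
    rw [integral_div, integral_finsetSum _ fun k _ => hψk k]
    simp only [hk, Finset.sum_const, Finset.card_range, nsmul_eq_mul]
    field_simp
  have hz : Tendsto (fun n => ‖B n - P‖) atTop (𝓝 0) :=
    tendsto_iff_norm_sub_tendsto_zero.1 hlim
  obtain ⟨L, hL, hLpos⟩ := ((hz.eventually_lt_const (show (0 : ℝ) < η / 2 by positivity)).and
    (eventually_gt_atTop 0)).exists
  refine ⟨L, hLpos, ?_⟩
  -- Averaging preserves the integral, which identifies the constant limit up to η/2.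
  have hdiff : |c - ∫ y, ψ y ∂ν| ≤ η / 2 := by
    rw [← hav_int L hLpos, abs_sub_comm]
    have h₁ : (∫ y, av L y ∂ν) - c = ∫ y, (av L y - c) ∂ν := by
      rw [integral_sub (havi L) (integrable_const c)]; simp
    rw [h₁]
    exact (abs_integral_le_integral_abs).trans ((hnorm L).trans hL.le)
  have hci : Integrable (fun y => |av L y - c|) ν := ((havi L).sub (integrable_const c)).abs
  calc ∫ y, |av L y - ∫ y, ψ y ∂ν| ∂ν ≤ ∫ y, (|av L y - c| + η / 2) ∂ν := by
        refine integral_mono_of_nonneg (ae_of_all _ fun y => abs_nonneg _)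
          (hci.add (integrable_const _)) (ae_of_all _ fun y => ?_)
        exact (abs_sub_le _ c _).trans (by simp only; gcongr)
    _ = (∫ y, |av L y - c| ∂ν) + η / 2 := by
        rw [integral_add hci (integrable_const _)]; simp
    _ ≤ η := by linarith [hnorm L]

theorem MeasureTheory.MeasurePreserving.integral_comp_of_measurable {Y Z : Type*} [MeasurableSpace Y]
    [MeasurableSpace Z] {ν : Measure Y} {ν' : Measure Z} {S : Y → Z}
    (hS : MeasurePreserving S ν ν') {g : Z → ℝ} (hg : Measurable g) :
    ∫ y, g (S y) ∂ν = ∫ z, g z ∂ν' := by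
  rw [← hS.map_eq, integral_map hS.measurable.aemeasurable hg.aestronglyMeasurable]

/-- Almost invariance under `S` passes to the iterates of `S`. -/
theorem integral_abs_comp_iterate_sub_le {Y : Type*} [MeasurableSpace Y] {ν : Measure Y}
    [IsProbabilityMeasure ν] {S : Y → Y} (hS : MeasurePreserving S ν ν) {u : Y → ℝ}
    (hu : Measurable u) (hu1 : ∀ y, 0 ≤ u y ∧ u y ≤ 1) {ε : ℝ}
    (h : ∫ y, |u (S y) - u y| ∂ν ≤ ε) (k : ℕ) :
    ∫ y, |u (S^[k] y) - u y| ∂ν ≤ k * ε := by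
  have hui : ∀ f g : Y → Y, Measurable f → Measurable g →
      Integrable (fun y => |u (f y) - u (g y)|) ν := fun f g hf hg =>
    integrable_of_bounded_measurable (K := 1) ((hu.comp hf).sub (hu.comp hg)).abs
      (ae_of_all _ fun y => by
        rw [abs_abs, abs_le]
        constructor <;> linarith [(hu1 (f y)).1, (hu1 (f y)).2, (hu1 (g y)).1, (hu1 (g y)).2])
  have hm := fun k => hS.measurable.iterate k
  induction k with
  | zero => simp
  | succ k ih =>
    have h₁ : ∫ y, |u (S (S^[k] y)) - u (S^[k] y)| ∂ν = ∫ y, |u (S y) - u y| ∂ν :=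
      (hS.iterate k).integral_comp_of_measurable (g := fun y => |u (S y) - u y|)
        ((hu.comp hS.measurable).sub hu).abs
    calc ∫ y, |u (S^[k + 1] y) - u y| ∂ν
        ≤ ∫ y, (|u (S (S^[k] y)) - u (S^[k] y)| + |u (S^[k] y) - u y|) ∂ν := by
          refine integral_mono (hui _ _ (hm _) measurable_id)
            ((hui _ _ (hS.measurable.comp (hm k)) (hm k)).add (hui _ _ (hm k) measurable_id))
            fun y => ?_
          simp only [Function.iterate_succ_apply']
          exact abs_sub_le _ _ _
      _ = (∫ y, |u (S y) - u y| ∂ν) + ∫ y, |u (S^[k] y) - u y| ∂ν := by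
          rw [← h₁]
          exact integral_add (hui _ _ (hS.measurable.comp (hm k)) (hm k))
            (hui _ _ (hm k) measurable_id)
      _ ≤ (k + 1 : ℕ) * ε := by push_cast; linarith

/-- Almost invariant functions are almost uncorrelated with a given function. -/
theorem Ergodic.exists_abs_integral_mul_sub_le {Y : Type*} [MeasurableSpace Y] {ν : Measure Y}
    [IsProbabilityMeasure ν] {S : Y → Y} (hS : Ergodic S ν) {ψ : Y → ℝ} (hψ : Measurable ψ)
    {K : ℝ} (hK : ∀ y, |ψ y| ≤ K) {η : ℝ} (hη : 0 < η) :
    ∃ ε : ℝ, 0 < ε ∧ ∀ u : Y → ℝ, Measurable u → (∀ y, 0 ≤ u y ∧ u y ≤ 1) →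
      ∫ y, |u (S y) - u y| ∂ν ≤ ε →
      |∫ y, ψ y * u y ∂ν - (∫ y, ψ y ∂ν) * ∫ y, u y ∂ν| ≤ η := by
  obtain ⟨L, hL, hav⟩ := hS.exists_integral_abs_average_sub_le hψ hK (half_pos hη)
  have hSm := hS.toMeasurePreserving
  have hm := fun k => hSm.measurable.iterate k
  have hLr : (0 : ℝ) < L := by exact_mod_cast hL
  obtain ⟨y₀⟩ : Nonempty Y := nonempty_of_isProbabilityMeasure ν
  have hK0 : 0 ≤ K := (abs_nonneg _).trans (hK y₀)
  -- Moving u by fewer than L steps changes its integral against ψ by at most K L ε ≤ η/2. The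
  -- function ψ may then be replaced by its ergodic average over L steps, which is nearly constant.
  refine ⟨η / (2 * (K + 1) * L), by positivity, fun u hu hu1 hinv => ?_⟩
  set ε := η / (2 * (K + 1) * L) with hε
  have hu1' : ∀ y, |u y| ≤ 1 := fun y => abs_le.2 ⟨by linarith [(hu1 y).1], (hu1 y).2⟩
  have hint : ∀ k j : ℕ, Integrable (fun y => ψ (S^[k] y) * u (S^[j] y)) ν := fun k j =>
    integrable_of_bounded_measurable (K := K) ((hψ.comp (hm k)).mul (hu.comp (hm j)))
      (ae_of_all _ fun y => by
        rw [abs_mul]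
        exact (mul_le_of_le_one_right (abs_nonneg _) (hu1' _)).trans (hK _))
  have hint0 : ∀ k : ℕ, Integrable (fun y => ψ (S^[k] y) * u y) ν := fun k => hint k 0
  have hui : Integrable u ν := integrable_of_bounded_measurable hu (ae_of_all _ hu1')
  have hstep : ∀ k < L, |∫ y, ψ (S^[k] y) * u y ∂ν - ∫ y, ψ y * u y ∂ν| ≤ η / 2 := by
    intro k hk
    -- Invariance of ν moves both factors by k steps; almost invariance then moves u back.
    have h₁ : ∫ y, ψ y * u y ∂ν = ∫ y, ψ (S^[k] y) * u (S^[k] y) ∂ν :=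
      ((hSm.iterate k).integral_comp_of_measurable (g := fun y => ψ y * u y) (hψ.mul hu)).symm
    have hdi : Integrable (fun y => |u (S^[k] y) - u y|) ν :=
      (((integrable_of_bounded_measurable (hu.comp (hm k)) (ae_of_all _ fun y => hu1' _)).sub
        hui).abs)
    rw [h₁, ← integral_sub (hint0 k) (hint k k)]
    calc |∫ y, (ψ (S^[k] y) * u y - ψ (S^[k] y) * u (S^[k] y)) ∂ν|
        ≤ ∫ y, |ψ (S^[k] y) * u y - ψ (S^[k] y) * u (S^[k] y)| ∂ν := abs_integral_le_integral_abs
      _ ≤ ∫ y, K * |u (S^[k] y) - u y| ∂ν := by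
          refine integral_mono_of_nonneg (ae_of_all _ fun y => abs_nonneg _) (hdi.const_mul K)
            (ae_of_all _ fun y => ?_)
          simp only
          rw [← mul_sub, abs_mul, abs_sub_comm]
          exact mul_le_mul_of_nonneg_right (hK _) (abs_nonneg _)
      _ ≤ K * (k * ε) := by
          rw [integral_const_mul]
          exact mul_le_mul_of_nonneg_left (integral_abs_comp_iterate_sub_le hSm hu hu1 hinv k) hK0
      _ ≤ (K + 1) * (L * ε) := by
          have : (k : ℝ) ≤ L := by exact_mod_cast hk.le
          have : 0 < ε := by positivity
          gcongr
          linarith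
      _ = η / 2 := by rw [hε]; field_simp
  have hA : |∫ y, (∑ k ∈ Finset.range L, ψ (S^[k] y)) / L * u y ∂ν - ∫ y, ψ y * u y ∂ν|
      ≤ η / 2 := by
    have e : ∫ y, (∑ k ∈ Finset.range L, ψ (S^[k] y)) / L * u y ∂ν - ∫ y, ψ y * u y ∂ν =
        (∑ k ∈ Finset.range L, (∫ y, ψ (S^[k] y) * u y ∂ν - ∫ y, ψ y * u y ∂ν)) / L := by
      rw [Finset.sum_sub_distrib, Finset.sum_const, Finset.card_range, nsmul_eq_mul, sub_div,
        mul_div_cancel_left₀ _ hLr.ne', ← integral_finsetSum _ fun k _ => hint0 k, ← integral_div]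
      congr 1
      refine integral_congr_ae (ae_of_all _ fun y => ?_)
      simp only
      rw [Finset.sum_div, Finset.sum_mul, Finset.sum_div]
      exact Finset.sum_congr rfl fun k _ => by ring
    rw [e, abs_div, abs_of_pos hLr, div_le_iff₀ hLr]
    refine (Finset.abs_sum_le_sum_abs _ _).trans ?_
    refine (Finset.sum_le_sum fun k hk => hstep k (Finset.mem_range.1 hk)).trans ?_
    rw [Finset.sum_const, Finset.card_range, nsmul_eq_mul, mul_comm]
  have havm : Measurable fun y => (∑ k ∈ Finset.range L, ψ (S^[k] y)) / (L : ℝ) :=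
    (Finset.measurable_sum _ fun k _ => hψ.comp (hm k)).div_const _
  have havi : Integrable (fun y => (∑ k ∈ Finset.range L, ψ (S^[k] y)) / (L : ℝ)) ν :=
    (integrable_finsetSum _ fun k _ =>
      integrable_of_bounded_measurable (hψ.comp (hm k)) (ae_of_all _ fun y => hK _)).div_const _
  have havui : Integrable (fun y => (∑ k ∈ Finset.range L, ψ (S^[k] y)) / (L : ℝ) * u y) ν :=
    havi.mul_bdd (c := 1) hu.aestronglyMeasurable (ae_of_all _ hu1')
  have hB : |∫ y, (∑ k ∈ Finset.range L, ψ (S^[k] y)) / L * u y ∂ν -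
      (∫ y, ψ y ∂ν) * ∫ y, u y ∂ν| ≤ η / 2 := by
    rw [← integral_const_mul, ← integral_sub havui (hui.const_mul _)]
    refine abs_integral_le_integral_abs.trans (le_trans ?_ hav)
    refine integral_mono_of_nonneg (ae_of_all _ fun y => abs_nonneg _)
      (havi.sub (integrable_const _)).abs (ae_of_all _ fun y => ?_)
    simp only
    rw [← sub_mul, abs_mul]
    exact mul_le_of_le_one_right (abs_nonneg _) (hu1' y)
  have := abs_sub_le (∫ y, ψ y * u y ∂ν)
    (∫ y, (∑ k ∈ Finset.range L, ψ (S^[k] y)) / L * u y ∂ν) ((∫ y, ψ y ∂ν) * ∫ y, u y ∂ν)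
  rw [abs_sub_comm] at hA
  linarith

/-! ### Correlations of a window mixing transformation -/

theorem SimpleFunc.exists_bound {X : Type*} [MeasurableSpace X] (F : SimpleFunc X ℝ) :
    ∃ C, ∀ x, |F x| ≤ C := by
  obtain ⟨C, hC⟩ := F.exists_forall_norm_le
  exact ⟨C, hC⟩

theorem SimpleFunc.integrable_mul_comp {X : Type*} [MeasurableSpace X] {μ : Measure X}
    [IsFiniteMeasure μ] (F G : SimpleFunc X ℝ) {T : X → X} (hT : Measurable T) :
    Integrable (fun x => F x * G (T x)) μ := by
  obtain ⟨C, hC⟩ := SimpleFunc.exists_bound F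
  obtain ⟨D, hD⟩ := SimpleFunc.exists_bound G
  refine integrable_of_bounded_measurable (K := C * D) (F.measurable.mul (G.measurable.comp hT))
    (ae_of_all _ fun x => ?_)
  rw [abs_mul]
  exact mul_le_mul (hC _) (hD _) (abs_nonneg _) ((abs_nonneg _).trans (hC x))

theorem IsWindowMixing.simpleFunc {X : Type*} [MeasurableSpace X] {μ : Measure X}
    [IsProbabilityMeasure μ] {T : X → X} {M : ℕ → ℕ → ℕ} {n : ℕ → ℕ}
    (hT : Measurable T) (hW : IsWindowMixing μ T M n) (F G : SimpleFunc X ℝ) :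
    ∀ η : ℝ, 0 < η → ∀ᶠ r in atTop, ∀ j, n r ≤ j → j ≤ M r (n r) →
      |∫ x, F x * G (T^[j] x) ∂μ - (∫ x, F x ∂μ) * ∫ x, G x ∂μ| ≤ η := by
  have hi : ∀ (F G : SimpleFunc X ℝ) (j : ℕ), Integrable (fun x => F x * G (T^[j] x)) μ :=
    fun F G j => SimpleFunc.integrable_mul_comp F G (hT.iterate j)
  have hi1 : ∀ F : SimpleFunc X ℝ, Integrable F μ := fun F => F.integrable_of_isFiniteMeasure
  induction F using SimpleFunc.induction with
  | @add F₁ F₂ _ h₁ h₂ =>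
    intro η hη
    filter_upwards [h₁ (η / 2) (half_pos hη), h₂ (η / 2) (half_pos hη)] with r hr₁ hr₂ j hj hj'
    have e : ∫ x, (F₁ + F₂) x * G (T^[j] x) ∂μ - (∫ x, (F₁ + F₂) x ∂μ) * ∫ x, G x ∂μ =
        (∫ x, F₁ x * G (T^[j] x) ∂μ - (∫ x, F₁ x ∂μ) * ∫ x, G x ∂μ) +
        (∫ x, F₂ x * G (T^[j] x) ∂μ - (∫ x, F₂ x ∂μ) * ∫ x, G x ∂μ) := by
      simp only [SimpleFunc.coe_add, Pi.add_apply, add_mul]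
      rw [integral_add (hi F₁ G j) (hi F₂ G j), integral_add (hi1 F₁) (hi1 F₂)]
      ring
    rw [e]
    exact (abs_add_le _ _).trans (by linarith [hr₁ j hj hj', hr₂ j hj hj'])
  | const c hs =>
    rename_i s
    induction G using SimpleFunc.induction with
    | @add G₁ G₂ _ h₁ h₂ =>
      intro η hη
      filter_upwards [h₁ (η / 2) (half_pos hη), h₂ (η / 2) (half_pos hη)] with r hr₁ hr₂ j hj hj'
      set F := SimpleFunc.piecewise s hs (SimpleFunc.const X c) (SimpleFunc.const X 0)
      have e : ∫ x, F x * (G₁ + G₂) (T^[j] x) ∂μ - (∫ x, F x ∂μ) * ∫ x, (G₁ + G₂) x ∂μ =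
          (∫ x, F x * G₁ (T^[j] x) ∂μ - (∫ x, F x ∂μ) * ∫ x, G₁ x ∂μ) +
          (∫ x, F x * G₂ (T^[j] x) ∂μ - (∫ x, F x ∂μ) * ∫ x, G₂ x ∂μ) := by
        simp only [SimpleFunc.coe_add, Pi.add_apply, mul_add]
        rw [integral_add (hi F G₁ j) (hi F G₂ j), integral_add (hi1 G₁) (hi1 G₂)]
        ring
      rw [e]
      exact (abs_add_le _ _).trans (by linarith [hr₁ j hj hj', hr₂ j hj hj'])
    | const d ht =>
      rename_i t
      intro η hη
      filter_upwards [hW s t hs ht (η / (|c * d| + 1)) (by positivity)] with r hr j hj hj'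
      have e₀ : ∀ (a : ℝ) (v : Set X) (hv : MeasurableSet v),
          ∫ x, SimpleFunc.piecewise v hv (SimpleFunc.const X a) (SimpleFunc.const X 0) x ∂μ =
            a * μ.real v := by
        intro a v hv
        have : (fun x => SimpleFunc.piecewise v hv (SimpleFunc.const X a) (SimpleFunc.const X 0) x)
            = fun x => a * v.indicator 1 x := by
          ext x
          by_cases hx : x ∈ v <;> simp [SimpleFunc.coe_piecewise, Set.piecewise, hx]
        rw [this, integral_const_mul, integral_indicator_one hv]
      have e₁ : (fun x => SimpleFunc.piecewise s hs (SimpleFunc.const X c) (SimpleFunc.const X 0) x *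
          SimpleFunc.piecewise t ht (SimpleFunc.const X d) (SimpleFunc.const X 0) (T^[j] x)) =
          fun x => (c * d) * (s ∩ T^[j] ⁻¹' t).indicator 1 x := by
        ext x
        by_cases hx : x ∈ s <;> by_cases hx' : T^[j] x ∈ t <;>
          simp [SimpleFunc.coe_piecewise, Set.piecewise, Set.indicator, hx, hx']
      rw [e₁, integral_const_mul, integral_indicator_one (hs.inter (hT.iterate j ht)), e₀, e₀]
      have e₂ : c * d * μ.real (s ∩ T^[j] ⁻¹' t) - c * μ.real s * (d * μ.real t) =
          (c * d) * (μ.real (s ∩ T^[j] ⁻¹' t) - μ.real s * μ.real t) := by ring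
      rw [e₂, abs_mul]
      calc |c * d| * |μ.real (s ∩ T^[j] ⁻¹' t) - μ.real s * μ.real t|
          ≤ (|c * d| + 1) * (η / (|c * d| + 1)) :=
            mul_le_mul (by linarith) (hr j hj hj') (abs_nonneg _) (by positivity)
        _ = η := by field_simp

/-- For a window mixing transformation there are finitely many times along which the averages of
`f · f ∘ T ^ d` are small in mean, for all large windows and all `d` in them. -/
theorem IsWindowMixing.exists_integral_abs_average_le {X : Type*} [MeasurableSpace X]
    {μ : Measure X} [IsProbabilityMeasure μ] {T : X → X} {M : ℕ → ℕ → ℕ} {n : ℕ → ℕ}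
    (hT : MeasurePreserving T μ μ) (hW : IsWindowMixing μ T M n) (hM : ∀ r k, r * k ≤ M r k)
    (hn : ∀ r, r ≤ n r) {f : SimpleFunc X ℝ} (hf : ∀ x, |f x| ≤ 1) (hf0 : ∫ x, f x ∂μ = 0)
    {η : ℝ} (hη : 0 < η) :
    ∃ (L : ℕ) (l : ℕ → ℕ), 0 < L ∧ ∀ᶠ r in atTop, ∀ d, n r ≤ d → d ≤ M r (n r) →
      ∫ x, |(∑ a ∈ Finset.range L, f (T^[l a] x) * f (T^[l a + d] x)) / L| ∂μ ≤ η := by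
  have hTm := hT.measurable
  -- Makes the diagonal contribution 1/L at most η²/8.
  obtain ⟨L, hL⟩ := exists_nat_gt (8 / η ^ 2)
  have hL0 : (0 : ℝ) < L := lt_trans (by positivity) hL
  have hLpos : 0 < L := by exact_mod_cast hL0
  obtain ⟨δ, hδ, hδη⟩ : ∃ δ : ℝ, 0 < δ ∧ δ ^ 2 ≤ η ^ 2 / 16 :=
    ⟨η / 4, by positivity, by ring_nf; rfl⟩
  -- A single window with r₀ ≥ L already contains q, 2q, ..., (L-1)q for q = n r₀, because r₀ q ≤ M
  -- r₀ q. Thus f decorrelates from its translates along these multiples.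
  obtain ⟨r₀, hr₀, hLr₀⟩ := ((hW.simpleFunc hTm f f δ hδ).and (eventually_ge_atTop L)).exists
  rw [hf0, zero_mul] at hr₀
  simp only [sub_zero] at hr₀
  set q := n r₀
  have hq : 0 < q := (hLpos.trans_le hLr₀).trans_le (hn r₀)
  have hcorr : ∀ k, 1 ≤ k → k < L → |∫ x, f x * f (T^[k * q] x) ∂μ| ≤ δ := by
    intro k hk hkL
    refine hr₀ (k * q) (Nat.le_mul_of_pos_left _ hk) ?_
    exact (Nat.mul_le_mul_right q (hkL.le.trans hLr₀)).trans (hM r₀ q)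
  -- The cross term for indices whose difference is k is the correlation of F k with itself at time
  -- d, hence close to the square of the integral of F k once d lies in a late window.
  set F : ℕ → SimpleFunc X ℝ := fun k => f * f.comp (T^[k * q]) (hTm.iterate _)
  have hF : ∀ k x, F k x = f x * f (T^[k * q] x) := fun k x => rfl
  have hev : ∀ᶠ r in atTop, ∀ k ∈ Finset.range L, ∀ j, n r ≤ j → j ≤ M r (n r) →
      |∫ x, F k x * F k (T^[j] x) ∂μ - (∫ x, F k x ∂μ) * ∫ x, F k x ∂μ| ≤ η ^ 2 / 16 := by
    rw [eventually_all_finset]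
    exact fun k _ => hW.simpleFunc hTm (F k) (F k) _ (by positivity)
  refine ⟨L, fun a => a * q, hLpos, hev.mono fun r hr d hd hd' => ?_⟩
  have hm := fun k => hTm.iterate k
  have hfm := f.measurable
  have := integral_abs_average_mul_le (γ := μ) (u := fun _ => 1) measurable_const (by simp)
    (w := fun a x => f (T^[a * q] x) * f (T^[a * q + d] x))
    (fun a => (hfm.comp (hm _)).mul (hfm.comp (hm _)))
    (fun a x => by
      rw [abs_mul]; exact mul_le_one₀ (hf _) (abs_nonneg _) (hf _)) hLpos
    (κ := η ^ 2 / 8) (by positivity) ?_ (half_pos hη)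
  · simp only [mul_one, integral_const, probReal_univ, smul_eq_mul] at this
    refine this.trans ?_
    have h₁ : 1 / (L : ℝ) ≤ η ^ 2 / 8 := by
      rw [div_le_div_iff₀ hL0 (by norm_num)]
      rw [div_lt_iff₀ (by positivity)] at hL
      linarith
    have h₂ : (1 / (L : ℝ) + η ^ 2 / 8) / (η / 2) ≤ η / 2 := by
      rw [div_le_iff₀ (by positivity)]
      nlinarith
    linarith
  · intro a ha b hb hab
    obtain ⟨k, rfl⟩ := Nat.exists_eq_add_of_lt hab
    have hk : k + 1 < L := by omega
    have h₁ : ∫ x, f (T^[a * q] x) * f (T^[a * q + d] x) *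
        (f (T^[(a + k + 1) * q] x) * f (T^[(a + k + 1) * q + d] x)) * 1 ∂μ =
        ∫ x, F (k + 1) x * F (k + 1) (T^[d] x) ∂μ := by
      rw [← (hT.iterate (a * q)).integral_comp_of_measurable
        (g := fun x => F (k + 1) x * F (k + 1) (T^[d] x))
        ((F (k + 1)).measurable.mul ((F (k + 1)).measurable.comp (hm d)))]
      refine integral_congr_ae (ae_of_all _ fun x => ?_)
      simp only [hF, ← Function.iterate_add_apply]
      rw [show (a + k + 1) * q = (k + 1) * q + a * q by ring, add_comm d (a * q),
        add_right_comm _ _ d, add_assoc _ d, add_comm d (a * q)]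
      ring
    have h₂ := (abs_le.1 (hr (k + 1) (Finset.mem_range.2 hk) d hd hd')).2
    have h₃ : (∫ x, F (k + 1) x ∂μ) * ∫ x, F (k + 1) x ∂μ ≤ δ ^ 2 := by
      rw [← abs_mul_abs_self, sq]
      have := hcorr (k + 1) (by omega) hk
      exact mul_le_mul this this (abs_nonneg _) hδ.le
    rw [h₁]
    linarith

/-! ### Joinings -/

namespace IsJoining

variable {X Y : Type*} [MeasurableSpace X] [MeasurableSpace Y] {μ : Measure X} {ν : Measure Y}
  {T : X → X} {S : Y → Y} {γ : Measure (X × Y)}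

theorem measurePreserving_fst (hγ : IsJoining μ ν T S γ) : MeasurePreserving Prod.fst γ μ :=
  ⟨measurable_fst, hγ.map_fst⟩

theorem measurePreserving_snd (hγ : IsJoining μ ν T S γ) : MeasurePreserving Prod.snd γ ν :=
  ⟨measurable_snd, hγ.map_snd⟩

theorem isProbabilityMeasure [IsProbabilityMeasure μ] (hγ : IsJoining μ ν T S γ) :
    IsProbabilityMeasure γ :=
  ⟨by simpa using hγ.measurePreserving_fst.measure_preimage MeasurableSet.univ.nullMeasurableSet⟩

theorem measurePreserving (hγ : IsJoining μ ν T S γ) (hT : Measurable T) (hS : Measurable S) :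
    MeasurePreserving (Prod.map T S) γ γ :=
  ⟨hT.prodMap hS, hγ.invariant⟩

theorem integral_comp_iterate (hγ : IsJoining μ ν T S γ) (hT : Measurable T) (hS : Measurable S)
    {h : X → Y → ℝ} (hh : Measurable fun z : X × Y => h z.1 z.2) (k : ℕ) :
    ∫ z, h (T^[k] z.1) (S^[k] z.2) ∂γ = ∫ z, h z.1 z.2 ∂γ := by
  have := ((hγ.measurePreserving hT hS).iterate k).integral_comp_of_measurable hh
  simpa only [Prod.map_iterate, Prod.map_fst, Prod.map_snd] using this

/-- The conditional expectation, given the second coordinate, of a simple function of the first. -/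
theorem exists_integral_mul_eq [IsProbabilityMeasure μ] [IsProbabilityMeasure ν]
    (hγ : IsJoining μ ν T S γ) (f : SimpleFunc X ℝ) :
    ∃ (ψ : Y → ℝ) (K : ℝ), Measurable ψ ∧ (∀ y, |ψ y| ≤ K) ∧
      ∀ v : Y → ℝ, Measurable v → (∀ y, |v y| ≤ 1) →
        ∫ z, f z.1 * v z.2 ∂γ = ∫ y, ψ y * v y ∂ν := by
  have := hγ.isProbabilityMeasure
  induction f using SimpleFunc.induction with
  | @add f₁ f₂ _ h₁ h₂ =>
    obtain ⟨ψ₁, K₁, hψ₁, hK₁, h₁⟩ := h₁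
    obtain ⟨ψ₂, K₂, hψ₂, hK₂, h₂⟩ := h₂
    refine ⟨ψ₁ + ψ₂, K₁ + K₂, hψ₁.add hψ₂,
      fun y => (abs_add_le _ _).trans (add_le_add (hK₁ y) (hK₂ y)), fun v hv hv1 => ?_⟩
    have hi : ∀ f : SimpleFunc X ℝ, Integrable (fun z : X × Y => f z.1 * v z.2) γ := fun f => by
      obtain ⟨C, hC⟩ := SimpleFunc.exists_bound f
      refine integrable_of_bounded_measurable (K := C)
        ((f.measurable.comp measurable_fst).mul (hv.comp measurable_snd)) (ae_of_all _ fun z => ?_)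
      rw [abs_mul]
      exact (mul_le_of_le_one_right (abs_nonneg _) (hv1 _)).trans (hC _)
    have hi' : ∀ {ψ : Y → ℝ} {K : ℝ}, Measurable ψ → (∀ y, |ψ y| ≤ K) →
        Integrable (fun y => ψ y * v y) ν := fun {ψ K} hψ hK => by
      refine integrable_of_bounded_measurable (K := K) (hψ.mul hv) (ae_of_all _ fun y => ?_)
      rw [abs_mul]
      exact (mul_le_of_le_one_right (abs_nonneg _) (hv1 _)).trans (hK _)
    simp only [SimpleFunc.coe_add, Pi.add_apply, add_mul]
    rw [integral_add (hi f₁) (hi f₂), integral_add (hi' hψ₁ hK₁) (hi' hψ₂ hK₂), h₁ v hv hv1,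
      h₂ v hv hv1]
  | const c hs =>
    rename_i s
    -- The part of ν lying over s under γ; its density with respect to ν is the conditional
    -- probability of s. It is at most 1 only almost everywhere, whence the truncation below.
    set κ := (γ.restrict (Prod.fst ⁻¹' s)).map Prod.snd
    have hκν : κ ≤ ν := by
      rw [← hγ.map_snd]
      exact Measure.map_mono Measure.restrict_le_self measurable_snd
    have : IsFiniteMeasure κ := inferInstance
    set D := fun y => (κ.rnDeriv ν y).toReal
    have hD : Measurable D := (Measure.measurable_rnDeriv κ ν).ennreal_toReal
    have hD1 : ∀ᵐ y ∂ν, D y ≤ 1 := by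
      filter_upwards [Measure.rnDeriv_le_one_of_le hκν] with y hy
      exact ENNReal.toReal_mono ENNReal.one_ne_top hy
    refine ⟨fun y => c * min (D y) 1, |c|, (hD.min measurable_const).const_mul c, fun y => ?_,
      fun v hv hv1 => ?_⟩
    · rw [abs_mul]
      refine mul_le_of_le_one_right (abs_nonneg _) ?_
      rw [abs_of_nonneg (le_min ENNReal.toReal_nonneg zero_le_one)]
      exact min_le_right _ _
    · have h₁ : ∫ y, c * min (D y) 1 * v y ∂ν = c * ∫ y, v y ∂κ := by
        rw [← integral_rnDeriv_smul (Measure.absolutelyContinuous_of_le hκν), ← integral_const_mul]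
        refine integral_congr_ae ?_
        filter_upwards [hD1] with y hy
        rw [min_eq_left hy, smul_eq_mul, mul_assoc]
      rw [h₁, integral_map measurable_snd.aemeasurable hv.aestronglyMeasurable,
        ← integral_indicator (measurable_fst hs), ← integral_const_mul]
      refine integral_congr_ae (ae_of_all _ fun z => ?_)
      by_cases hz : z.1 ∈ s <;> simp [SimpleFunc.coe_piecewise, Set.piecewise, hz]

end IsJoining

/-! ### Vanishing of correlations in joinings -/

namespace IsJoining

variable {X Y : Type*} [MeasurableSpace X] [MeasurableSpace Y] {μ : Measure X} {ν : Measure Y}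
  {T : X → X} {γ : Measure (X × Y)}

/-- Conditioning on the second coordinate turns f into a function on Y, and ergodicity decorrelates
its product with g from every almost invariant u. -/
theorem exists_abs_integral_mul_mul_sub_le [IsProbabilityMeasure μ] [IsProbabilityMeasure ν]
    {S : Y → Y} (hγ : IsJoining μ ν T S γ) (hS : Ergodic S ν) (f : SimpleFunc X ℝ) {g : Y → ℝ}
    (hg : Measurable g) (hg1 : ∀ y, |g y| ≤ 1) {η : ℝ} (hη : 0 < η) :
    ∃ ε : ℝ, 0 < ε ∧ ∀ u : Y → ℝ, Measurable u → (∀ y, 0 ≤ u y ∧ u y ≤ 1) →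
      ∫ y, |u (S y) - u y| ∂ν ≤ ε →
      |∫ z, f z.1 * (g z.2 * u z.2) ∂γ - (∫ z, f z.1 * g z.2 ∂γ) * ∫ y, u y ∂ν| ≤ η := by
  obtain ⟨ψ, K, hψ, hK, h⟩ := hγ.exists_integral_mul_eq f
  obtain ⟨ε, hε, hu⟩ := hS.exists_abs_integral_mul_sub_le (hψ.mul hg) (K := K)
    (fun y => by
      simp only [Pi.mul_apply, abs_mul]
      exact (mul_le_of_le_one_right (abs_nonneg _) (hg1 y)).trans (hK y)) hη
  refine ⟨ε, hε, fun u hum hu1 hinv => ?_⟩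
  rw [h g hg hg1, h (fun y => g y * u y) (hg.mul hum) fun y => by
    rw [abs_mul, abs_of_nonneg (hu1 y).1]; exact mul_le_one₀ (hg1 y) (hu1 y).1 (hu1 y).2]
  simpa only [Pi.mul_apply, mul_assoc] using hu u hum hu1 hinv

/-- Correlations of a window mixing transformation stay small when they are weighted by an almost
invariant function of the other coordinate. -/
theorem exists_abs_integral_corr_le [IsProbabilityMeasure μ] [IsProbabilityMeasure ν] {S : Y → Y}
    {M : ℕ → ℕ → ℕ} {n : ℕ → ℕ} (hγ : IsJoining μ ν T S γ) (hT : MeasurePreserving T μ μ)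
    (hS : MeasurePreserving S ν ν) (hW : IsWindowMixing μ T M n) (hM : ∀ r k, r * k ≤ M r k)
    (hn : ∀ r, r ≤ n r) {f : SimpleFunc X ℝ} (hf : ∀ x, |f x| ≤ 1) (hf0 : ∫ x, f x ∂μ = 0)
    {η : ℝ} (hη : 0 < η) :
    ∃ ε : ℝ, 0 < ε ∧ ∀ᶠ r in atTop, ∀ u : Y → ℝ, Measurable u → (∀ y, 0 ≤ u y ∧ u y ≤ 1) →
      ∫ y, |u (S y) - u y| ∂ν ≤ ε → ∀ m d, n r ≤ d → d ≤ M r (n r) →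
        ∫ z, f (T^[m] z.1) * f (T^[m + d] z.1) * u z.2 ∂γ ≤ η := by
  have := hγ.isProbabilityMeasure
  obtain ⟨L, l, hL, hev⟩ := hW.exists_integral_abs_average_le hT hM hn hf hf0 (half_pos hη)
  have hLr : (0 : ℝ) < L := by exact_mod_cast hL
  set B := (Finset.range L).sup l
  have hB : ∀ a < L, l a ≤ B := fun a ha => Finset.le_sup (Finset.mem_range.2 ha)
  -- Here ε depends only on the finitely many shifts l a, all at most B, and not on r; so it can be
  -- fixed before the window.
  refine ⟨η / (2 * (B + 1)), by positivity, hev.mono fun r hr u hu hu1 hinv m d hd hd' => ?_⟩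
  set ε := η / (2 * (B + 1)) with hε
  have hε0 : 0 < ε := by positivity
  have hfm := fun k => f.measurable.comp (hT.measurable.iterate k)
  have hSm := fun k => hS.measurable.iterate k
  have hu1' : ∀ y, |u y| ≤ 1 := fun y => abs_le.2 ⟨by linarith [(hu1 y).1], (hu1 y).2⟩
  have hf2 : ∀ i j x, |f (T^[i] x) * f (T^[j] x)| ≤ 1 := fun i j x => by
    rw [abs_mul]; exact mul_le_one₀ (hf _) (abs_nonneg _) (hf _)
  have hi : ∀ i j k, Integrable (fun z : X × Y => f (T^[i] z.1) * f (T^[j] z.1) * u (S^[k] z.2)) γ :=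
    fun i j k => integrable_of_bounded_measurable (K := 1)
      ((((hfm i).comp measurable_fst).mul ((hfm j).comp measurable_fst)).mul
        ((hu.comp (hSm k)).comp measurable_snd))
      (ae_of_all _ fun z => by
        rw [abs_mul]; exact mul_le_one₀ (hf2 _ _ _) (abs_nonneg _) (hu1' _))
  have hi0 : ∀ i j, Integrable (fun z : X × Y => f (T^[i] z.1) * f (T^[j] z.1) * u z.2) γ :=
    fun i j => hi i j 0
  set J := ∫ z, f (T^[m] z.1) * f (T^[m + d] z.1) * u z.2 ∂γ with hJ
  -- Invariance of γ shifts the whole integrand by l a, and undoing the shift in u costs at most l a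
  -- · ε ≤ η/2. The average over a is then small by mixing, whatever the weight.
  have hstep : ∀ a ∈ Finset.range L,
      J ≤ ∫ z, f (T^[l a + m] z.1) * f (T^[l a + d + m] z.1) * u z.2 ∂γ + η / 2 := by
    intro a ha
    have h₁ : J = ∫ z, f (T^[l a + m] z.1) * f (T^[l a + d + m] z.1) * u (S^[l a] z.2) ∂γ := by
      rw [hJ, ← hγ.integral_comp_iterate hT.measurable hS.measurable
        (h := fun x y => f (T^[m] x) * f (T^[m + d] x) * u y)
        ((((hfm _).comp measurable_fst).mul ((hfm _).comp measurable_fst)).mul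
          (hu.comp measurable_snd)) (l a)]
      refine integral_congr_ae (ae_of_all _ fun z => ?_)
      simp only [← Function.iterate_add_apply]
      rw [add_comm m (l a), show l a + d + m = m + d + l a by ring]
    have hdi : Integrable (fun z : X × Y => |u (S^[l a] z.2) - u z.2|) γ :=
      integrable_of_bounded_measurable (K := 1)
        (((hu.comp (hSm _)).sub hu).abs.comp measurable_snd) (ae_of_all _ fun z => by
          rw [abs_abs, abs_le]
          constructor <;> linarith [(hu1 z.2).1, (hu1 z.2).2, (hu1 (S^[l a] z.2)).1,
            (hu1 (S^[l a] z.2)).2])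
    have h₂ : J ≤ ∫ z, (f (T^[l a + m] z.1) * f (T^[l a + d + m] z.1) * u z.2 +
        |u (S^[l a] z.2) - u z.2|) ∂γ := by
      rw [h₁]
      refine integral_mono (hi _ _ _) ((hi0 _ _).add hdi) fun z => ?_
      have h₃ : f (T^[l a + m] z.1) * f (T^[l a + d + m] z.1) * (u (S^[l a] z.2) - u z.2) ≤
          |u (S^[l a] z.2) - u z.2| := by
        refine (le_abs_self _).trans ?_
        rw [abs_mul]
        exact mul_le_of_le_one_left (abs_nonneg _) (hf2 _ _ _)
      simp only
      linarith
    rw [integral_add (hi0 _ _) hdi] at h₂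
    have h₄ : ∫ z : X × Y, |u (S^[l a] z.2) - u z.2| ∂γ ≤ η / 2 := by
      rw [hγ.measurePreserving_snd.integral_comp_of_measurable
        (g := fun y => |u (S^[l a] y) - u y|) ((hu.comp (hSm _)).sub hu).abs]
      refine (integral_abs_comp_iterate_sub_le hS hu hu1 hinv (l a)).trans ?_
      have h₅ : (l a : ℝ) ≤ B + 1 := by
        have := hB a (Finset.mem_range.1 ha)
        have : (l a : ℝ) ≤ B := by exact_mod_cast this
        linarith
      calc (l a : ℝ) * ε ≤ (B + 1) * ε := mul_le_mul_of_nonneg_right h₅ hε0.le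
        _ = η / 2 := by rw [hε]; field_simp
    linarith
  have hsum := Finset.sum_le_sum hstep
  rw [Finset.sum_const, Finset.card_range, nsmul_eq_mul, Finset.sum_add_distrib, Finset.sum_const,
    Finset.card_range, nsmul_eq_mul, ← integral_finsetSum _ fun a _ => hi0 _ _] at hsum
  have hav : (∫ z : X × Y, ∑ a ∈ Finset.range L,
      f (T^[l a + m] z.1) * f (T^[l a + d + m] z.1) * u z.2 ∂γ) / L ≤ η / 2 := by
    have hwm : Measurable fun x =>
        |(∑ a ∈ Finset.range L, f (T^[l a] x) * f (T^[l a + d] x)) / (L : ℝ)| :=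
      ((Finset.measurable_sum _ fun a _ => (hfm _).mul (hfm _)).div_const _).abs
    have hw1 : ∀ x, |(∑ a ∈ Finset.range L, f (T^[l a] x) * f (T^[l a + d] x)) / (L : ℝ)| ≤ 1 := by
      intro x
      rw [abs_div, abs_of_pos hLr, div_le_one hLr]
      refine (Finset.abs_sum_le_sum_abs _ _).trans
        ((Finset.sum_le_sum fun a _ => hf2 _ _ _).trans ?_)
      simp
    have hwi : Integrable (fun z : X × Y =>
        |(∑ a ∈ Finset.range L, f (T^[l a] (T^[m] z.1)) * f (T^[l a + d] (T^[m] z.1))) / (L : ℝ)|) γ :=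
      integrable_of_bounded_measurable (K := 1)
        ((hwm.comp (hT.measurable.iterate m)).comp measurable_fst)
        (ae_of_all _ fun z => by rw [abs_abs]; exact hw1 _)
    refine le_trans ?_ (hr d hd hd')
    rw [← ((hT.iterate m).comp hγ.measurePreserving_fst).integral_comp_of_measurable hwm,
      ← integral_div]
    refine integral_mono ((integrable_finsetSum _ fun a _ => hi0 _ _).div_const _) hwi fun z => ?_
    simp only [Function.comp_apply, ← Function.iterate_add_apply, ← Finset.sum_mul]
    rw [mul_div_right_comm]
    refine (le_abs_self _).trans ?_
    rw [abs_mul]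
    exact mul_le_of_le_one_right (abs_nonneg _) (hu1' _)
  rw [div_le_iff₀ hLr] at hav
  have : (L : ℝ) * J ≤ L * η := by linarith
  exact le_of_mul_le_mul_left this hLr

/-- A window mixing transformation is uncorrelated, in every joining with an ergodic `S`, from each
function `g` along which `S` is partially rigid at tuples of times from the windows. -/
theorem integral_mul_eq_zero [IsProbabilityMeasure μ] [IsProbabilityMeasure ν] {S : Y ≃ᵐ Y}
    {M : ℕ → ℕ → ℕ} {n : ℕ → ℕ} (hγ : IsJoining μ ν T S γ) (hT : MeasurePreserving T μ μ)
    (hS : Ergodic S ν) (hW : IsWindowMixing μ T M n) (hM : ∀ r k, r * k ≤ M r k)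
    (hn : ∀ r, r ≤ n r) {f : SimpleFunc X ℝ} (hf : ∀ x, |f x| ≤ 1) (hf0 : ∫ x, f x ∂μ = 0)
    {g : Y → ℝ} (hg : Measurable g) (hg1 : ∀ y, |g y| ≤ 1) {c : ℕ → ℝ} (hc : ∀ N, 0 < c N)
    (hrig : ∀ N ε, 0 < ε → ∀ᶠ r in atTop, ∃ (u : Y → ℝ) (m : ℕ → ℕ), Measurable u ∧
      (∀ y, 0 ≤ u y ∧ u y ≤ 1) ∧ (∀ i < N, m i + n r ≤ m (i + 1)) ∧
      (∀ i ≤ N, m i ≤ M r (n r)) ∧ c N ≤ ∫ y, u y ∂ν ∧ ∫ y, |u (S y) - u y| ∂ν ≤ ε ∧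
      ∀ i ≤ N, ∫ y, u y * |g (S^[m i] y) - g y| ∂ν ≤ ε) :
    ∫ z, f z.1 * g z.2 ∂γ = 0 := by
  have := hγ.isProbabilityMeasure
  have hSm := hS.toMeasurePreserving
  set I := ∫ z, f z.1 * g z.2 ∂γ with hI
  by_contra hI0
  have hIpos : 0 < |I| := abs_pos.2 hI0
  -- Final balance: with N > 1/s² and δ small against s · c N, the argument yields 4sU = |I| U ≤
  -- (5/2) sU, although U > 0.
  obtain ⟨s, hs, hsI⟩ : ∃ s : ℝ, 0 < s ∧ 4 * s = |I| := ⟨|I| / 4, by positivity, by ring⟩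
  obtain ⟨N, hN⟩ := exists_nat_gt (1 / s ^ 2)
  have hNr : (0 : ℝ) < N := lt_trans (by positivity) hN
  have hNpos : 0 < N := by exact_mod_cast hNr
  obtain ⟨δ, hδ, hδs, hδ1⟩ : ∃ δ : ℝ, 0 < δ ∧ δ / s ≤ s * c N / 4 ∧ 2 * δ ≤ s * c N / 4 := by
    have := hc N
    refine ⟨min (s * (s * c N / 4)) (s * c N / 8), by positivity, ?_, ?_⟩
    · rw [div_le_iff₀ hs, mul_comm _ s]; exact min_le_left _ _
    · linarith [min_le_right (s * (s * c N / 4)) (s * c N / 8)]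
  obtain ⟨ε₁, hε₁, h₁⟩ := hγ.exists_abs_integral_mul_mul_sub_le hS f hg hg1 hδ
  obtain ⟨ε₂, hε₂, h₂⟩ := hγ.exists_abs_integral_corr_le hT hSm hW hM hn hf hf0 hδ
  obtain ⟨r, ⟨u, m, hu, hu1, hm, hmM, hmass, hinv, hrg⟩, h₂⟩ :=
    ((hrig N (min δ (min ε₁ ε₂)) (by positivity)).and h₂).exists
  have hfm := fun k => f.measurable.comp (hT.measurable.iterate k)
  have hSk := fun k => hSm.measurable.iterate k
  have hmadd : ∀ i j, i < j → j ≤ N → m i + n r ≤ m j := by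
    intro i j hij
    induction j, hij using Nat.le_induction with
    | base => exact fun h => hm i (by omega)
    | succ j hij ih => exact fun h => by linarith [ih (by omega), hm j (by omega)]
  set w : ℕ → X × Y → ℝ := fun i z => f (T^[m i] z.1)
  have hwm : ∀ i, Measurable (w i) := fun i => (hfm _).comp measurable_fst
  have hw1 : ∀ i z, |w i z| ≤ 1 := fun i z => hf _
  have hint_u : ∫ z : X × Y, u z.2 ∂γ = ∫ y, u y ∂ν :=
    hγ.measurePreserving_snd.integral_comp_of_measurable hu
  -- Differences of the times are at least n r and at most M r (n r), so they lie in the mixing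
  -- window and the weighted cross terms are at most δ.
  have hU := integral_abs_average_mul_le (γ := γ) (u := fun z => u z.2) (hu.comp measurable_snd)
    (fun z => hu1 _) hwm hw1 hNpos hδ.le (fun a ha b hb hab => by
      have h₃ := hmadd a b hab hb.le
      have h₄ := h₂ u hu hu1 (hinv.trans ((min_le_right _ _).trans (min_le_right _ _))) (m a)
        (m b - m a) (by omega) (by have := hmM b hb.le; omega)
      rwa [Nat.add_sub_cancel' (by omega)] at h₄) hs
  rw [hint_u] at hU
  set U := ∫ y, u y ∂ν
  have hwi : ∀ i, Integrable (fun z : X × Y => w i z * (g z.2 * u z.2)) γ := fun i =>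
    integrable_of_bounded_measurable (K := 1)
      ((hwm i).mul ((hg.comp measurable_snd).mul (hu.comp measurable_snd)))
      (ae_of_all _ fun z => by
        rw [abs_mul, abs_mul, abs_of_nonneg (hu1 _).1]
        exact mul_le_one₀ (hw1 _ _) (mul_nonneg (abs_nonneg _) (hu1 _).1)
          (mul_le_one₀ (hg1 _) (hu1 _).1 (hu1 _).2))
  have hstep : ∀ i ∈ Finset.range N, |∫ z, w i z * (g z.2 * u z.2) ∂γ - I * U| ≤ 2 * δ := by
    intro i hi
    have hiN : i ≤ N := (Finset.mem_range.1 hi).le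
    -- Pulling u back by S^{-m i} keeps its integral and its almost invariance exactly, however
    -- large m i is; invariance of γ then brings the weight u back.
    set v : Y → ℝ := fun y => u (S.symm^[m i] y)
    have hSs : MeasurePreserving S.symm ν ν := hSm.symm S
    have hvm : Measurable v := hu.comp (hSs.measurable.iterate _)
    have hvS : ∀ y, v (S^[m i] y) = u y := fun y =>
      congrArg u ((Function.LeftInverse.iterate S.symm_apply_apply (m i)) y)
    have hvint : ∫ y, v y ∂ν = U := (hSs.iterate (m i)).integral_comp_of_measurable hu
    have hvinv : ∫ y, |v (S y) - v y| ∂ν ≤ ε₁ := by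
      have hcomm : ∀ y, S.symm^[m i] (S y) = S (S.symm^[m i] y) := fun y =>
        (Function.Commute.iterate_left (f := S.symm) (g := S)
          (fun y => by rw [S.symm_apply_apply, S.apply_symm_apply]) (m i)) y
      have h₃ : ∫ y, |v (S y) - v y| ∂ν = ∫ y, |u (S y) - u y| ∂ν := by
        rw [← (hSs.iterate (m i)).integral_comp_of_measurable
          (g := fun y => |u (S y) - u y|) ((hu.comp S.measurable).sub hu).abs]
        simp only [v, hcomm]
      rw [h₃]
      exact hinv.trans ((min_le_right _ _).trans (min_le_left _ _))
    have hmain := h₁ v hvm (fun y => hu1 _) hvinv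
    rw [hvint, ← hγ.integral_comp_iterate hT.measurable S.measurable
      (h := fun x y => f x * (g y * v y)) ((f.measurable.comp measurable_fst).mul
        ((hg.comp measurable_snd).mul (hvm.comp measurable_snd))) (m i)] at hmain
    simp only [hvS] at hmain
    have hbi : Integrable (fun z : X × Y => w i z * (g (S^[m i] z.2) * u z.2)) γ :=
      integrable_of_bounded_measurable (K := 1)
        ((hwm i).mul (((hg.comp (hSk _)).comp measurable_snd).mul (hu.comp measurable_snd)))
        (ae_of_all _ fun z => by
          rw [abs_mul, abs_mul, abs_of_nonneg (hu1 _).1]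
          exact mul_le_one₀ (hw1 _ _) (mul_nonneg (abs_nonneg _) (hu1 _).1)
            (mul_le_one₀ (hg1 _) (hu1 _).1 (hu1 _).2))
    have herr : |∫ z, w i z * (g z.2 * u z.2) ∂γ - ∫ z, w i z * (g (S^[m i] z.2) * u z.2) ∂γ|
        ≤ δ := by
      rw [← integral_sub (hwi i) hbi]
      have hem : Measurable fun y => u y * |g (S^[m i] y) - g y| :=
        hu.mul ((hg.comp (hSk _)).sub hg).abs
      have hei : Integrable (fun z : X × Y => u z.2 * |g (S^[m i] z.2) - g z.2|) γ :=
        integrable_of_bounded_measurable (K := 2) (hem.comp measurable_snd) (ae_of_all _ fun z => by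
          rw [abs_mul, abs_abs, abs_of_nonneg (hu1 _).1]
          refine (mul_le_of_le_one_left (abs_nonneg _) (hu1 _).2).trans ((abs_sub _ _).trans ?_)
          linarith [hg1 (S^[m i] z.2), hg1 z.2])
      refine abs_integral_le_integral_abs.trans (le_trans ?_ ((hrg i hiN).trans (min_le_left _ _)))
      rw [← hγ.measurePreserving_snd.integral_comp_of_measurable hem]
      refine integral_mono ((hwi i).sub hbi).abs hei fun z => ?_
      have e : w i z * (g z.2 * u z.2) - w i z * (g (S^[m i] z.2) * u z.2) =
          w i z * (u z.2 * (g z.2 - g (S^[m i] z.2))) := by ring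
      simp only [e]
      rw [abs_mul, abs_mul, abs_of_nonneg (hu1 _).1, abs_sub_comm (g z.2)]
      exact mul_le_of_le_one_left (mul_nonneg (hu1 _).1 (abs_nonneg _)) (hw1 _ _)
    have := abs_sub_le (∫ z, w i z * (g z.2 * u z.2) ∂γ)
      (∫ z, w i z * (g (S^[m i] z.2) * u z.2) ∂γ) (I * U)
    linarith
  have hsum : |(∑ i ∈ Finset.range N, ∫ z, w i z * (g z.2 * u z.2) ∂γ) / N - I * U| ≤ 2 * δ := by
    have e : (∑ i ∈ Finset.range N, ∫ z, w i z * (g z.2 * u z.2) ∂γ) / N - I * U =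
        (∑ i ∈ Finset.range N, (∫ z, w i z * (g z.2 * u z.2) ∂γ - I * U)) / N := by
      rw [Finset.sum_sub_distrib, Finset.sum_const, Finset.card_range, nsmul_eq_mul, sub_div,
        mul_div_cancel_left₀ _ hNr.ne']
    rw [e, abs_div, abs_of_pos hNr, div_le_iff₀ hNr]
    refine (Finset.abs_sum_le_sum_abs _ _).trans ((Finset.sum_le_sum hstep).trans ?_)
    rw [Finset.sum_const, Finset.card_range, nsmul_eq_mul, mul_comm]
  have hle : |(∑ i ∈ Finset.range N, ∫ z, w i z * (g z.2 * u z.2) ∂γ) / N| ≤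
      ∫ z, |(∑ i ∈ Finset.range N, w i z) / N| * u z.2 ∂γ := by
    rw [← integral_finsetSum _ fun i _ => hwi i, ← integral_div]
    refine abs_integral_le_integral_abs.trans ?_
    have hWm : Measurable fun z => (∑ i ∈ Finset.range N, w i z) / (N : ℝ) :=
      (Finset.measurable_sum _ fun i _ => hwm i).div_const _
    have hW1 : ∀ z, |(∑ i ∈ Finset.range N, w i z) / (N : ℝ)| ≤ 1 := fun z => by
      rw [abs_div, abs_of_pos hNr, div_le_one hNr]
      refine (Finset.abs_sum_le_sum_abs _ _).trans ((Finset.sum_le_sum fun i _ => hw1 i z).trans ?_)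
      simp
    refine integral_mono ((integrable_finsetSum _ fun i _ => hwi i).div_const _).abs
      (integrable_of_bounded_measurable (K := 1) (hWm.abs.mul (hu.comp measurable_snd))
        (ae_of_all _ fun z => by
          rw [abs_mul, abs_abs, abs_of_nonneg (hu1 _).1]
          exact mul_le_one₀ (hW1 z) (hu1 _).1 (hu1 _).2)) fun z => ?_
    simp only [← Finset.sum_mul]
    rw [mul_div_right_comm, abs_mul]
    refine mul_le_mul_of_nonneg_left ?_ (abs_nonneg _)
    rw [abs_mul, abs_of_nonneg (hu1 _).1]
    exact mul_le_of_le_one_left (hu1 _).1 (hg1 _)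
  have hU0 : 0 < U := (hc N).trans_le hmass
  have hIU : |I| * U ≤ 2 * δ + (s * U + (U / N + δ) / s) := by
    have h₃ := abs_sub_abs_le_abs_sub (I * U)
      ((∑ i ∈ Finset.range N, ∫ z, w i z * (g z.2 * u z.2) ∂γ) / N)
    rw [abs_sub_comm] at h₃
    rw [← abs_of_pos hU0, ← abs_mul, abs_of_pos hU0]
    linarith
  have h₄ : U / N / s ≤ s * U := by
    rw [div_lt_iff₀ (by positivity)] at hN
    rw [div_div, div_le_iff₀ (by positivity)]
    nlinarith
  have h₅ : s * c N ≤ s * U := mul_le_mul_of_nonneg_left hmass hs.le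
  have h₆ : 0 < s * U := by positivity
  rw [add_div] at hIU
  rw [← hsI] at hIU
  linarith

end IsJoining

/-! ### Interval exchange transformations and their joinings -/

instance : IsProbabilityMeasure lebesgueIco :=
  ⟨by
    rw [lebesgueIco, comap_subtype_coe_apply measurableSet_Ico, Set.image_univ, Subtype.range_coe,
      Real.volume_Ico]
    simp⟩

theorem integral_lebesgueIco (f : ℝ → ℝ) :
    ∫ y : Set.Ico (0 : ℝ) 1, f y ∂lebesgueIco = ∫ x in Set.Ico (0 : ℝ) 1, f x :=
  integral_subtype_comap measurableSet_Ico f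

theorem IsIET.exists_eq_rearrange {S : Set.Ico (0 : ℝ) 1 → Set.Ico (0 : ℝ) 1} (hS : IsIET S) :
    ∃ (p : ℕ) (l : Fin p → ℝ) (π : Equiv.Perm (Fin p)), l ∈ stdSimplex ℝ (Fin p) ∧
      ∀ y, (S y : ℝ) = rearrange l 1 π y := by
  obtain ⟨p, l, π, hl, hl1, h⟩ := hS
  have hls : l ∈ stdSimplex ℝ (Fin p) := ⟨fun i => (hl i).le, hl1⟩
  refine ⟨p, l, π, hls, fun y => ?_⟩
  obtain ⟨j, hj⟩ := exists_mem_piece hls 1 y.2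
  have e : ∑ i with i ≤ j, l i = leftEnd l 1 j + l j := by
    have hj' : j ∉ Finset.univ.filter fun i => i < j := by simp
    have : Finset.univ.filter (fun i => i ≤ j) = insert j (Finset.univ.filter fun i => i < j) := by
      ext i
      simp [le_iff_lt_or_eq, or_comm]
    rw [this, Finset.sum_insert hj', add_comm]
    rfl
  rw [rearrange_of_mem hls.1 π hj, h j y hj.1 (by rw [e]; exact hj.2)]
  change _ - leftEnd l 1 j + leftEnd l π j = _
  ring

theorem exists_measurableEquiv_of_eq_rearrange {S : Set.Ico (0 : ℝ) 1 → Set.Ico (0 : ℝ) 1} {p : ℕ}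
    {l : Fin p → ℝ} {π : Equiv.Perm (Fin p)} (hl : l ∈ stdSimplex ℝ (Fin p))
    (hS : ∀ y, (S y : ℝ) = rearrange l 1 π y) :
    ∃ e : Set.Ico (0 : ℝ) 1 ≃ᵐ Set.Ico (0 : ℝ) 1, ⇑e = S := by
  refine ⟨⟨⟨S, fun y => ⟨rearrange l π 1 y, (rearrange_mem_Ico_iff hl π 1 y).2 y.2⟩,
    fun y => ?_, fun y => ?_⟩, ?_, ?_⟩, rfl⟩
  · refine Subtype.ext ?_
    change rearrange l π 1 (S y) = y
    rw [hS, rearrange_rearrange hl]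
  · exact Subtype.ext (by rw [hS, rearrange_rearrange hl])
  · have h : Subtype.val ∘ S = rearrange l 1 π ∘ Subtype.val := funext hS
    refine (MeasurableEmbedding.subtype_coe measurableSet_Ico).measurable_comp_iff.1 ?_
    change Measurable (Subtype.val ∘ S)
    rw [h]
    exact (measurable_rearrange l 1 π).comp measurable_subtype_coe
  · exact ((measurable_rearrange l π 1).comp measurable_subtype_coe).subtype_mk

/-- Windows in which all exchanges of few intervals have tuples of partial rigidity times. -/
theorem exists_window_isRigidFor : ∃ M : ℕ → ℕ → ℕ, (∀ r k, r * k ≤ M r k) ∧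
    ∀ (r n p N : ℕ), 0 < p → p ≤ r → N ≤ r → ∀ l ∈ stdSimplex ℝ (Fin p), ∀ π : Equiv.Perm (Fin p),
      IsRigidFor (rearrange l 1 π) N n (M r n) (IsExchange.rigidityConst p N / 4)
        (1 / ((r : ℝ) + 1)) := by
  have h := fun (r n p N : ℕ) => exists_uniform_isRigidFor p.succ_pos N n
    (show 0 < 1 / ((r : ℝ) + 1) by positivity)
  choose M₀ hM₀ using h
  -- The term r n puts the multiples n, ..., r n into the window; the double sum dominates the
  -- bounds for all relevant p and N up to r, so any fixed exchange and N are covered for large r.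
  refine ⟨fun r n => r * n + ∑ p ∈ Finset.range (r + 1), ∑ N ∈ Finset.range (r + 1), M₀ r n p N,
    fun r k => Nat.le_add_right _ _, fun r n p N hp hpr hN l hl π => ?_⟩
  obtain ⟨p, rfl⟩ := Nat.exists_eq_succ_of_ne_zero hp.ne'
  refine (hM₀ r n p N l hl π).mono ?_
  refine le_trans ?_ (Nat.le_add_left _ _)
  refine le_trans ?_ (Finset.single_le_sum (f := fun p => ∑ N ∈ Finset.range (r + 1), M₀ r n p N)
    (fun _ _ => Nat.zero_le _) (Finset.mem_range.2 (show p < r + 1 by omega)))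
  exact Finset.single_le_sum (f := fun N => M₀ r n p N) (fun _ _ => Nat.zero_le _)
    (Finset.mem_range.2 (show N < r + 1 by omega))

/-- Uniform continuity for close points, the trivial bound 2 for the others. This turns rigidity of
the coordinate x into rigidity of every bounded continuous function of x. -/
theorem exists_abs_sub_le_add_mul {G : ℝ → ℝ} (hG : Continuous G) (hG1 : ∀ x, |G x| ≤ 1) {η : ℝ}
    (hη : 0 < η) : ∃ K : ℝ, 0 < K ∧ ∀ x ∈ Set.Ico (0 : ℝ) 1, ∀ y ∈ Set.Ico (0 : ℝ) 1,
      |G x - G y| ≤ η + K * |x - y| := by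
  have huc := isCompact_Icc.uniformContinuousOn_of_continuous (s := Set.Icc (0 : ℝ) 1)
    hG.continuousOn
  obtain ⟨δ, hδ, h⟩ := Metric.uniformContinuousOn_iff.1 huc η hη
  refine ⟨2 / δ, by positivity, fun x hx y hy => ?_⟩
  by_cases hxy : |x - y| < δ
  · have := h x (Set.Ico_subset_Icc_self hx) y (Set.Ico_subset_Icc_self hy) hxy
    rw [Real.dist_eq] at this
    have : 0 ≤ 2 / δ * |x - y| := by positivity
    linarith
  · push Not at hxy
    have h₁ : 2 ≤ 2 / δ * |x - y| := by
      calc (2 : ℝ) = 2 / δ * δ := by field_simp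
        _ ≤ 2 / δ * |x - y| := by gcongr
    have h₂ := abs_sub (G x) (G y)
    linarith [hG1 x, hG1 y]

/-- Two measures on `X × [0, 1)` are equal if the integrals of continuous functions of the second
coordinate over each cylinder of the first are. -/
theorem measure_eq_of_forall_integral_eq {X : Type*} [MeasurableSpace X]
    {γ₁ γ₂ : Measure (X × Set.Ico (0 : ℝ) 1)} [IsFiniteMeasure γ₁] [IsFiniteMeasure γ₂]
    (h : ∀ A, MeasurableSet A → ∀ G : BoundedContinuousFunction ℝ ℝ,
      ∫ z in Prod.fst ⁻¹' A, G z.2 ∂γ₁ = ∫ z in Prod.fst ⁻¹' A, G z.2 ∂γ₂) : γ₁ = γ₂ := by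
  refine Measure.ext_prod fun {A C} hA hC => ?_
  have hm : Measurable fun z : X × Set.Ico (0 : ℝ) 1 => (z.2 : ℝ) :=
    measurable_subtype_coe.comp measurable_snd
  have key : (γ₁.restrict (Prod.fst ⁻¹' A)).map (fun z => (z.2 : ℝ)) =
      (γ₂.restrict (Prod.fst ⁻¹' A)).map (fun z => (z.2 : ℝ)) := by
    refine ext_of_forall_integral_eq_of_IsFiniteMeasure fun G => ?_
    rw [integral_map hm.aemeasurable G.continuous.aestronglyMeasurable,
      integral_map hm.aemeasurable G.continuous.aestronglyMeasurable]
    exact h A hA G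
  have hC' : MeasurableSet ((↑) '' C : Set ℝ) := measurableSet_Ico.subtype_image hC
  have e : ∀ γ : Measure (X × Set.Ico (0 : ℝ) 1), γ (A ×ˢ C) =
      (γ.restrict (Prod.fst ⁻¹' A)).map (fun z => (z.2 : ℝ)) ((↑) '' C) := fun γ => by
    rw [Measure.map_apply hm hC', Measure.restrict_apply (hm hC')]
    congr 1
    ext z
    simp only [Set.mem_prod, Set.mem_inter_iff, Set.mem_preimage, 
      Subtype.val_injective.mem_set_image, and_comm]
  rw [e, e, key]

/-- Products of a mean zero simple function on X and a continuous function on [0, 1) have integral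
zero under every joining; applied to 1_A - μ(A), this identifies the joining with the product. -/
theorem areDisjoint_of_isWindowMixing {X : Type*} [MeasurableSpace X] {μ : Measure X}
    [IsProbabilityMeasure μ] {T : X → X} (hT : MeasurePreserving T μ μ) {M : ℕ → ℕ → ℕ} {n : ℕ → ℕ}
    (hM : ∀ r k, r * k ≤ M r k)
    (hR : ∀ (r n p N : ℕ), 0 < p → p ≤ r → N ≤ r → ∀ l ∈ stdSimplex ℝ (Fin p),
      ∀ π : Equiv.Perm (Fin p), IsRigidFor (rearrange l 1 π) N n (M r n)
        (IsExchange.rigidityConst p N / 4) (1 / ((r : ℝ) + 1)))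
    (hn : ∀ r, r ≤ n r) (hW : IsWindowMixing μ T M n) {S : Set.Ico (0 : ℝ) 1 → Set.Ico (0 : ℝ) 1}
    (hS : IsIET S) (hSe : Ergodic S lebesgueIco) : AreDisjoint μ lebesgueIco T S := by
  intro γ hγ
  obtain ⟨p, l, π, hl, hSl⟩ := hS.exists_eq_rearrange
  have hp := card_pos_of_mem_stdSimplex hl
  have hSk : ∀ k y, ((S^[k] y : Set.Ico (0 : ℝ) 1) : ℝ) = (rearrange l 1 π)^[k] y := by
    intro k
    induction k with
    | zero => exact fun _ => rfl
    | succ k ih =>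
      intro y
      rw [Function.iterate_succ_apply', Function.iterate_succ_apply', hSl, ih]
  obtain ⟨e, he⟩ := exists_measurableEquiv_of_eq_rearrange hl hSl
  have hSm : Measurable S := hSe.measurable
  have := hγ.isProbabilityMeasure
  have key : ∀ (f : SimpleFunc X ℝ) (G : ℝ → ℝ), (∀ x, |f x| ≤ 1) → ∫ x, f x ∂μ = 0 →
      Continuous G → (∀ x, |G x| ≤ 1) → ∫ z, f z.1 * G z.2 ∂γ = 0 := by
    intro f G hf hf0 hG hG1
    have hGm : Measurable fun y : Set.Ico (0 : ℝ) 1 => G y :=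
      hG.measurable.comp measurable_subtype_coe
    rw [← he] at hγ hSe
    refine hγ.integral_mul_eq_zero hT hSe hW hM hn hf hf0 hGm (fun y => hG1 y)
      (c := fun N => IsExchange.rigidityConst p N / 4)
      (fun N => div_pos (IsExchange.rigidityConst_pos hp N) (by norm_num)) fun N ε hε => ?_
    obtain ⟨K, hK, hGK⟩ := exists_abs_sub_le_add_mul hG hG1 (half_pos hε)
    have hsmall : ∀ᶠ r : ℕ in atTop, 1 / ((r : ℝ) + 1) ≤ min ε (ε / (2 * K)) :=
      (tendsto_one_div_add_atTop_nhds_zero_nat.eventually_lt_const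
        (show 0 < min ε (ε / (2 * K)) by positivity)).mono fun _ h => h.le
    filter_upwards [hsmall, eventually_ge_atTop p, eventually_ge_atTop N] with r hr hpr hNr
    obtain ⟨φ, m, hφ, hφ1, hm, hmM, hmass, hinv, hrig⟩ := hR r (n r) p N hp hpr hNr l hl π
    have hφm : Measurable fun y : Set.Ico (0 : ℝ) 1 => φ y :=
      hφ.measurable.comp measurable_subtype_coe
    refine ⟨fun y => φ y, m, hφm, fun y => hφ1 y, hm, hmM, ?_, ?_, fun i hi => ?_⟩
    · rw [integral_lebesgueIco φ]; exact hmass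
    · rw [he]
      simp only [hSl]
      rw [integral_lebesgueIco fun x => |φ (rearrange l 1 π x) - φ x|]
      exact hinv.trans (hr.trans (min_le_left _ _))
    · rw [he]
      have h₁ : ∫ y : Set.Ico (0 : ℝ) 1, φ y * |((S^[m i] y : Set.Ico (0 : ℝ) 1) : ℝ) - y|
          ∂lebesgueIco ≤ ε / (2 * K) := by
        simp only [hSk]
        rw [integral_lebesgueIco fun x => φ x * |(rearrange l 1 π)^[m i] x - x|]
        exact (hrig i hi).trans (hr.trans (min_le_right _ _))
      have hSi := hSm.iterate (m i)
      have hdi : Integrable (fun y : Set.Ico (0 : ℝ) 1 =>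
          φ y * |((S^[m i] y : Set.Ico (0 : ℝ) 1) : ℝ) - y|) lebesgueIco :=
        integrable_of_bounded_measurable (K := 1)
          (hφm.mul ((measurable_subtype_coe.comp hSi).sub measurable_subtype_coe).abs)
          (ae_of_all _ fun y => by
            rw [abs_mul, abs_abs, abs_of_nonneg (hφ1 _).1]
            refine mul_le_one₀ (hφ1 _).2 (abs_nonneg _) (abs_le.2 ⟨?_, ?_⟩) <;>
              linarith [y.2.1, y.2.2, (S^[m i] y).2.1, (S^[m i] y).2.2])
      calc ∫ y : Set.Ico (0 : ℝ) 1, φ y * |G (S^[m i] y : Set.Ico (0 : ℝ) 1) - G y| ∂lebesgueIco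
          ≤ ∫ y : Set.Ico (0 : ℝ) 1, (ε / 2 +
            K * (φ y * |((S^[m i] y : Set.Ico (0 : ℝ) 1) : ℝ) - y|)) ∂lebesgueIco := by
            refine integral_mono_of_nonneg
              (ae_of_all _ fun y => mul_nonneg (hφ1 _).1 (abs_nonneg _))
              ((integrable_const _).add (hdi.const_mul K)) (ae_of_all _ fun y => ?_)
            have h₂ := hGK _ (S^[m i] y).2 _ y.2
            have h₃ := mul_le_mul_of_nonneg_left h₂ (hφ1 y).1
            have h₄ : φ y * (ε / 2) ≤ ε / 2 := mul_le_of_le_one_left (by positivity) (hφ1 y).2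
            simp only
            linarith
        _ ≤ ε := by
            rw [integral_add (integrable_const _) (hdi.const_mul K), integral_const_mul]
            have h₅ : K * (ε / (2 * K)) = ε / 2 := by field_simp
            have h₆ := mul_le_mul_of_nonneg_left h₁ hK.le
            simp only [integral_const, probReal_univ, smul_eq_mul, one_mul]
            linarith
  refine measure_eq_of_forall_integral_eq fun A hA G => ?_
  set a := μ.real A
  have ha1 : a ≤ 1 := measureReal_le_one
  have ha0 : 0 ≤ a := measureReal_nonneg
  set f : SimpleFunc X ℝ :=
    SimpleFunc.piecewise A hA (SimpleFunc.const X 1) (SimpleFunc.const X 0) - SimpleFunc.const X a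
  have hf : ∀ x, f x = A.indicator 1 x - a := fun x => by
    by_cases hx : x ∈ A <;> simp [f, SimpleFunc.coe_piecewise, hx]
  have hf1 : ∀ x, |f x| ≤ 1 := fun x => by
    rw [hf]
    by_cases hx : x ∈ A
    · rw [Set.indicator_of_mem hx, Pi.one_apply, abs_of_nonneg (by linarith)]; linarith
    · rw [Set.indicator_of_notMem hx, zero_sub, abs_neg, abs_of_nonneg ha0]; exact ha1
  have hf0 : ∫ x, f x ∂μ = 0 := by
    simp only [hf]
    rw [integral_sub ((integrable_indicator_iff hA).2 (integrable_const _).integrableOn)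
      (integrable_const _), integral_indicator_one hA]
    simp [a]
  -- Scaling reduces to functions bounded by 1, as required by `key`.
  obtain ⟨s, hs, hsG⟩ : ∃ s : ℝ, 0 < s ∧ ∀ x, |s * G x| ≤ 1 := by
    refine ⟨1 / (‖G‖ + 1), by positivity, fun x => ?_⟩
    have := G.norm_coe_le_norm x
    rw [Real.norm_eq_abs] at this
    rw [abs_mul, abs_of_nonneg (by positivity), one_div, inv_mul_le_one₀ (by positivity)]
    linarith
  have h := key f (fun x => s * G x) hf1 hf0 (continuous_const.mul G.continuous) hsG
  have hGm : Measurable fun y : Set.Ico (0 : ℝ) 1 => G y :=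
    G.continuous.measurable.comp measurable_subtype_coe
  have hAm : MeasurableSet (Prod.fst ⁻¹' A : Set (X × Set.Ico (0 : ℝ) 1)) := measurable_fst hA
  have hGi : Integrable (fun z : X × Set.Ico (0 : ℝ) 1 => G z.2) γ :=
    integrable_of_bounded_measurable (K := ‖G‖) (hGm.comp measurable_snd)
      (ae_of_all _ fun z => G.norm_coe_le_norm _)
  have e₁ : ∫ z, f z.1 * (s * G z.2) ∂γ =
      s * (∫ z in Prod.fst ⁻¹' A, G z.2 ∂γ - a * ∫ z, G z.2 ∂γ) := by
    rw [← integral_indicator hAm, ← integral_const_mul, ← integral_sub (hGi.indicator hAm)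
      (hGi.const_mul a), ← integral_const_mul]
    refine integral_congr_ae (ae_of_all _ fun z => ?_)
    simp only [hf]
    by_cases hz : z.1 ∈ A
    · rw [Set.indicator_of_mem hz, Set.indicator_of_mem (show z ∈ Prod.fst ⁻¹' A from hz)]
      simp only [Pi.one_apply]; ring
    · rw [Set.indicator_of_notMem hz, Set.indicator_of_notMem (show z ∉ Prod.fst ⁻¹' A from hz)]
      ring
  have e₂ : ∫ z, G z.2 ∂γ = ∫ y, G y ∂lebesgueIco :=
    hγ.measurePreserving_snd.integral_comp_of_measurable hGm
  have e₃ : ∫ z in Prod.fst ⁻¹' A, G z.2 ∂(μ.prod lebesgueIco) = a * ∫ y, G y ∂lebesgueIco := by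
    have := setIntegral_prod_mul (μ := μ) (ν := lebesgueIco) (fun _ => (1 : ℝ)) (fun y => G y) A
      Set.univ
    simpa [Set.prod_univ, a] using this
  rw [e₁] at h
  have h' := (mul_eq_zero.1 h).resolve_left hs.ne'
  rw [e₃, ← e₂]
  linarith

/-- The windows come from the exchanges alone and are fixed before T. One countable family of open
conditions thus handles the uncountably many exchanges at once. -/
theorem mainTheorem4 {X : Type*} [MeasurableSpace X] [StandardBorelSpace X]
    (μ : Measure X) [IsProbabilityMeasure μ] [NullSingletonClass μ]
    (A : ℕ → Set X) (hA : IsDenseFamily μ A) :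
    IsGeneric μ A {T : Aut μ | ∀ S : Set.Ico (0 : ℝ) 1 → Set.Ico (0 : ℝ) 1,
      IsIET S → Ergodic S lebesgueIco → T.IsDisjointFrom lebesgueIco S} := by
  obtain ⟨M, hM, hR⟩ := exists_window_isRigidFor
  exact isGeneric_of_isWindowMixing hA M fun T n hn hW S hS hSe =>
    areDisjoint_of_isWindowMixing T.2 hM hR hn hW hS hSe
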